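/- Let $n\ge 1$, let $\mathbb{B}_n$ be the open unit ball of $\mathbb{C}^n$, $V$ Lebesgue measure on $\mathbb{B}_n$, $|E|=V(E)$, and $\langle z,w\rangle=\sum_j z_j\overline{w_j}$. For $f\in L^1(\mathbb{B}_n)$ let $$Pf(z)=\frac{n!}{\pi^n}\int_{\mathbb{B}_n}\frac{f(w)}{(1-\langle z,w\rangle)^{n+1}}\,dV(w),\qquad z\in\mathbb{B}_n,$$ be the Bergman projection, and for a function $g$ on $\mathbb{B}_n$ put $[g,P]f=g\,Pf-P(gf)$. For $z\in\mathbb{B}_n\setminus\{0\}$ let $T_z=\{w\in\mathbb{B}_n:|1-\langle z,w\rangle/|z||<1-|z|\}$, and let $T_0=\mathbb{B}_n$. Let $\mathrm{BMO}$ be the space of locally integrable $b:\mathbb{B}_n\to\mathbb{C}$ with $$\|b\|_{\mathrm{BMO}}=\sup_{z\in\mathbb{B}_n}\frac1{|T_z|}\int_{T_z}|b-\langle b\rangle_{T_z}|\,dV<\infty,\qquad \langle b\rangle_{T}=\frac1{|T|}\int_T b\,dV.$$ Let $\varphi(t)=t\log^+t$ with $\log^+t=\max\{0,\log t\}$, let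 $L\log^+L$ be the space of measurable $f:\mathbb{B}_n\to\mathbb{C}$ with $\int_{\mathbb{B}_n}\varphi(|f|/c)\,dV<\infty$ for some $c>0$, and let $\|f\|_{L\log^+L}=\inf\{c>0:\int_{\mathbb{B}_n}\varphi(|f|/c)\,dV\le1\}$. Let $\|g\|_{L^{1,\infty}}=\sup_{\lambda>0}\lambda\,|\{z\in\mathbb{B}_n:|g(z)|>\lambda\}|$, and let $L^{1,\infty}$ be the space of measurable $g$ with $\|g\|_{L^{1,\infty}}<\infty$. There is a constant $C$, depending only on $n$, such that for every harmonic function $b:\mathbb{B}_n\to\mathbb{C}$ that belongs to $\mathrm{BMO}$ and every $f\in L\log^+L$, the functions $f$ and $\bar b f$ are integrable on $\mathbb{B}_n$ (so that $[\bar b,P]f$ is well defined), $[\bar b,P]f\in L^{1,\infty}$, and $$\|[\bar b,P]f\|_{L^{1,\infty}}\le C\,\|b\|_{\mathrm{BMO}}\,\|f\|_{L\log^+L}.$$ -/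

import Mathlib

open MeasureTheory
open scoped ENNReal NNReal

noncomputable section

namespace BergmanCommutator

/-- Complex Euclidean space `ℂⁿ` with its Hermitian norm. -/
abbrev Cn (n : ℕ) : Type := EuclideanSpace ℂ (Fin n)

/-- The open unit ball of `ℂⁿ`. -/
def unitBall (n : ℕ) : Set (Cn n) := Metric.ball 0 1

/-- Lebesgue volume measure `V` on the unit ball of `ℂⁿ`. -/
def ballVolume (n : ℕ) : Measure (Cn n) := volume.restrict (unitBall n)

/-- The Hermitian pairing `⟨z, w⟩ = ∑ j, z j * conj (w j)`, linear in `z`. -/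
def pairing {n : ℕ} (z w : Cn n) : ℂ := ∑ j, z j * starRingEnd ℂ (w j)

/-- The Bergman projection of the unit ball, through its integral kernel:
`P f (z) = (n! / π ^ n) ∫ f (w) / (1 - ⟨z, w⟩) ^ (n + 1) dV (w)`. For `z` in the ball the kernel is
bounded in `w`, so that the integral converges absolutely for every integrable `f`. -/
def bergmanProj {n : ℕ} (f : Cn n → ℂ) (z : Cn n) : ℂ :=
  ((n.factorial : ℂ) / (Real.pi : ℂ) ^ n) *
    ∫ w, f w / (1 - pairing z w) ^ (n + 1) ∂(ballVolume n)

/-- The commutator `[g, P] f = g P f - P (g f)` of the Bergman projection with the symbol `g`. -/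
def bergmanCommutator {n : ℕ} (g f : Cn n → ℂ) (z : Cn n) : ℂ :=
  g z * bergmanProj f z - bergmanProj (fun w => g w * f w) z

/-- The Carleson tent at a point `z` of the ball: the points `w` of the ball with
`|1 - ⟨z, w⟩ / |z|| < 1 - |z|` if `z ≠ 0`, and the whole ball if `z = 0`. -/
def carlesonTent {n : ℕ} (z : Cn n) : Set (Cn n) :=
  {w | w ∈ unitBall n ∧ (z ≠ 0 → ‖1 - pairing z w / (‖z‖ : ℂ)‖ < 1 - ‖z‖)}

/-- The `BMO` seminorm: the supremum over all Carleson tents `T` of the mean over `T` of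
`|b - ⟨b⟩_T|`, where `⟨b⟩_T` is the mean of `b` over `T`. It is infinite if a locally integrable `b`
fails to be integrable on some tent. -/
def bmoNorm {n : ℕ} (b : Cn n → ℂ) : ℝ≥0∞ :=
  ⨆ z ∈ unitBall n, (volume (carlesonTent z))⁻¹ *
    ∫⁻ w in carlesonTent z, ‖b w - ⨍ u in carlesonTent z, b u‖ₑ

/-- The space `BMO`: locally integrable functions on the ball of finite `BMO` seminorm. -/
def MemBMO {n : ℕ} (b : Cn n → ℂ) : Prop :=
  LocallyIntegrableOn b (unitBall n) ∧ bmoNorm b < ∞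

/-- The Orlicz space `L_Ψ` of the ball. -/
def MemOrlicz {n : ℕ} (Ψ : ℝ → ℝ) (f : Cn n → ℂ) : Prop :=
  AEStronglyMeasurable f (ballVolume n) ∧
    ∃ c : ℝ, 0 < c ∧ ∫⁻ z, ENNReal.ofReal (Ψ (‖f z‖ / c)) ∂(ballVolume n) < ∞

/-- The Luxemburg norm of the Orlicz space `L_Ψ` of the ball:
the infimum of the `c > 0` with `∫ Ψ (|f| / c) dV ≤ 1`. -/
def luxemburgNorm {n : ℕ} (Ψ : ℝ → ℝ) (f : Cn n → ℂ) : ℝ≥0∞ :=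
  ⨅ (c : ℝ) (_ : 0 < c)
    (_ : ∫⁻ z, ENNReal.ofReal (Ψ (‖f z‖ / c)) ∂(ballVolume n) ≤ 1), ENNReal.ofReal c

/-- The Young function `t log⁺ t`, with `log⁺ t = max 0 (log t)`. -/
def youngLlogL (t : ℝ) : ℝ := t * Real.posLog t

/-- The space `L log⁺ L` of the ball. -/
def MemLlogL {n : ℕ} (f : Cn n → ℂ) : Prop := MemOrlicz youngLlogL f

/-- The Luxemburg norm of `L log⁺ L`. -/
def llogLNorm {n : ℕ} (f : Cn n → ℂ) : ℝ≥0∞ := luxemburgNorm youngLlogL f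

/-- The weak `L¹` quasinorm on the ball: the supremum over `t > 0` of `t |{|g| > t}|`. -/
def weakL1Norm {n : ℕ} (g : Cn n → ℂ) : ℝ≥0∞ :=
  ⨆ (t : ℝ) (_ : 0 < t), ENNReal.ofReal t * ballVolume n {z | t < ‖g z‖}

/-- The space `L^{1,∞}` of the ball. -/
def MemWeakL1 {n : ℕ} (g : Cn n → ℂ) : Prop :=
  AEStronglyMeasurable g (ballVolume n) ∧ weakL1Norm g < ∞

end BergmanCommutator

end

/-! Write `d(z) = 1 - ‖z‖` and `Λ(z) = 2 - log d(z)`. The proof bounds the absolute values of the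
kernel; no cancellation in it is used, and harmonicity enters only through a growth bound for `b`.

Growth (`exists_enorm_sub_average_le`): with `c` the mean of `b` over the ball, `|b - c| ≤ C ‖b‖_BMO
Λ`. The mean value property on a Euclidean ball of radius about `d` does not give this: its volume
is of order `d ^ (2n)`, that of a tent `d ^ (n+1)`, and a power of `d` is lost if `n > 1`. Instead,
Green's identity with a cutoff near the sphere (`exists_enorm_harmonic_le`) controls the value at
`z` by an average, against a Poisson-type kernel, over a layer of width `s` comparable to `d ^ 2`.
Korányi balls of radius `s` have Euclidean diameter at most of order `√s`, hence of order `d`, and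
at that scale the kernel is essentially constant, so the integral is controlled by integrals over
tents of aperture `8 s` (`exists_lintegral_layer_le`). Telescoping over doubled tents bounds their
means of `|b - c|` by `‖b‖_BMO log (1/s)`, and `log (1/s)` is comparable to `Λ`.

Domination (`lintegral_kernel_le_shellSum`): the commutator is now bounded by the integral of `(Λ(z)
+ Λ(w)) |f(w)| / |1 - ⟨z, w⟩| ^ (n+1)`. Since `d(w) ≤ |1 - ⟨z, w⟩|`, where the latter is about `2 ^
j d(z)` one has `Λ(z) ≤ (j + 2) Λ(w)`. The logarithm thus moves entirely onto `f`, leaving a sum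
over `j`, with weights `j + 2`, of means of the measure `|f| Λ dV`.

Weak type (`volume_shellSum_gt_le`): this sum is of weak type `(1, 1)` for every finite measure. The
mean at scale `2 ^ k d(z)` is large only on a set covered by thin layers of Korányi balls, of width
comparable to `d` rather than `2 ^ k d`. This gains `2 ^ (-k)` over the maximal theorem and makes
the series converge.

Mass (`exists_lintegral_logDensity_le`): Young's inequality bounds `∫ |f| Λ dV` by the `L log⁺ L`
norm. -/

open scoped Pointwise

/-! ### The Korányi quasi-distance on the closed ball. -/

namespace BergmanCommutator

/-- The Korányi quasi-distance `|1 - ⟨z, w⟩|` on the closed ball. -/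
noncomputable def korDist {n : ℕ} (z w : Cn n) : ℝ := ‖1 - pairing z w‖

variable {n : ℕ}

lemma pairing_eq_inner (z w : Cn n) : pairing z w = inner ℂ w z := by
  simp [pairing, PiLp.inner_apply, RCLike.inner_apply]

lemma real_inner_eq_re_pairing (z w : Cn n) : inner ℝ z w = (pairing z w).re := by
  rw [pairing_eq_inner, PiLp.inner_apply, PiLp.inner_apply, Complex.re_sum]
  refine Finset.sum_congr rfl fun i _ => ?_
  simp [Complex.inner]
  ring

lemma norm_pairing_le (z w : Cn n) : ‖pairing z w‖ ≤ ‖z‖ * ‖w‖ := by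
  rw [pairing_eq_inner, mul_comm]; exact norm_inner_le_norm _ _

lemma pairing_sub_left (x y w : Cn n) : pairing (x - y) w = pairing x w - pairing y w := by
  simp only [pairing_eq_inner, inner_sub_right]

lemma pairing_add_right (x y w : Cn n) : pairing x (y + w) = pairing x y + pairing x w := by
  simp only [pairing_eq_inner, inner_add_left]

lemma pairing_sub_right (x y w : Cn n) : pairing x (y - w) = pairing x y - pairing x w := by
  simp only [pairing_eq_inner, inner_sub_left]

lemma pairing_self (x : Cn n) : pairing x x = (‖x‖ : ℂ) ^ 2 := by
  rw [pairing_eq_inner, inner_self_eq_norm_sq_to_K]; rfl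

lemma pairing_smul_left (r : ℝ) (x w : Cn n) : pairing (r • x) w = r * pairing x w := by
  simp [pairing, Finset.mul_sum, mul_assoc]

lemma pairing_smul_right (r : ℝ) (x w : Cn n) : pairing x (r • w) = r * pairing x w := by
  simp only [pairing, Finset.mul_sum]
  refine Finset.sum_congr rfl fun i _ => ?_
  simp; ring

lemma continuous_pairing : Continuous fun p : Cn n × Cn n => pairing p.1 p.2 := by
  simp only [pairing_eq_inner]; fun_prop

lemma continuous_pairing_right (z : Cn n) : Continuous fun w : Cn n => pairing z w :=
  continuous_pairing.comp (by fun_prop : Continuous fun w : Cn n => (z, w))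

lemma continuous_korDist : Continuous fun p : Cn n × Cn n => korDist p.1 p.2 :=
  (continuous_const.sub continuous_pairing).norm

lemma continuous_korDist_right (z : Cn n) : Continuous fun w : Cn n => korDist z w :=
  (continuous_const.sub (continuous_pairing_right z)).norm

lemma korDist_comm (z w : Cn n) : korDist z w = korDist w z := by
  have : 1 - pairing w z = starRingEnd ℂ (1 - pairing z w) := by
    rw [map_sub, map_one, pairing_eq_inner, pairing_eq_inner, inner_conj_symm]
  rw [korDist, korDist, this, RCLike.norm_conj]

lemma one_sub_norm_le_korDist {z w : Cn n} (hw : ‖w‖ ≤ 1) : 1 - ‖z‖ ≤ korDist z w := by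
  have h1 : ‖pairing z w‖ ≤ ‖z‖ := (norm_pairing_le z w).trans
    (mul_le_of_le_one_right (norm_nonneg z) hw)
  have h2 : ‖(1 : ℂ)‖ - ‖pairing z w‖ ≤ korDist z w := norm_sub_norm_le _ _
  rw [norm_one] at h2
  linarith

/-- Expand the square and use `‖z‖, ‖u‖ ≤ 1`. A Korányi ball of radius `s` therefore has Euclidean
size at most of order `√s`; the choice `s ~ D ^ 2` in the growth estimate rests on this. -/
lemma norm_sub_sq_le_korDist {z u : Cn n} (hz : ‖z‖ ≤ 1) (hu : ‖u‖ ≤ 1) :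
    ‖z - u‖ ^ 2 ≤ 2 * korDist z u := by
  have h := norm_sub_sq_real z u
  rw [real_inner_eq_re_pairing] at h
  have h2 : (1 - pairing z u).re ≤ korDist z u := Complex.re_le_norm _
  rw [Complex.sub_re, Complex.one_re] at h2
  nlinarith [norm_nonneg z, norm_nonneg u]

/-- Expand `⟨z - u, w - u⟩`. The defect `1 - ‖u‖ ^ 2` is at most `2 |1 - ⟨z, u⟩|`, and the product
of Euclidean distances is absorbed by `norm_sub_sq_le_korDist`. -/
lemma korDist_triangle {z u w : Cn n} (hz : ‖z‖ ≤ 1) (hu : ‖u‖ ≤ 1) (hw : ‖w‖ ≤ 1) :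
    korDist z w ≤ 4 * (korDist z u + korDist u w) := by
  have key : 1 - pairing z w = (1 - pairing u w) + ((1 - pairing z u) - (1 - pairing u u))
      - pairing (z - u) (w - u) := by
    rw [pairing_sub_left, pairing_sub_right, pairing_sub_right]; ring
  have h1 : ‖1 - pairing u u‖ ≤ 2 * korDist z u := by
    rw [pairing_self]
    have : (1 : ℂ) - (‖u‖ : ℂ) ^ 2 = ((1 - ‖u‖ ^ 2 : ℝ) : ℂ) := by push_cast; ring
    rw [this, Complex.norm_real, Real.norm_of_nonneg (by nlinarith [norm_nonneg u])]
    have := one_sub_norm_le_korDist (z := u) hz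
    rw [korDist_comm] at this
    nlinarith [norm_nonneg u]
  have h2 : ‖pairing (z - u) (w - u)‖ ≤ korDist z u + korDist u w := by
    refine (norm_pairing_le _ _).trans ?_
    have a1 := norm_sub_sq_le_korDist hz hu
    have a2 := norm_sub_sq_le_korDist hw hu
    rw [korDist_comm w u] at a2
    nlinarith [sq_nonneg (‖z - u‖ - ‖w - u‖)]
  have h3 : korDist z w ≤ (korDist u w + (korDist z u + ‖1 - pairing u u‖))
      + ‖pairing (z - u) (w - u)‖ := by
    rw [korDist, key]
    refine (norm_sub_le _ _).trans (add_le_add_left ((norm_add_le _ _).trans ?_) _)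
    exact add_le_add_right (norm_sub_le _ _) _
  have : 0 ≤ korDist u w := norm_nonneg _
  linarith

lemma korDist_le_add_norm_sub {z u w : Cn n} (hw : ‖w‖ ≤ 1) :
    korDist z w ≤ korDist u w + ‖z - u‖ := by
  have : 1 - pairing z w = (1 - pairing u w) - pairing (z - u) w := by
    rw [pairing_sub_left]; ring
  rw [korDist, this]
  refine (norm_sub_le _ _).trans (add_le_add_right ?_ _)
  exact (norm_pairing_le _ _).trans (mul_le_of_le_one_right (norm_nonneg _) hw)

end BergmanCommutator

/-! ### Cones and layers along the unit sphere. -/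

section Cone

variable {E : Type*} [NormedAddCommGroup E] [NormedSpace ℝ E] [FiniteDimensional ℝ E]
  [MeasurableSpace E] [BorelSpace E]

/-- The part of a cone in a spherical layer of the unit ball. -/
lemma measure_cone_layer (μ : Measure E) [μ.IsAddHaarMeasure] {A : Set E} (hA : MeasurableSet A)
    (hcone : ∀ t : ℝ, 0 < t → ∀ x ∈ A, t • x ∈ A) {h : ℝ} (h0 : 0 < h) (h1 : h < 1) :
    μ (A ∩ {y | ‖y‖ < 1 ∧ 1 - h ≤ ‖y‖}) =
      ENNReal.ofReal (1 - (1 - h) ^ Module.finrank ℝ E) * μ (A ∩ Metric.ball 0 1) := by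
  have hr : 0 < 1 - h := by linarith
  have e1 : (1 - h) • (A ∩ Metric.ball (0 : E) 1) = A ∩ Metric.ball 0 (1 - h) := by
    ext x
    rw [Set.mem_smul_set_iff_inv_smul_mem₀ hr.ne']
    simp only [Set.mem_inter_iff, mem_ball_zero_iff, norm_smul, norm_inv,
      Real.norm_of_nonneg hr.le]
    refine and_congr ⟨fun hx => ?_, fun hx => hcone _ (inv_pos.2 hr) _ hx⟩ ?_
    · simpa [smul_smul, hr.ne'] using hcone _ hr _ hx
    · rw [inv_mul_lt_iff₀ hr, mul_one]
  have e2 : A ∩ {y : E | ‖y‖ < 1 ∧ 1 - h ≤ ‖y‖} =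
      (A ∩ Metric.ball 0 1) \ (A ∩ Metric.ball 0 (1 - h)) := by
    ext x
    simp only [Set.mem_inter_iff, Set.mem_ofPred_eq, Set.mem_sdiff, mem_ball_zero_iff, not_and,
      not_lt]
    tauto
  have hfin : μ (A ∩ Metric.ball 0 1) ≠ ∞ :=
    ((measure_mono Set.inter_subset_right).trans_lt measure_ball_lt_top).ne
  rw [e2, measure_sdiff (Set.inter_subset_inter_right _ (Metric.ball_subset_ball (by linarith)))
    (hA.inter measurableSet_ball).nullMeasurableSet
    ((measure_mono Set.inter_subset_right).trans_lt measure_ball_lt_top).ne, ← e1,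
    Measure.addHaar_smul_of_nonneg _ hr.le, ENNReal.ofReal_sub _ (by positivity),
    ENNReal.ofReal_one, ENNReal.sub_mul (fun _ _ => hfin), one_mul]

/-- The measure of a layer of a cone is an explicit function of the width, so only `1 - (1 - h) ^ N
≤ N h` (Bernoulli) and `1 - (1 - R) ^ N ≥ R` are needed. -/
lemma measure_cone_layer_mul_le (μ : Measure E) [μ.IsAddHaarMeasure] [Nontrivial E] {A : Set E}
    (hA : MeasurableSet A) (hcone : ∀ t : ℝ, 0 < t → ∀ x ∈ A, t • x ∈ A) {h R : ℝ} (h0 : 0 < h)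
    (hR : h ≤ R) (hR1 : R < 1) :
    ENNReal.ofReal R * μ (A ∩ {y | ‖y‖ < 1 ∧ 1 - h ≤ ‖y‖}) ≤
      ENNReal.ofReal (Module.finrank ℝ E * h) * μ (A ∩ {y | ‖y‖ < 1 ∧ 1 - R ≤ ‖y‖}) := by
  have hN : 1 ≤ Module.finrank ℝ E := Module.finrank_pos
  rw [measure_cone_layer μ hA hcone h0 (hR.trans_lt hR1),
    measure_cone_layer μ hA hcone (h0.trans_le hR) hR1, ← mul_assoc, ← mul_assoc,
    ← ENNReal.ofReal_mul (by linarith), ← ENNReal.ofReal_mul (by positivity)]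
  gcongr ENNReal.ofReal ?_ * _
  have a1 : 1 - (1 - h) ^ Module.finrank ℝ E ≤ Module.finrank ℝ E * h := by
    have := one_add_mul_le_pow (a := -h) (by linarith) (Module.finrank ℝ E)
    rw [← sub_eq_add_neg] at this
    linarith
  have a2 : (1 - R) ^ Module.finrank ℝ E ≤ 1 - R := pow_le_of_le_one (by linarith) (by linarith)
    (by omega)
  have a3 : (0 : ℝ) ≤ Module.finrank ℝ E * h := by positivity
  nlinarith

/-- A volume bound for the sets `{‖c - L y‖ < R}` in the ball gains a factor `h / R` when one
intersects with the layer of width `h` along the sphere. -/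
lemma measure_layer_le (μ : Measure E) [μ.IsAddHaarMeasure] [Nontrivial E] {F : Type*}
    [NormedAddCommGroup F] [NormedSpace ℝ F] (m : ℕ) (M : ℝ≥0) :
    ∃ C : ℝ≥0, ∀ (L : E →L[ℝ] F) (c : F), ‖c‖ ≤ 1 →
      (∀ R : ℝ, 0 < R → μ {y | ‖y‖ < 1 ∧ ‖c - L y‖ < R} ≤ M * ENNReal.ofReal (R ^ (m + 1))) →
      ∀ h R : ℝ, 0 < h → h ≤ R →
        μ {y | ‖y‖ < 1 ∧ ‖c - L y‖ < R ∧ 1 - h ≤ ‖y‖} ≤ C * ENNReal.ofReal (R ^ m * h) := by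
  set N := Module.finrank ℝ E with hN
  set V : ℝ≥0 := (μ (Metric.ball 0 1)).toNNReal with hV
  have hVe : (V : ℝ≥0∞) = μ (Metric.ball 0 1) := ENNReal.coe_toNNReal measure_ball_lt_top.ne
  have hN1 : 1 ≤ N := Module.finrank_pos
  refine ⟨(2 * N + 2) * 2 ^ m * V + N * M * 6 ^ (m + 1), fun L c hc hM h R h0 hhR => ?_⟩
  have hR0 : 0 < R := h0.trans_le hhR
  rcases lt_or_ge (1 / 2) R with hR | hR
  -- For `R > 1 / 2` the factor `R ^ m` is bounded below, and the measure of the whole layer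
  -- suffices.
  · have hlow : (1 : ℝ) ≤ 2 ^ m * R ^ m := by
      rw [← mul_pow]; exact one_le_pow₀ (by linarith)
    have key : μ {y : E | ‖y‖ < 1 ∧ 1 - h ≤ ‖y‖} ≤ (2 * N + 2 : ℝ≥0) * V * ENNReal.ofReal h := by
      rcases lt_or_ge h (1 / 2) with hh | hh
      · have := measure_cone_layer μ (A := Set.univ) MeasurableSet.univ (by simp) h0
          (by linarith)
        rw [Set.univ_inter, Set.univ_inter, ← hVe] at this
        rw [this, mul_comm, mul_right_comm, mul_comm (V : ℝ≥0∞)]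
        gcongr
        have a1 := one_add_mul_le_pow (a := -h) (by linarith) N
        rw [← sub_eq_add_neg] at a1
        have : ENNReal.ofReal (1 - (1 - h) ^ N) ≤ ENNReal.ofReal (N * h) := by
          gcongr; linarith
        refine this.trans ?_
        rw [ENNReal.ofReal_mul (by positivity), ENNReal.ofReal_natCast]
        gcongr
        rw [show ((N : ℝ≥0∞)) = ((N : ℝ≥0) : ℝ≥0∞) by simp]
        norm_cast
        omega
      · calc μ {y : E | ‖y‖ < 1 ∧ 1 - h ≤ ‖y‖} ≤ V := by
              rw [hVe]; exact measure_mono fun y hy => by simpa using hy.1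
          _ = V * 1 := (mul_one _).symm
          _ ≤ V * (((2 * N + 2 : ℝ≥0)) * ENNReal.ofReal h) := by
              gcongr
              rw [← ENNReal.ofReal_coe_nnreal, ← ENNReal.ofReal_mul (by positivity),
                ← ENNReal.ofReal_one]
              gcongr
              push_cast
              have : (0 : ℝ) ≤ N := by positivity
              nlinarith
          _ = _ := by ring
    calc μ {y | ‖y‖ < 1 ∧ ‖c - L y‖ < R ∧ 1 - h ≤ ‖y‖} ≤ μ {y : E | ‖y‖ < 1 ∧ 1 - h ≤ ‖y‖} :=
          measure_mono fun y hy => ⟨hy.1, hy.2.2⟩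
      _ ≤ (2 * N + 2 : ℝ≥0) * V * ENNReal.ofReal h := key
      _ ≤ (2 * N + 2 : ℝ≥0) * V * ENNReal.ofReal (2 ^ m * (R ^ m * h)) := by
          gcongr; nlinarith
      _ = (((2 * N + 2) * 2 ^ m * V : ℝ≥0) : ℝ≥0∞) * ENNReal.ofReal (R ^ m * h) := by
          rw [ENNReal.ofReal_mul (by positivity), ENNReal.ofReal_pow (by norm_num)]
          push_cast
          rw [ENNReal.ofReal_ofNat]
          ring
      _ ≤ _ := by gcongr; exact le_self_add
  -- Replacing `c` by `‖y‖ • c` makes the condition homogeneous, so that the cone lemma applies. In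
  -- the layer of width `R ≤ 1 / 2` the change costs at most `R`, and `‖y‖ ≥ 1 / 2` there: hence `2
  -- R ≤ 4 R ‖y‖` in one direction and `4 R + R < 6 R` in the other.
  · set A : Set E := {y | ‖‖y‖ • c - L y‖ < 4 * R * ‖y‖} with hAdef
    have hA : MeasurableSet A := by
      refine (isOpen_lt ?_ ?_).measurableSet <;> fun_prop
    have hcone : ∀ t : ℝ, 0 < t → ∀ x ∈ A, t • x ∈ A := by
      intro t ht x hx
      simp only [hAdef, Set.mem_ofPred_eq, norm_smul, Real.norm_of_nonneg ht.le, map_smul,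
        mul_smul] at hx ⊢
      rw [← smul_sub, norm_smul, Real.norm_of_nonneg ht.le]
      nlinarith
    have s1 : {y | ‖y‖ < 1 ∧ ‖c - L y‖ < R ∧ 1 - h ≤ ‖y‖} ⊆
        A ∩ {y | ‖y‖ < 1 ∧ 1 - h ≤ ‖y‖} := by
      rintro y ⟨h1, h2, h3⟩
      refine ⟨?_, h1, h3⟩
      have : ‖y‖ • c - L y = (c - L y) - (1 - ‖y‖) • c := by rw [sub_smul, one_smul]; abel
      simp only [hAdef, Set.mem_ofPred_eq]
      rw [this]
      refine (norm_sub_le _ _).trans_lt ?_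
      rw [norm_smul, Real.norm_of_nonneg (by linarith)]
      nlinarith [norm_nonneg c]
    have s2 : A ∩ {y | ‖y‖ < 1 ∧ 1 - R ≤ ‖y‖} ⊆ {y | ‖y‖ < 1 ∧ ‖c - L y‖ < 6 * R} := by
      rintro y ⟨h1, h2, h3⟩
      refine ⟨h2, ?_⟩
      simp only [hAdef, Set.mem_ofPred_eq] at h1
      have : c - L y = (‖y‖ • c - L y) + (1 - ‖y‖) • c := by rw [sub_smul, one_smul]; abel
      rw [this]
      refine (norm_add_le _ _).trans_lt ?_
      rw [norm_smul, Real.norm_of_nonneg (by linarith)]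
      nlinarith [norm_nonneg c]
    have k := measure_cone_layer_mul_le μ hA hcone h0 hhR (by linarith)
    have hRne : ENNReal.ofReal R ≠ 0 := by simpa using hR0
    rw [← ENNReal.mul_le_mul_iff_right hRne ENNReal.ofReal_ne_top]
    calc ENNReal.ofReal R * μ {y | ‖y‖ < 1 ∧ ‖c - L y‖ < R ∧ 1 - h ≤ ‖y‖}
        ≤ ENNReal.ofReal R * μ (A ∩ {y | ‖y‖ < 1 ∧ 1 - h ≤ ‖y‖}) := by gcongr
      _ ≤ ENNReal.ofReal (N * h) * μ (A ∩ {y | ‖y‖ < 1 ∧ 1 - R ≤ ‖y‖}) := k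
      _ ≤ ENNReal.ofReal (N * h) * (M * ENNReal.ofReal ((6 * R) ^ (m + 1))) := by
          gcongr; exact (measure_mono s2).trans (hM _ (by positivity))
      _ = ((N * M * 6 ^ (m + 1) : ℝ≥0) : ℝ≥0∞) *
          (ENNReal.ofReal R * ENNReal.ofReal (R ^ m * h)) := by
          rw [ENNReal.ofReal_mul (by positivity), mul_pow, ENNReal.ofReal_mul (by positivity),
            ENNReal.ofReal_mul (by positivity), pow_succ R, ENNReal.ofReal_mul (by positivity),
            ENNReal.ofReal_natCast, ENNReal.ofReal_pow (by positivity), ENNReal.ofReal_ofNat]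
          push_cast
          ring
      _ ≤ ((((2 * N + 2) * 2 ^ m * V + N * M * 6 ^ (m + 1) : ℝ≥0)) : ℝ≥0∞) *
            (ENNReal.ofReal R * ENNReal.ofReal (R ^ m * h)) := by gcongr; exact le_add_self
      _ = _ := by ring

end Cone

/-! ### Volumes of Korányi balls and of their layers. -/

namespace BergmanCommutator

variable {n : ℕ}

lemma exists_orthonormalBasis_apply_zero {m : ℕ} {ζ : Cn (m + 1)} (hζ : ‖ζ‖ = 1) :
    ∃ b : OrthonormalBasis (Fin (m + 1)) ℂ (Cn (m + 1)), b 0 = ζ := by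
  have h : Orthonormal ℂ (({0} : Set (Fin (m + 1))).domRestrict fun _ => ζ) := by
    refine ⟨fun _ => hζ, fun i j hij => absurd (Subsingleton.elim i j) hij⟩
  obtain ⟨b, hb⟩ := h.exists_orthonormalBasis_extension_of_card_eq (by simp)
  exact ⟨b, hb 0 rfl⟩

/-- The volume in the coordinates of an orthonormal basis is a multiple, independent of the basis,
of the Lebesgue measure on `Fin n → ℂ`. -/
lemma exists_volume_preimage_coordinates (n : ℕ) :
    ∃ κ : ℝ≥0, κ ≠ 0 ∧ ∀ (b : OrthonormalBasis (Fin n) ℂ (Cn n)) (S : Set (Fin n → ℂ)),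
      MeasurableSet S → volume {y : Cn n | (fun j => inner ℂ (b j) y) ∈ S} = κ * volume S := by
  -- Uniqueness of Haar measure gives a constant for each basis. The unit ball has the same
  -- description in all orthonormal coordinates, so testing on it identifies the constants.
  set S₀ : Set (Fin n → ℂ) := {v | ∑ j, ‖v j‖ ^ 2 < 1} with hS₀
  have hS₀m : MeasurableSet S₀ := by
    refine (isOpen_lt ?_ continuous_const).measurableSet; fun_prop
  have key : ∀ (b : OrthonormalBasis (Fin n) ℂ (Cn n)), ∃ κ : ℝ≥0, κ ≠ 0 ∧
      ∀ (S : Set (Fin n → ℂ)),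
      MeasurableSet S → volume {y : Cn n | (fun j => inner ℂ (b j) y) ∈ S} = κ * volume S := by
    intro b
    let ψ : Cn n ≃L[ℂ] (Fin n → ℂ) :=
      b.repr.toContinuousLinearEquiv.trans (EuclideanSpace.equiv (Fin n) ℂ)
    let φ : Cn n ≃L[ℝ] (Fin n → ℂ) :=
      { ψ.toLinearEquiv.restrictScalars ℝ with
        continuous_toFun := ψ.continuous
        continuous_invFun := ψ.symm.continuous }
    have hφ : ∀ y, φ y = fun j => inner ℂ (b j) y := by
      intro y; funext j
      simp [φ, ψ, OrthonormalBasis.repr_apply_apply]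
    have : (Measure.map φ volume).IsAddHaarMeasure :=
      ContinuousLinearEquiv.isAddHaarMeasure_map φ _
    have hs := Measure.isAddLeftInvariant_eq_smul (Measure.map φ volume)
      (volume : Measure (Fin n → ℂ))
    refine ⟨Measure.addHaarScalarFactor (Measure.map φ volume) volume, ?_, fun S hS => ?_⟩
    · exact (Measure.addHaarScalarFactor_pos_of_isAddHaarMeasure _ _).ne'
    · have e : {y : Cn n | (fun j => inner ℂ (b j) y) ∈ S} = φ ⁻¹' S := by
        ext y; simp [hφ]
      rw [e, ← Measure.map_apply φ.continuous.measurable hS]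
      conv_lhs => rw [hs]
      rfl
  obtain ⟨κ, hκ, h⟩ := key (EuclideanSpace.basisFun (Fin n) ℂ)
  have hpre : ∀ b : OrthonormalBasis (Fin n) ℂ (Cn n),
      {y : Cn n | (fun j => inner ℂ (b j) y) ∈ S₀} = Metric.ball 0 1 := by
    intro b; ext y
    simp only [hS₀, Set.mem_ofPred_eq, mem_ball_zero_iff, b.sum_sq_norm_inner_right]
    rw [sq_lt_one_iff₀ (norm_nonneg _)]
  have h1 := h S₀ hS₀m
  rw [hpre] at h1
  have hpos : volume S₀ ≠ 0 := by
    intro h0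
    rw [h0, mul_zero] at h1
    exact (Metric.measure_ball_pos volume (0 : Cn n) one_pos).ne' h1
  have htop : volume S₀ ≠ ∞ := by
    intro h0
    rw [h0, ENNReal.mul_top (by simpa using hκ)] at h1
    exact measure_ball_lt_top.ne h1
  refine ⟨κ, hκ, fun b S hS => ?_⟩
  obtain ⟨κ', _, h'⟩ := key b
  have h2 := h' S₀ hS₀m
  rw [hpre, h1] at h2
  have : (κ : ℝ≥0∞) = κ' := (ENNReal.mul_left_inj hpos htop).1 h2
  rw [h' S hS, this]

lemma volume_pi_ball_complex (m : ℕ) (a : Fin (m + 1) → ℂ) (r : Fin (m + 1) → ℝ) :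
    volume (Set.univ.pi fun j => Metric.ball (a j) (r j)) =
      ∏ j, (ENNReal.ofReal (r j) ^ 2 * NNReal.pi) := by
  rw [volume_pi_pi]
  simp_rw [Complex.volume_ball]

/-- In an orthonormal basis starting with `ζ`, the set lies in a disc of radius `δ` about `1` times
`n` discs of radius `√(2 δ)`: the first coordinate exceeds `1 - δ` in modulus, which leaves at most
`2 δ` for the other squares. -/
lemma volume_korDist_lt_le_of_norm_eq_one (n : ℕ) :
    ∃ C : ℝ≥0, ∀ ζ : Cn (n + 1), ‖ζ‖ = 1 → ∀ δ : ℝ, 0 < δ →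
      volume {w : Cn (n + 1) | ‖w‖ < 1 ∧ korDist ζ w < δ} ≤ C * ENNReal.ofReal (δ ^ (n + 2)) := by
  obtain ⟨κ, _, h⟩ := exists_volume_preimage_coordinates (n + 1)
  refine ⟨κ * (NNReal.pi ^ (n + 1) * 2 ^ n), fun ζ hζ δ hδ => ?_⟩
  obtain ⟨b, hb⟩ := exists_orthonormalBasis_apply_zero hζ
  set S : Set (Fin (n + 1) → ℂ) := Set.univ.pi fun j =>
    Metric.ball ((Fin.cons 1 (fun _ => 0) : Fin (n + 1) → ℂ) j)
      ((Fin.cons δ (fun _ => √(2 * δ)) : Fin (n + 1) → ℝ) j) with hS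
  have sub : {w : Cn (n + 1) | ‖w‖ < 1 ∧ korDist ζ w < δ} ⊆
      {y | (fun j => inner ℂ (b j) y) ∈ S} := by
    rintro w ⟨hw, hd⟩
    have hd' : ‖1 - inner ℂ (b 0) w‖ < δ := by
      rw [korDist_comm, korDist, pairing_eq_inner] at hd
      rwa [hb]
    have hsum := b.sum_sq_norm_inner_right w
    rw [Fin.sum_univ_succ] at hsum
    have hw2 : ‖w‖ ^ 2 < 1 := by rwa [sq_lt_one_iff₀ (norm_nonneg _)]
    have h0 : 1 - δ < ‖inner ℂ (b 0) w‖ := by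
      have := norm_sub_norm_le (1 : ℂ) (inner ℂ (b 0) w)
      rw [norm_one] at this
      linarith
    have hle : ‖inner ℂ (b 0) w‖ ≤ 1 := by
      refine (norm_inner_le_norm _ _).trans ?_
      rw [b.orthonormal.1, one_mul]; exact hw.le
    simp only [hS, Set.mem_ofPred_eq, Set.mem_univ_pi]
    intro j
    refine Fin.cases ?_ (fun i => ?_) j
    · simpa [dist_eq_norm, norm_sub_rev] using hd'
    · simp only [Fin.cons_succ, mem_ball_zero_iff]
      refine Real.lt_sqrt_of_sq_lt ?_
      have : ‖inner ℂ (b i.succ) w‖ ^ 2 ≤ ∑ i : Fin n, ‖inner ℂ (b i.succ) w‖ ^ 2 :=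
        Finset.single_le_sum (f := fun i : Fin n => ‖inner ℂ (b i.succ) w‖ ^ 2)
          (fun _ _ => by positivity) (Finset.mem_univ i)
      rcases lt_or_ge δ 1 with h1 | h1
      · nlinarith [norm_nonneg (inner ℂ (b 0) w)]
      · nlinarith [norm_nonneg (inner ℂ (b 0) w)]
  refine (measure_mono sub).trans ?_
  rw [h b S (MeasurableSet.univ_pi fun j => measurableSet_ball), volume_pi_ball_complex,
    Fin.prod_univ_succ]
  simp only [Fin.cons_zero, Fin.cons_succ, Finset.prod_const, Finset.card_univ, Fintype.card_fin]
  rw [← ENNReal.ofReal_pow (by positivity), ← ENNReal.ofReal_pow (by positivity),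
    Real.sq_sqrt (by positivity), mul_pow, ← ENNReal.ofReal_pow (by positivity), mul_pow,
    ENNReal.ofReal_mul (by positivity), ENNReal.ofReal_pow (p := 2) (by positivity),
    ENNReal.ofReal_ofNat, show δ ^ (n + 2) = δ ^ 2 * δ ^ n by ring,
    ENNReal.ofReal_mul (by positivity)]
  push_cast
  refine le_of_eq ?_
  ring

lemma volume_korDist_lt_ge (n : ℕ) :
    ∃ c : ℝ≥0, 0 < c ∧ ∀ ζ : Cn (n + 1), ‖ζ‖ = 1 → ∀ δ : ℝ, 0 < δ → δ ≤ 1 →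
      c * ENNReal.ofReal (δ ^ (n + 2)) ≤ volume {w : Cn (n + 1) | ‖w‖ < 1 ∧ korDist ζ w < δ} := by
  obtain ⟨κ, hκ, h⟩ := exists_volume_preimage_coordinates (n + 1)
  refine ⟨κ * (NNReal.pi ^ (n + 1) * ((1 / 16) * (1 / (4 * (n + 1))) ^ n)), ?_,
    fun ζ hζ δ hδ hδ1 => ?_⟩
  · have : 0 < NNReal.pi := NNReal.pi_pos
    have := pos_iff_ne_zero.2 hκ
    positivity
  obtain ⟨b, hb⟩ := exists_orthonormalBasis_apply_zero hζ
  -- An inscribed polydisc: the first coordinate stays below `1 - δ / 4` in modulus and the other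
  -- squares add up to at most `δ / 4`, so the norm is below `1`.
  set S : Set (Fin (n + 1) → ℂ) := Set.univ.pi fun j =>
    Metric.ball ((Fin.cons (1 - δ / 2 : ℝ) (fun _ => 0) : Fin (n + 1) → ℂ) j)
      ((Fin.cons (δ / 4) (fun _ => √(δ / (4 * (n + 1)))) : Fin (n + 1) → ℝ) j) with hS
  have sub : {y | (fun j => inner ℂ (b j) y) ∈ S} ⊆
      {w : Cn (n + 1) | ‖w‖ < 1 ∧ korDist ζ w < δ} := by
    intro w hw
    simp only [hS, Set.mem_ofPred_eq, Set.mem_univ_pi] at hw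
    have h0 := hw 0
    simp only [Fin.cons_zero, Metric.mem_ball, dist_eq_norm] at h0
    have hi : ∀ i : Fin n, ‖inner ℂ (b i.succ) w‖ ^ 2 ≤ δ / (4 * (n + 1)) := fun i => by
      have := hw i.succ
      simp only [Fin.cons_succ, mem_ball_zero_iff] at this
      calc _ ≤ √(δ / (4 * (n + 1))) ^ 2 := by gcongr
        _ = _ := Real.sq_sqrt (by positivity)
    have hsum := b.sum_sq_norm_inner_right w
    rw [Fin.sum_univ_succ] at hsum
    have hs2 : ∑ i : Fin n, ‖inner ℂ (b i.succ) w‖ ^ 2 ≤ δ / 4 := by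
      refine (Finset.sum_le_sum fun i _ => hi i).trans ?_
      simp only [Finset.sum_const, Finset.card_univ, Fintype.card_fin, nsmul_eq_mul]
      rw [mul_div_assoc', div_le_div_iff₀ (by positivity) (by norm_num)]
      nlinarith
    have hn0 : ‖inner ℂ (b 0) w‖ < 1 - δ / 4 := by
      have := norm_sub_norm_le (inner ℂ (b 0) w) ((1 - δ / 2 : ℝ) : ℂ)
      rw [Complex.norm_real, Real.norm_of_nonneg (by linarith)] at this
      linarith
    refine ⟨?_, ?_⟩
    · rw [← sq_lt_one_iff₀ (norm_nonneg _), ← hsum]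
      nlinarith [norm_nonneg (inner ℂ (b 0) w)]
    · rw [korDist_comm, korDist, pairing_eq_inner, ← hb]
      have e : 1 - inner ℂ (b 0) w = ((δ / 2 : ℝ) : ℂ) -
          (inner ℂ (b 0) w - ((1 - δ / 2 : ℝ) : ℂ)) := by push_cast; ring
      rw [e]
      refine (norm_sub_le _ _).trans_lt ?_
      rw [Complex.norm_real, Real.norm_of_nonneg (by linarith)]
      linarith
  refine le_trans (le_of_eq ?_) (measure_mono sub)
  rw [h b S (MeasurableSet.univ_pi fun j => measurableSet_ball), volume_pi_ball_complex,
    Fin.prod_univ_succ]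
  simp only [Fin.cons_zero, Fin.cons_succ, Finset.prod_const, Finset.card_univ, Fintype.card_fin]
  rw [← ENNReal.ofReal_pow (by positivity), ← ENNReal.ofReal_pow (by positivity),
    Real.sq_sqrt (by positivity), mul_pow, ← ENNReal.ofReal_pow (by positivity),
    show (δ / 4) ^ 2 = (1 / 16 : ℝ) * δ ^ 2 by ring,
    show (δ / (4 * (n + 1))) ^ n = (1 / (4 * ((n : ℝ) + 1))) ^ n * δ ^ n by
      rw [← mul_pow]; congr 1; ring,
    ENNReal.ofReal_mul (by positivity), ENNReal.ofReal_mul (by positivity),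
    show δ ^ (n + 2) = δ ^ 2 * δ ^ n by ring, ENNReal.ofReal_mul (by positivity)]
  have e1 : ENNReal.ofReal (1 / 16) = ((1 / 16 : ℝ≥0) : ℝ≥0∞) := by
    rw [← ENNReal.ofReal_coe_nnreal]; norm_num
  have e2 : ENNReal.ofReal ((1 / (4 * ((n : ℝ) + 1))) ^ n) =
      (((1 / (4 * ((n : ℝ≥0) + 1))) ^ n : ℝ≥0) : ℝ≥0∞) := by
    rw [← ENNReal.ofReal_coe_nnreal]; norm_num
  rw [e1, e2]
  push_cast
  ring

/-- If the set is nonempty then `1 - ‖ζ‖ < δ`, so moving `ζ` radially to the sphere only doubles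
`δ`. For `δ ≥ 1 / 2` the volume of the ball is enough. -/
lemma volume_korDist_lt_le (n : ℕ) :
    ∃ C : ℝ≥0, ∀ ζ : Cn (n + 1), ‖ζ‖ ≤ 1 → ∀ δ : ℝ, 0 < δ →
      volume {w : Cn (n + 1) | ‖w‖ < 1 ∧ korDist ζ w < δ} ≤ C * ENNReal.ofReal (δ ^ (n + 2)) := by
  obtain ⟨C, hC⟩ := volume_korDist_lt_le_of_norm_eq_one n
  set V : ℝ≥0 := (volume (Metric.ball (0 : Cn (n + 1)) 1)).toNNReal with hV
  have hVe : (V : ℝ≥0∞) = volume (Metric.ball (0 : Cn (n + 1)) 1) :=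
    ENNReal.coe_toNNReal measure_ball_lt_top.ne
  refine ⟨C * 2 ^ (n + 2) + V * 2 ^ (n + 2), fun ζ hζ δ hδ => ?_⟩
  rw [ENNReal.coe_add, add_mul]
  have hpow : ∀ K : ℝ≥0, ((K * 2 ^ (n + 2) : ℝ≥0) : ℝ≥0∞) * ENNReal.ofReal (δ ^ (n + 2)) =
      K * ENNReal.ofReal ((2 * δ) ^ (n + 2)) := by
    intro K
    rw [mul_pow, ENNReal.ofReal_mul (by positivity), ENNReal.ofReal_pow (p := 2) (by positivity),
      ENNReal.ofReal_ofNat]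
    push_cast; ring
  rw [hpow, hpow]
  rcases lt_or_ge δ (1 / 2) with h | h
  · refine le_trans ?_ le_self_add
    rcases lt_or_ge ‖ζ‖ (1 / 2) with h1 | h1
    · have : {w : Cn (n + 1) | ‖w‖ < 1 ∧ korDist ζ w < δ} = ∅ := by
        ext w
        simp only [Set.mem_ofPred_eq, Set.mem_empty_iff_false, iff_false, not_and, not_lt]
        intro hw
        have := one_sub_norm_le_korDist (z := ζ) hw.le
        linarith
      rw [this, measure_empty]; exact zero_le
    · have hpos : 0 < ‖ζ‖ := by linarith
      refine le_trans ?_ (hC (‖ζ‖⁻¹ • ζ) ?_ (2 * δ) (by linarith))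
      · refine measure_mono fun w hw => ⟨hw.1, ?_⟩
        refine (korDist_le_add_norm_sub (u := ζ) hw.1.le).trans_lt ?_
        have e : ‖ζ‖⁻¹ • ζ - ζ = (‖ζ‖⁻¹ - 1) • ζ := by rw [sub_smul, one_smul]
        have h2 := one_sub_norm_le_korDist (z := ζ) hw.1.le
        have h3 : ‖‖ζ‖⁻¹ • ζ - ζ‖ = 1 - ‖ζ‖ := by
          rw [e, norm_smul, Real.norm_of_nonneg (by
            rw [sub_nonneg]; exact (one_le_inv₀ hpos).2 hζ), sub_mul, inv_mul_cancel₀ hpos.ne',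
            one_mul]
        have := hw.2
        linarith
      · rw [norm_smul, norm_inv, norm_norm, inv_mul_cancel₀ hpos.ne']
  · refine le_trans ?_ le_add_self
    calc _ ≤ (V : ℝ≥0∞) := by
          rw [hVe]; exact measure_mono fun w hw => by simpa using hw.1
      _ = V * ENNReal.ofReal 1 := by simp
      _ ≤ _ := by gcongr; exact one_le_pow₀ (by linarith)

/-- The real-linear functional `w ↦ ⟨z, w⟩`. -/
noncomputable def pairingCLM (z : Cn n) : Cn n →L[ℝ] ℂ :=
  LinearMap.toContinuousLinearMap
    { toFun := fun w => pairing z w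
      map_add' := fun x y => pairing_add_right z x y
      map_smul' := fun r x => by simp [pairing_smul_right] }

instance : Nontrivial (Cn (n + 1)) :=
  Module.nontrivial_of_finrank_pos (R := ℂ) (by simp)

lemma finrank_real_Cn (n : ℕ) : Module.finrank ℝ (Cn n) = 2 * n := by
  rw [← Module.finrank_mul_finrank ℝ ℂ (Cn n)]
  simp

/-- `measure_layer_le` with `L` the functional `w ↦ ⟨ζ, w⟩` and `c = 1`. The Euclidean analogue that
follows takes `L` the identity and `c = z`. -/
lemma volume_korDist_layer_le (n : ℕ) :
    ∃ C : ℝ≥0, ∀ ζ : Cn (n + 1), ‖ζ‖ ≤ 1 → ∀ h R : ℝ, 0 < h → h ≤ R →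
      volume {w : Cn (n + 1) | ‖w‖ < 1 ∧ korDist ζ w < R ∧ 1 - h ≤ ‖w‖} ≤
        C * ENNReal.ofReal (R ^ (n + 1) * h) := by
  obtain ⟨M, hM⟩ := volume_korDist_lt_le n
  obtain ⟨C, hC⟩ := measure_layer_le (volume : Measure (Cn (n + 1))) (F := ℂ) (n + 1) M
  exact ⟨C, fun ζ hζ => hC (pairingCLM ζ) 1 (by simp) (hM ζ hζ)⟩

lemma volume_ball_layer_le (n : ℕ) :
    ∃ C : ℝ≥0, ∀ z : Cn (n + 1), ‖z‖ ≤ 1 → ∀ h R : ℝ, 0 < h → h ≤ R →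
      volume {w : Cn (n + 1) | ‖w‖ < 1 ∧ ‖z - w‖ < R ∧ 1 - h ≤ ‖w‖} ≤
        C * ENNReal.ofReal (R ^ (2 * n + 1) * h) := by
  set V : ℝ≥0 := (volume (Metric.ball (0 : Cn (n + 1)) 1)).toNNReal with hV
  have hVe : (V : ℝ≥0∞) = volume (Metric.ball (0 : Cn (n + 1)) 1) :=
    ENNReal.coe_toNNReal measure_ball_lt_top.ne
  obtain ⟨C, hC⟩ := measure_layer_le (volume : Measure (Cn (n + 1))) (F := Cn (n + 1))
    (2 * n + 1) V
  refine ⟨C, fun z hz => hC (ContinuousLinearMap.id ℝ _) z hz fun R hR => ?_⟩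
  calc volume {y : Cn (n + 1) | ‖y‖ < 1 ∧ ‖z - (ContinuousLinearMap.id ℝ (Cn (n + 1))) y‖ < R}
      ≤ volume (Metric.ball z R) := measure_mono fun y hy => by
        rw [Metric.mem_ball, dist_comm, dist_eq_norm]; exact hy.2
    _ = _ := by
        rw [Measure.addHaar_ball _ _ hR.le, finrank_real_Cn, hVe, mul_comm]
        rfl

end BergmanCommutator

/-! ### Weak type estimates for means over dilated Korányi balls. -/

namespace BergmanCommutator

/-- The Korányi ball about `z` whose radius is `2 ^ (k + 1)` times the distance to the sphere. -/
def korShell {n : ℕ} (k : ℕ) (z : Cn n) : Set (Cn n) :=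
  {w | ‖w‖ < 1 ∧ korDist z w < 2 ^ (k + 1) * (1 - ‖z‖)}

lemma measurableSet_korShell {n : ℕ} (k : ℕ) (z : Cn n) : MeasurableSet (korShell k z) :=
  ((isOpen_lt continuous_norm continuous_const).inter
    (isOpen_lt (continuous_korDist_right z) continuous_const)).measurableSet

/-- The sum over dyadic dilates of weighted Korányi means of a measure on the ball. -/
noncomputable def shellSum {n : ℕ} (μ : Measure (Cn n)) (z : Cn n) : ℝ≥0∞ :=
  ∑' k : ℕ, (k + 2 : ℝ≥0∞) * ENNReal.ofReal ((2 ^ k * (1 - ‖z‖)) ^ (n + 1))⁻¹ * μ (korShell k z)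

/-- The radius of `korShell k z` is a fixed multiple of the distance from `z` to the sphere.
Selecting by Vitali therefore also controls how far the covered points are from the sphere: they
fill only a layer, a fraction of order `2 ^ (-k)` of the enlarged ball. This is the factor `2 ^ k`
on the left. -/
lemma volume_korShell_mean_gt_le (n : ℕ) :
    ∃ C : ℝ≥0, ∀ (μ : Measure (Cn (n + 1))) [IsFiniteMeasure μ] (k : ℕ) (t : ℝ), 0 < t →
      ENNReal.ofReal (2 ^ k * t) * volume {z : Cn (n + 1) | ‖z‖ < 1 ∧
        ENNReal.ofReal (t * (2 ^ k * (1 - ‖z‖)) ^ (n + 2)) < μ (korShell k z)} ≤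
        C * μ Set.univ := by
  obtain ⟨C, hC⟩ := volume_korDist_layer_le n
  refine ⟨C * (2 * 24 ^ (n + 1)), fun μ _ k t ht => ?_⟩
  set T : Set (Cn (n + 1)) := {z | ‖z‖ < 1 ∧
    ENNReal.ofReal (t * (2 ^ k * (1 - ‖z‖)) ^ (n + 2)) < μ (korShell k z)} with hT
  obtain ⟨u, huT, hdisj, hcov⟩ := Vitali.exists_disjoint_subfamily_covering_enlargement
    (korShell k) T (fun z => 1 - ‖z‖) 2 one_lt_two
    (fun z hz => sub_nonneg.2 hz.1.le) 1
    (fun z _ => sub_le_self _ (norm_nonneg z))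
    (fun z hz => nonempty_of_measure_ne_zero ((zero_le).trans_lt hz.2).ne')
  have hcount : u.Countable := by
    have h1 := Measure.countable_meas_pos_of_disjoint_iUnion (μ := μ)
      (As := fun b : u => korShell k (b : Cn (n + 1))) (fun b => measurableSet_korShell k _)
      (fun a b hab => hdisj a.2 b.2 (fun h => hab (Subtype.ext h)))
    have h2 : {i : u | 0 < μ (korShell k (i : Cn (n + 1)))} = Set.univ :=
      Set.eq_univ_of_forall fun i => (zero_le).trans_lt (huT i.2).2
    rw [h2] at h1
    exact Set.countable_coe_iff.1 (Set.countable_univ_iff.1 h1)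
  -- A point `a` covered by `b` has `1 - ‖a‖ ≤ 2 (1 - ‖b‖)`. The quasi-triangle inequality through a
  -- common point then gives the radius `4 (2 + 4) 2 ^ k (1 - ‖b‖)`, whence `24`.
  set P : Cn (n + 1) → Set (Cn (n + 1)) := fun b =>
    {w | ‖w‖ < 1 ∧ korDist b w < 24 * (2 ^ k * (1 - ‖b‖)) ∧ 1 - 2 * (1 - ‖b‖) ≤ ‖w‖} with hP
  have hsub : T ⊆ ⋃ b ∈ u, P b := by
    intro a ha
    obtain ⟨b, hb, ⟨x, hxa, hxb⟩, hd⟩ := hcov a ha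
    have hb1 := (huT hb).1
    refine Set.mem_biUnion hb ⟨ha.1, ?_, ?_⟩
    · have h1 := korDist_triangle hb1.le hxa.1.le ha.1.le
      have h2 := hxa.2
      have h3 := hxb.2
      rw [korDist_comm] at h2
      have h5 : (2 : ℝ) ^ (k + 1) * (1 - ‖a‖) ≤ 2 ^ (k + 1) * (2 * (1 - ‖b‖)) := by gcongr
      rw [pow_succ] at h5 h2 h3
      linarith
    · linarith
  have hPle : ∀ b ∈ u, ENNReal.ofReal (2 ^ k * t) * volume (P b) ≤
      (C * (2 * 24 ^ (n + 1)) : ℝ≥0) * μ (korShell k b) := by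
    intro b hb
    have hb1 : 0 < 1 - ‖b‖ := by have := (huT hb).1; linarith
    have hk : (1 : ℝ) ≤ 2 ^ k := one_le_pow₀ (by norm_num)
    have h1 := hC b (huT hb).1.le (2 * (1 - ‖b‖)) (24 * (2 ^ k * (1 - ‖b‖))) (by positivity)
      (by nlinarith)
    calc ENNReal.ofReal (2 ^ k * t) * volume (P b)
        ≤ ENNReal.ofReal (2 ^ k * t) * (C * ENNReal.ofReal
          ((24 * (2 ^ k * (1 - ‖b‖))) ^ (n + 1) * (2 * (1 - ‖b‖)))) := by gcongr
      _ = (C * (2 * 24 ^ (n + 1)) : ℝ≥0) *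
          ENNReal.ofReal (t * (2 ^ k * (1 - ‖b‖)) ^ (n + 2)) := by
          rw [mul_left_comm, ← ENNReal.ofReal_mul (by positivity),
            show 2 ^ k * t * ((24 * (2 ^ k * (1 - ‖b‖))) ^ (n + 1) * (2 * (1 - ‖b‖))) =
              (2 * 24 ^ (n + 1)) * (t * (2 ^ k * (1 - ‖b‖)) ^ (n + 2)) by rw [mul_pow]; ring,
            ENNReal.ofReal_mul (by positivity), ENNReal.ofReal_mul (by positivity),
            ENNReal.ofReal_pow (by positivity), ENNReal.ofReal_ofNat, ENNReal.ofReal_ofNat]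
          push_cast; ring
      _ ≤ _ := by gcongr; exact (huT hb).2.le
  calc ENNReal.ofReal (2 ^ k * t) * volume T
      ≤ ENNReal.ofReal (2 ^ k * t) * ∑' b : u, volume (P b) := by
        gcongr
        exact (measure_mono hsub).trans (measure_biUnion_le _ hcount _)
    _ = ∑' b : u, ENNReal.ofReal (2 ^ k * t) * volume (P b) := ENNReal.tsum_mul_left.symm
    _ ≤ ∑' b : u, (C * (2 * 24 ^ (n + 1)) : ℝ≥0) * μ (korShell k b) :=
        ENNReal.tsum_le_tsum fun b => hPle b b.2
    _ = (C * (2 * 24 ^ (n + 1)) : ℝ≥0) * μ (⋃ b ∈ u, korShell k b) := by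
        rw [ENNReal.tsum_mul_left, measure_biUnion hcount hdisj
          fun b _ => measurableSet_korShell k b]
    _ ≤ _ := by gcongr; exact Set.subset_univ _

/-- The weak type `(1, 1)` bound for `shellSum`. -/
lemma volume_shellSum_gt_le (n : ℕ) :
    ∃ C : ℝ≥0, ∀ (μ : Measure (Cn (n + 1))) [IsFiniteMeasure μ] (t : ℝ), 0 < t →
      ENNReal.ofReal t * volume {z : Cn (n + 1) | ‖z‖ < 1 ∧ ENNReal.ofReal t < shellSum μ z} ≤
        C * μ Set.univ := by
  obtain ⟨C, hC⟩ := volume_korShell_mean_gt_le n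
  refine ⟨48 * C, fun μ _ t ht => ?_⟩
  -- The level `t` is distributed over the scales; `12` is the sum of `(k + 2) (2 / 3) ^ k`. Any
  -- ratio strictly between `1 / 2` and `1` would do: the levels must be summable against `k + 2`,
  -- while the loss `(3 / 2) ^ k` must be beaten by the gain `2 ^ (-k)`.
  have hgeo : HasSum (fun k : ℕ => ((k : ℝ) + 2) * (t / 12 * (2 / 3) ^ k)) t := by
    have h1 := hasSum_coe_mul_geometric_of_norm_lt_one (r := (2 / 3 : ℝ)) (by norm_num)
    have h2 := hasSum_geometric_of_lt_one (r := (2 / 3 : ℝ)) (by norm_num) (by norm_num)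
    have h3 := (h1.add (h2.mul_left 2)).mul_left (t / 12)
    rw [show t / 12 * (2 / 3 / (1 - 2 / 3) ^ 2 + 2 * (1 - 2 / 3)⁻¹) = t by norm_num] at h3
    exact h3.congr_fun fun k => by ring
  set T : ℕ → Set (Cn (n + 1)) := fun k => {z | ‖z‖ < 1 ∧
    ENNReal.ofReal (t / 12 * (2 / 3) ^ k * (2 ^ k * (1 - ‖z‖)) ^ (n + 2)) < μ (korShell k z)}
    with hT
  have hsub : {z : Cn (n + 1) | ‖z‖ < 1 ∧ ENNReal.ofReal t < shellSum μ z} ⊆ ⋃ k, T k := by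
    rintro z ⟨hz, hS⟩
    by_contra hcon
    simp only [hT, Set.mem_iUnion, Set.mem_ofPred_eq, not_exists, not_and, not_lt] at hcon
    refine absurd hS (not_lt.2 ?_)
    have hz0 : 0 < 1 - ‖z‖ := by linarith
    calc shellSum μ z ≤ ∑' k : ℕ, ENNReal.ofReal (((k : ℝ) + 2) * (t / 12 * (2 / 3) ^ k)) := by
          refine ENNReal.tsum_le_tsum fun k => ?_
          calc _ ≤ (k + 2 : ℝ≥0∞) * ENNReal.ofReal ((2 ^ k * (1 - ‖z‖)) ^ (n + 1 + 1))⁻¹ *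
                ENNReal.ofReal (t / 12 * (2 / 3) ^ k * (2 ^ k * (1 - ‖z‖)) ^ (n + 2)) := by
                gcongr; exact hcon k hz
            _ = _ := by
                rw [mul_assoc, ← ENNReal.ofReal_mul (by positivity),
                  ENNReal.ofReal_mul (p := (k : ℝ) + 2) (by positivity),
                  ENNReal.ofReal_add (by positivity) (by positivity), ENNReal.ofReal_natCast,
                  ENNReal.ofReal_ofNat]
                congr 2
                field_simp
      _ = ENNReal.ofReal t := by
          rw [← ENNReal.ofReal_tsum_of_nonneg (fun k => by positivity) hgeo.summable,
            hgeo.tsum_eq]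
  have hk : ∀ k, ENNReal.ofReal t * volume (T k) ≤
      ENNReal.ofReal (12 * (3 / 4) ^ k) * (C * μ Set.univ) := by
    intro k
    have h1 := hC μ k (t / 12 * (2 / 3) ^ k) (by positivity)
    calc ENNReal.ofReal t * volume (T k)
        = ENNReal.ofReal (12 * (3 / 4) ^ k) *
          (ENNReal.ofReal (2 ^ k * (t / 12 * (2 / 3) ^ k)) * volume (T k)) := by
          rw [← mul_assoc, ← ENNReal.ofReal_mul (by positivity)]
          congr 2
          rw [show 12 * (3 / 4 : ℝ) ^ k * (2 ^ k * (t / 12 * (2 / 3) ^ k)) =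
            t * ((3 / 4) * 2 * (2 / 3)) ^ k by rw [mul_pow, mul_pow]; ring]
          norm_num
      _ ≤ _ := by gcongr
  have hgeo2 : HasSum (fun k : ℕ => (12 : ℝ) * (3 / 4) ^ k) 48 := by
    have h2 := (hasSum_geometric_of_lt_one (r := (3 / 4 : ℝ)) (by norm_num)
      (by norm_num)).mul_left 12
    rwa [show (12 : ℝ) * (1 - 3 / 4)⁻¹ = 48 by norm_num] at h2
  calc _ ≤ ENNReal.ofReal t * ∑' k, volume (T k) := by
        gcongr; exact (measure_mono hsub).trans (measure_iUnion_le _)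
    _ = ∑' k, ENNReal.ofReal t * volume (T k) := ENNReal.tsum_mul_left.symm
    _ ≤ ∑' k : ℕ, ENNReal.ofReal (12 * (3 / 4) ^ k) * (C * μ Set.univ) :=
        ENNReal.tsum_le_tsum hk
    _ = ENNReal.ofReal 48 * (C * μ Set.univ) := by
        rw [ENNReal.tsum_mul_right, ← ENNReal.ofReal_tsum_of_nonneg (fun k => by positivity)
          hgeo2.summable, hgeo2.tsum_eq]
    _ = _ := by rw [ENNReal.ofReal_ofNat]; push_cast; ring

end BergmanCommutator

/-! ### Smooth cutoffs and Green's identity. -/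

section Green

/-- A smooth step function `θ` from `0` to `1` on `[0, 1]`, with first and second derivatives
`θ₁`, `θ₂` bounded by `M`. -/
structure IsSmoothStep (θ θ₁ θ₂ : ℝ → ℝ) (M : ℝ) : Prop where
  nonneg : 0 ≤ M
  deriv : ∀ u, HasDerivAt θ (θ₁ u) u
  deriv₂ : ∀ u, HasDerivAt θ₁ (θ₂ u) u
  cont₂ : Continuous θ₂
  bound : ∀ u, |θ u| ≤ 1
  bound₁ : ∀ u, |θ₁ u| ≤ M
  bound₂ : ∀ u, |θ₂ u| ≤ M
  eq_zero : ∀ u < 0, θ u = 0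
  eq_one : ∀ u, 1 ≤ u → θ u = 1
  deriv_eq_zero : ∀ u, u ∉ Set.Icc (0 : ℝ) 1 → θ₁ u = 0 ∧ θ₂ u = 0

lemma exists_isSmoothStep : ∃ (θ θ₁ θ₂ : ℝ → ℝ) (M : ℝ), IsSmoothStep θ θ₁ θ₂ M := by
  set θ := Real.smoothTransition with hθ
  have hsm : ContDiff ℝ 2 θ := Real.smoothTransition.contDiff
  have hd : ContDiff ℝ 1 (deriv θ) := by
    have : ContDiff ℝ (1 + 1) θ := by exact_mod_cast hsm
    exact (contDiff_succ_iff_deriv.1 this).2.2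
  have hdd : Continuous (deriv (deriv θ)) := hd.continuous_deriv (by norm_num)
  have hout : ∀ u, u ∉ Set.Icc (0 : ℝ) 1 → deriv θ u = 0 ∧ deriv (deriv θ) u = 0 := by
    intro u hu
    have hc : ∃ c, θ =ᶠ[nhds u] fun _ => c := by
      rcases lt_or_ge u 0 with h | h
      · exact ⟨0, by filter_upwards [Iio_mem_nhds h] with x hx using
          Real.smoothTransition.zero_of_nonpos (le_of_lt hx)⟩
      · have h1 : 1 < u := by
          by_contra h1; exact hu ⟨h, not_lt.1 h1⟩
        exact ⟨1, by filter_upwards [Ioi_mem_nhds h1] with x hx using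
          Real.smoothTransition.one_of_one_le (le_of_lt hx)⟩
    obtain ⟨c, hc⟩ := hc
    have h1 : deriv θ =ᶠ[nhds u] fun _ => 0 := by
      have := hc.deriv
      simpa using this
    exact ⟨h1.eq_of_nhds, by simpa using h1.deriv_eq⟩
  obtain ⟨M₁, hM₁⟩ := isCompact_Icc.exists_bound_of_continuousOn (s := Set.Icc (0 : ℝ) 1)
    (hd.continuous.continuousOn)
  obtain ⟨M₂, hM₂⟩ := isCompact_Icc.exists_bound_of_continuousOn (s := Set.Icc (0 : ℝ) 1)
    (hdd.continuousOn)
  have h0 : (0 : ℝ) ∈ Set.Icc (0 : ℝ) 1 := by simp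
  have hM0 : 0 ≤ max M₁ M₂ := (norm_nonneg _).trans ((hM₁ 0 h0).trans (le_max_left _ _))
  refine ⟨θ, deriv θ, deriv (deriv θ), max M₁ M₂, hM0,
    fun u => (hsm.differentiable (by norm_num) u).hasDerivAt,
    fun u => (hd.differentiable (by norm_num) u).hasDerivAt, hdd, fun u => ?_, fun u => ?_,
    fun u => ?_, fun u hu => Real.smoothTransition.zero_of_nonpos hu.le,
    fun u hu => Real.smoothTransition.one_of_one_le hu, hout⟩
  · rw [abs_of_nonneg (Real.smoothTransition.nonneg _)]
    exact Real.smoothTransition.le_one _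
  · by_cases hu : u ∈ Set.Icc (0 : ℝ) 1
    · exact (hM₁ u hu).trans (le_max_left _ _)
    · rw [(hout u hu).1, abs_zero]; exact hM0
  · by_cases hu : u ∈ Set.Icc (0 : ℝ) 1
    · exact (hM₂ u hu).trans (le_max_right _ _)
    · rw [(hout u hu).2, abs_zero]; exact hM0

/-- Composed with `‖x‖ ^ 2`, this is up to normalisation the Newton kernel of real dimension `2 n`,
logarithmic when `n = 1`. Only its derivative is used later, which treats all dimensions at once. -/
lemma exists_antideriv_neg_inv_pow (n : ℕ) :
    ∃ g : ℝ → ℝ, ∀ a, 0 < a → HasDerivAt g (-(a ^ n)⁻¹) a := by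
  rcases eq_or_ne n 1 with rfl | hn
  · exact ⟨fun a => -Real.log a, fun a ha => by
      rw [pow_one]; exact (Real.hasDerivAt_log ha.ne').neg⟩
  · refine ⟨fun a => a ^ (1 - n : ℤ) / (n - 1), fun a ha => ?_⟩
    have h1 : ((n : ℝ) - 1) ≠ 0 := by
      rw [sub_ne_zero]; exact_mod_cast hn
    refine ((hasDerivAt_zpow (1 - n : ℤ) a (Or.inl ha.ne')).div_const _).congr_deriv ?_
    rw [show (1 - n - 1 : ℤ) = -(n : ℤ) by ring, zpow_neg, zpow_natCast]
    push_cast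
    field_simp
    ring

variable {E : Type*} [NormedAddCommGroup E] [InnerProductSpace ℝ E]

lemma hasLineDerivAt_const_fun {F : Type*} [NormedAddCommGroup F] [NormedSpace ℝ F] (c : F)
    (x v : E) : HasLineDerivAt ℝ (fun _ : E => c) 0 x v :=
  hasDerivAt_const _ _

lemma hasLineDerivAt_comp {g : ℝ → ℝ} {q : E → ℝ} {g' q' : ℝ} {x v : E}
    (hg : HasDerivAt g g' (q x)) (hq : HasLineDerivAt ℝ q q' x v) :
    HasLineDerivAt ℝ (fun y => g (q y)) (g' * q') x v := by
  unfold HasLineDerivAt at *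
  refine HasDerivAt.comp (h := fun t : ℝ => q (x + t • v)) (h₂ := g) 0 ?_ hq
  simpa using hg

lemma hasLineDerivAt_mul {f g : E → ℝ} {f' g' : ℝ} {x v : E}
    (hf : HasLineDerivAt ℝ f f' x v) (hg : HasLineDerivAt ℝ g g' x v) :
    HasLineDerivAt ℝ (fun y => f y * g y) (f' * g x + f x * g') x v := by
  unfold HasLineDerivAt at *
  exact (HasDerivAt.mul hf hg).congr_deriv (by simp)

lemma hasLineDerivAt_smul {F : Type*} [NormedAddCommGroup F] [NormedSpace ℝ F] {f : E → ℝ}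
    {g : E → F} {f' : ℝ} {g' : F} {x v : E}
    (hf : HasLineDerivAt ℝ f f' x v) (hg : HasLineDerivAt ℝ g g' x v) :
    HasLineDerivAt ℝ (fun y => f y • g y) (f x • g' + f' • g x) x v := by
  unfold HasLineDerivAt at *
  exact (HasDerivAt.smul hf hg).congr_deriv (by simp)

/-- Leibniz rule for a product one factor of which is only controlled on an open set containing
the support of the other. -/
lemma hasLineDerivAt_mul_of_support {K U : Set E} (hK : IsClosed K) {v : E}
    {k k₁ G G₁ : E → ℝ} (hk : ∀ x ∈ U, HasLineDerivAt ℝ k (k₁ x) x v)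
    (hG : ∀ x ∈ U, HasLineDerivAt ℝ G (G₁ x) x v) (hKU : K ⊆ U)
    (h0 : ∀ x ∉ K, k x = 0) (h1 : ∀ x ∉ K, k₁ x = 0) (x : E) :
    HasLineDerivAt ℝ (fun y => k y * G y) (k₁ x * G x + k x * G₁ x) x v := by
  by_cases hx : x ∈ K
  · exact hasLineDerivAt_mul (hk x (hKU hx)) (hG x (hKU hx))
  · rw [h0 x hx, h1 x hx, zero_mul, zero_mul, add_zero]
    have : (fun y => k y * G y) =ᶠ[nhds x] fun _ => 0 := by
      filter_upwards [hK.isOpen_compl.mem_nhds hx] with y hy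
      rw [h0 y hy, zero_mul]
    exact (hasLineDerivAt_const_fun (0 : ℝ) x v).congr_of_eventuallyEq this

lemma integrable_of_continuousOn_of_eq_zero_off {E F : Type*} [NormedAddCommGroup F]
    [TopologicalSpace E] [T2Space E] [MeasurableSpace E] [BorelSpace E]
    {μ : Measure E} [IsFiniteMeasureOnCompacts μ] {K : Set E} {f : E → F} (hK : IsCompact K)
    (hf : ContinuousOn f K) (h0 : ∀ x ∉ K, f x = 0) : Integrable f μ :=
  (integrableOn_iff_integrable_of_support_subset (fun x hx => by
    by_contra h; exact hx (h0 x h))).1 (hf.integrableOn_compact hK)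

variable [FiniteDimensional ℝ E] [MeasurableSpace E] [BorelSpace E]

open scoped Laplacian in
/-- Green's second identity for a harmonic function and a compactly supported test function. -/
lemma integral_mul_laplacian_eq_zero {μ : Measure E} [μ.IsAddHaarMeasure] {ι : Type*} [Fintype ι]
    (e : OrthonormalBasis ι ℝ E) {U K : Set E} (hU : IsOpen U) (hK : IsCompact K) (hKU : K ⊆ U)
    {b : E → ℂ} (hb : InnerProductSpace.HarmonicOnNhd b U) {f : E → ℝ} {f₁ f₂ : ι → E → ℝ}
    (hf : ∀ i x, HasLineDerivAt ℝ f (f₁ i x) x (e i))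
    (hf₁ : ∀ i x, HasLineDerivAt ℝ (f₁ i) (f₂ i x) x (e i))
    (hc : ContinuousOn f K) (hc₁ : ∀ i, ContinuousOn (f₁ i) K) (hc₂ : ∀ i, ContinuousOn (f₂ i) K)
    (h0 : ∀ x ∉ K, f x = 0) (h1 : ∀ i, ∀ x ∉ K, f₁ i x = 0) (h2 : ∀ i, ∀ x ∉ K, f₂ i x = 0) :
    ∫ x, (∑ i, f₂ i x) • b x ∂μ = 0 := by
  have hbC : ContDiffOn ℝ 2 b U := hb.contDiffOn
  have hbc : ContinuousOn b K := hb.continuousOn.mono hKU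
  set b₁ : ι → E → ℂ := fun i x => fderiv ℝ b x (e i) with hb₁
  set b₂ : ι → E → ℂ := fun i x => fderiv ℝ (b₁ i) x (e i) with hb₂
  have hfd : ContDiffOn ℝ 1 (fderiv ℝ b) U := hbC.fderiv_of_isOpen hU (by norm_num)
  have hb₁C : ∀ i, ContDiffOn ℝ 1 (b₁ i) U := fun i => hfd.clm_apply contDiffOn_const
  have hb₂c : ∀ i, ContinuousOn (b₂ i) K := fun i =>
    (((hb₁C i).continuousOn_fderiv_of_isOpen hU (by norm_num)).clm_apply
      continuousOn_const).mono hKU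
  have hbd : ∀ i, ∀ x ∈ U, HasLineDerivAt ℝ b (b₁ i x) x (e i) := fun i x hx =>
    (((hbC.differentiableOn (by norm_num)).differentiableAt
      (hU.mem_nhds hx)).hasFDerivAt).hasLineDerivAt _
  have hb₁d : ∀ i, ∀ x ∈ U, HasLineDerivAt ℝ (b₁ i) (b₂ i x) x (e i) := fun i x hx =>
    ((((hb₁C i).differentiableOn (by norm_num)).differentiableAt
      (hU.mem_nhds hx)).hasFDerivAt).hasLineDerivAt _
  have hlap : ∀ x ∈ U, ∑ i, b₂ i x = 0 := by
    intro x hx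
    have h3 : (Δ b) x = 0 := (hb x hx).2.eq_of_nhds
    rw [InnerProductSpace.laplacian_eq_iteratedFDeriv_orthonormalBasis b e] at h3
    rw [← h3]
    refine Finset.sum_congr rfl fun i _ => ?_
    rw [iteratedFDeriv_two_apply]
    simp only [hb₂, hb₁, Matrix.cons_val_zero, Matrix.cons_val_one]
    rw [fderiv_clm_apply ((hfd.differentiableOn (by norm_num)).differentiableAt
      (hU.mem_nhds hx)) (differentiableAt_const _)]
    simp
  have hint : ∀ i, Integrable (fun x => f₂ i x • b x) μ := fun i =>
    integrable_of_continuousOn_of_eq_zero_off hK ((hc₂ i).smul hbc)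
      (fun x hx => by rw [h2 i x hx, zero_smul])
  have hint' : ∀ i, Integrable (fun x => f x • b₂ i x) μ := fun i =>
    integrable_of_continuousOn_of_eq_zero_off hK (hc.smul (hb₂c i))
      (fun x hx => by rw [h0 x hx, zero_smul])
  have hibp : ∀ i, ∫ x, (f₂ i x • b x - f x • b₂ i x) ∂μ = 0 := by
    intro i
    set W : E → ℂ := fun x => f₁ i x • b x - f x • b₁ i x with hW
    have hWc : ContinuousOn W K :=
      ((hc₁ i).smul hbc).sub (hc.smul ((hb₁C i).continuousOn.mono hKU))
    have hW0 : ∀ x ∉ K, W x = 0 := fun x hx => by simp [hW, h0 x hx, h1 i x hx]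
    have hWd : ∀ x, HasLineDerivAt ℝ W (f₂ i x • b x - f x • b₂ i x) x (e i) := by
      intro x
      by_cases hx : x ∈ K
      · have k1 := hasLineDerivAt_smul (hf₁ i x) (hbd i x (hKU hx))
        have k2 := hasLineDerivAt_smul (hf i x) (hb₁d i x (hKU hx))
        have k3 : HasLineDerivAt ℝ W _ x (e i) := HasDerivAt.sub k1 k2
        convert k3 using 1
        abel
      · have : W =ᶠ[nhds x] fun _ => 0 := by
          filter_upwards [hK.isClosed.isOpen_compl.mem_nhds hx] with y hy using hW0 y hy
        rw [h0 x hx, h2 i x hx, zero_smul, zero_smul, sub_zero]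
        exact (hasLineDerivAt_const_fun (0 : ℂ) x (e i)).congr_of_eventuallyEq this
    -- Integration by parts against the constant `1`: a directional derivative of the compactly
    -- supported `W` has integral zero.
    have key := integral_bilinear_hasLineDerivAt_right_eq_neg_left_of_integrable (μ := μ)
      (f := fun _ : E => (1 : ℝ)) (f' := fun _ => 0) (g := W)
      (g' := fun x => f₂ i x • b x - f x • b₂ i x) (v := e i)
      (B := ContinuousLinearMap.lsmul ℝ ℝ) (by simp)
      (by simpa using! (hint i).sub (hint' i))
      (by simpa using integrable_of_continuousOn_of_eq_zero_off hK hWc hW0)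
      (fun x _ => hasLineDerivAt_const_fun (1 : ℝ) x (e i)) (fun x _ => hWd x)
    simpa using key
  have hfb : ∀ x, ∑ i, f x • b₂ i x = 0 := by
    intro x
    by_cases hx : x ∈ K
    · rw [← Finset.smul_sum, hlap x (hKU hx), smul_zero]
    · simp [h0 x hx]
  calc ∫ x, (∑ i, f₂ i x) • b x ∂μ = ∫ x, ∑ i, (f₂ i x • b x - f x • b₂ i x) ∂μ := by
        congr 1; ext1 x
        rw [Finset.sum_sub_distrib, hfb, sub_zero, Finset.sum_smul]
    _ = ∑ i, ∫ x, (f₂ i x • b x - f x • b₂ i x) ∂μ :=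
        integral_finsetSum _ fun i _ => (hint i).sub (hint' i)
    _ = 0 := Finset.sum_eq_zero fun i _ => hibp i

end Green

/-! ### The truncated Green function of the ball. -/

section Kernel

lemma hasDerivAt_inv_pow (n : ℕ) {a : ℝ} (ha : 0 < a) :
    HasDerivAt (fun t : ℝ => (t ^ n)⁻¹) (-(n * (a ^ (n + 1))⁻¹)) a := by
  refine ((hasDerivAt_pow n a).inv (by positivity)).congr_deriv ?_
  rcases n with _ | n
  · simp
  · rw [Nat.add_sub_cancel]
    field_simp
    ring

lemma abs_sub_le_of_hasDerivAt {g g' : ℝ → ℝ} {q p B : ℝ} (hqp : q ≤ p)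
    (hg : ∀ t ∈ Set.Icc q p, HasDerivAt g (g' t) t) (hB : ∀ t ∈ Set.Icc q p, |g' t| ≤ B) :
    |g q - g p| ≤ B * (p - q) := by
  have := (convex_Icc q p).norm_image_sub_le_of_norm_hasDerivWithin_le
    (fun t ht => (hg t ht).hasDerivWithinAt) hB (Set.right_mem_Icc.2 hqp)
    (Set.left_mem_Icc.2 hqp)
  rwa [Real.norm_eq_abs, Real.norm_eq_abs, abs_sub_comm q p,
    abs_of_nonneg (sub_nonneg.2 hqp)] at this

/-- The estimate of the terms of the Laplacian that come from the cutoff. -/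
lemma abs_cutoff_terms_le {n : ℕ} {g : ℝ → ℝ} (hg : ∀ a, 0 < a → HasDerivAt g (-(a ^ n)⁻¹) a)
    {ρ τ ζ ε s q p A B M : ℝ} (hM : 0 ≤ M) (hA : |A| ≤ M) (hB : |B| ≤ M) (hρ0 : 0 ≤ ρ)
    (hρ1 : ρ ≤ 1) (hζ0 : 0 ≤ ζ) (hζ1 : ζ < 1) (hτ : |τ| ≤ 1) (hs : 0 < s) (hs1 : s ≤ 1)
    (hε : 0 < ε) (hεs : ε ≤ s * (1 - ζ)) (hr1 : s ≤ 1 - ρ) (hr2 : 1 - ρ ≤ 2 * s)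
    (hq : q = ρ - 2 * τ + ζ + ε) (hp : p = ζ * ρ - 2 * τ + 1) (hqs : s ≤ q) :
    |B * (4 / s ^ 2) * ρ * (g q - g p) +
      A * (8 / s) * ((q ^ n)⁻¹ * (ρ - τ) - (p ^ n)⁻¹ * (ζ * ρ - τ)) -
      4 * n * A / s * (g q - g p)| ≤ M * (16 + 40 * n) * ((1 - ζ) / s) * (q ^ n)⁻¹ := by
  have hq0 : 0 < q := hs.trans_le hqs
  have hpq : p - q = (1 - ρ) * (1 - ζ) - ε := by rw [hq, hp]; ring
  have hqp : q ≤ p := by nlinarith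
  have hpq2 : p - q ≤ 2 * s * (1 - ζ) := by nlinarith
  set D := 1 - ζ with hD
  have hD0 : 0 < D := by linarith
  set Q := (q ^ n)⁻¹ with hQ
  set P := (p ^ n)⁻¹ with hP
  have hQ0 : 0 < Q := by positivity
  -- The Green function nearly vanishes at the sphere: `p - q ≤ 2 s D`. This gains a factor `s`
  -- against the `s⁻²` from two derivatives of the cutoff, as well as the factor `D` of the Poisson
  -- kernel.
  have hG : |g q - g p| ≤ Q * (2 * s * D) := by
    refine (abs_sub_le_of_hasDerivAt hqp (fun t ht => hg t (hq0.trans_le ht.1))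
      (B := Q) fun t ht => ?_).trans (by gcongr)
    have ht0 : 0 < t := hq0.trans_le ht.1
    rw [abs_neg, abs_of_pos (by positivity)]
    have := ht.1
    simp only [hQ]
    gcongr
  have hQP : |Q - P| ≤ n * (2 * D * Q) := by
    refine (abs_sub_le_of_hasDerivAt (g := fun t : ℝ => (t ^ n)⁻¹) hqp
      (fun t ht => hasDerivAt_inv_pow n (hq0.trans_le ht.1))
      (B := n * (q ^ (n + 1))⁻¹) fun t ht => ?_).trans ?_
    · have ht0 : 0 < t := hq0.trans_le ht.1
      rw [abs_neg, abs_of_nonneg (by positivity)]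
      have := ht.1
      gcongr
    · rw [mul_assoc]
      refine mul_le_mul_of_nonneg_left ?_ (by positivity)
      calc (q ^ (n + 1))⁻¹ * (p - q) ≤ (q ^ (n + 1))⁻¹ * (2 * q * D) := by
            gcongr
            nlinarith
        _ = 2 * D * Q := by rw [hQ, pow_succ]; field_simp
  have hbr : |Q * (ρ - τ) - P * (ζ * ρ - τ)| ≤ (1 + 4 * n) * (D * Q) := by
    -- Neither product on the left carries a factor `D` by itself; after regrouping both summands
    -- do.
    have e : Q * (ρ - τ) - P * (ζ * ρ - τ) = Q * (ρ * D) + (Q - P) * (ζ * ρ - τ) := by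
      rw [hD]; ring
    rw [e]
    refine (abs_add_le _ _).trans ?_
    have h1 : |Q * (ρ * D)| ≤ D * Q := by
      rw [abs_of_nonneg (by positivity)]
      have : ρ * (D * Q) ≤ 1 * (D * Q) := by gcongr
      linarith
    have h2 : |ζ * ρ - τ| ≤ 2 := by
      refine (abs_sub _ _).trans ?_
      rw [abs_of_nonneg (by positivity : 0 ≤ ζ * ρ)]
      nlinarith
    have h3 : |(Q - P) * (ζ * ρ - τ)| ≤ n * (2 * D * Q) * 2 := by
      rw [abs_mul]; gcongr
    linarith
  have t1 : |B * (4 / s ^ 2) * ρ * (g q - g p)| ≤ M * (8 * (D / s)) * Q := by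
    rw [abs_mul, abs_mul, abs_mul, abs_of_nonneg hρ0, abs_of_pos (by positivity : 0 < 4 / s ^ 2)]
    calc |B| * (4 / s ^ 2) * ρ * |g q - g p| ≤ M * (4 / s ^ 2) * 1 * (Q * (2 * s * D)) := by gcongr
      _ = _ := by field_simp; ring
  have t2 : |A * (8 / s) * (Q * (ρ - τ) - P * (ζ * ρ - τ))| ≤
      M * (8 / s) * ((1 + 4 * n) * (D * Q)) := by
    rw [abs_mul, abs_mul, abs_of_pos (by positivity : 0 < 8 / s)]
    gcongr
  have t3 : |4 * n * A / s * (g q - g p)| ≤ M * (8 * n * (D / s)) * Q := by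
    rw [abs_mul, abs_div, abs_mul, abs_of_nonneg (by positivity : (0 : ℝ) ≤ 4 * n), abs_of_pos hs]
    calc 4 * n * |A| / s * |g q - g p| ≤ 4 * n * M / s * (Q * (2 * s * D)) := by gcongr
      _ = M * (8 * n * (D / s)) * Q * s := by field_simp; ring
      _ ≤ M * (8 * n * (D / s)) * Q * 1 := by gcongr
      _ = _ := mul_one _
  refine (abs_sub _ _).trans ((add_le_add (abs_add_le _ _) le_rfl).trans ?_)
  refine (add_le_add (add_le_add t1 t2) t3).trans (le_of_eq ?_)
  ring

variable {E : Type*} [NormedAddCommGroup E] [InnerProductSpace ℝ E]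

lemma hasLineDerivAt_norm_sq (x v : E) :
    HasLineDerivAt ℝ (fun y : E => ‖y‖ ^ 2) (2 * inner ℝ x v) x v := by
  have := (hasStrictFDerivAt_norm_sq x).hasFDerivAt.hasLineDerivAt v
  simpa using this

lemma hasLineDerivAt_inner_left (w x v : E) :
    HasLineDerivAt ℝ (fun y : E => inner ℝ y w) (inner ℝ v w) x v := by
  have := ((innerSL ℝ w).hasFDerivAt (x := x)).hasLineDerivAt v
  have e : (fun y : E => inner ℝ y w) = innerSL ℝ w := by
    ext y; rw [innerSL_apply_apply, real_inner_comm]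
  rwa [← e] at this

variable [FiniteDimensional ℝ E] [MeasurableSpace E] [BorelSpace E]

/-- Green's identity in the ball against the truncated Green function with pole near `z`. -/
lemma enorm_integral_mollifier_le {n : ℕ} (hdim : Module.finrank ℝ E = 2 * n)
    {μ : Measure E} [μ.IsAddHaarMeasure] {θ θ₁ θ₂ : ℝ → ℝ} {M : ℝ}
    (hθ : IsSmoothStep θ θ₁ θ₂ M) {b : E → ℂ}
    (hb : InnerProductSpace.HarmonicOnNhd b (Metric.ball 0 1)) {z : E} (hz : ‖z‖ < 1) {s ε : ℝ}
    (hs : 0 < s) (hsz : 16 * s ≤ (1 - ‖z‖ ^ 2) ^ 2) (hε : 0 < ε)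
    (hεs : ε ≤ s * (1 - ‖z‖ ^ 2)) :
    ‖∫ x, (4 * n * ε * θ ((1 - ‖x‖ ^ 2) / s - 1) * ((‖x - z‖ ^ 2 + ε) ^ (n + 1))⁻¹) • b x ∂μ‖ₑ ≤
      ENNReal.ofReal (M * (16 + 40 * n) * ((1 - ‖z‖ ^ 2) / s)) *
        ∫⁻ x in {x | s ≤ 1 - ‖x‖ ^ 2 ∧ 1 - ‖x‖ ^ 2 ≤ 2 * s},
          ENNReal.ofReal ((‖x - z‖ ^ (2 * n))⁻¹) * ‖b x‖ₑ ∂μ := by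
  obtain ⟨g, hg⟩ := exists_antideriv_neg_inv_pow n
  set e := stdOrthonormalBasis ℝ E with he
  set ζ : ℝ := ‖z‖ ^ 2 with hζ
  have hζ0 : 0 ≤ ζ := by positivity
  have hζ1 : ζ < 1 := by rw [hζ, sq_lt_one_iff₀ (norm_nonneg _)]; exact hz
  have hs1 : s ≤ 1 / 16 := by nlinarith
  set U : Set E := Metric.ball 0 1 with hU
  set K : Set E := {x | ‖x‖ ^ 2 ≤ 1 - s} with hK
  have hKc : IsClosed K := isClosed_le (by fun_prop) continuous_const
  have hKU : K ⊆ U := fun x hx => by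
    rw [hU, mem_ball_zero_iff, ← sq_lt_one_iff₀ (norm_nonneg _)]
    have : ‖x‖ ^ 2 ≤ 1 - s := hx
    linarith
  have hKcomp : IsCompact K := (isCompact_closedBall (0 : E) 1).of_isClosed_subset hKc
    (hKU.trans Metric.ball_subset_closedBall)
  set u : E → ℝ := fun x => (1 - ‖x‖ ^ 2) / s - 1 with hu
  have huK : ∀ x ∉ K, u x < 0 := fun x hx => by
    have : 1 - s < ‖x‖ ^ 2 := not_le.1 hx
    rw [hu]; simp only [sub_neg]
    rw [div_lt_one hs]; linarith
  -- The number `ε` removes the singularity at `z`. For `z ≠ 0`, `p` is `‖z‖ ^ 2` times the squared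
  -- distance to the reflection of `z` in the sphere, so `g (p x)` is the image term of the Green
  -- function. The relation `p - q = (1 - ‖x‖ ^ 2) (1 - ζ) - ε` shows that `p` is positive in the
  -- ball and close to `q` near the sphere.
  set q : E → ℝ := fun x => ‖x - z‖ ^ 2 + ε with hq
  set p : E → ℝ := fun x => ζ * ‖x‖ ^ 2 - 2 * inner ℝ x z + 1 with hp
  have hqx : ∀ x, q x = ‖x‖ ^ 2 - 2 * inner ℝ x z + ζ + ε := fun x => by
    simp only [hq, norm_sub_sq_real, hζ]
  have hq0 : ∀ x, 0 < q x := fun x => by simp only [hq]; positivity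
  have hp0 : ∀ x ∈ U, 0 < p x := fun x hx => by
    have h1 : ‖x‖ ^ 2 < 1 := by
      rw [sq_lt_one_iff₀ (norm_nonneg _)]; simpa [hU] using hx
    have h2 : p x = ‖x - z‖ ^ 2 + (1 - ‖x‖ ^ 2) * (1 - ζ) := by
      simp only [hp, norm_sub_sq_real, hζ]; ring
    rw [h2]
    have : 0 < (1 - ‖x‖ ^ 2) * (1 - ζ) := mul_pos (by linarith) (by linarith)
    positivity
  have hpc : Continuous p := by simp only [hp]; fun_prop
  have hqc : Continuous q := by simp only [hq]; fun_prop
  have huc : Continuous u := by simp only [hu]; fun_prop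
  have hθc : Continuous θ := continuous_iff_continuousAt.2 fun t => (hθ.deriv t).continuousAt
  have hθ₁c : Continuous θ₁ := continuous_iff_continuousAt.2 fun t => (hθ.deriv₂ t).continuousAt
  set u₁ := fun i (x : E) => -(2 * inner ℝ x (e i)) / s with hu₁
  set q₁ := fun i (x : E) => 2 * inner ℝ (x - z) (e i) with hq₁
  set p₁ := fun i (x : E) => ζ * (2 * inner ℝ x (e i)) - 2 * inner ℝ (e i) z with hp₁
  have hee : ∀ i, inner ℝ (e i) (e i) = 1 := fun i => by
    rw [real_inner_self_eq_norm_sq, e.orthonormal.1, one_pow]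
  have du : ∀ i x, HasLineDerivAt ℝ u (u₁ i x) x (e i) := fun i x => by
    have h1 : HasLineDerivAt ℝ u _ x (e i) := HasDerivAt.sub_const 1
      (HasDerivAt.div_const (HasDerivAt.const_sub 1 (hasLineDerivAt_norm_sq x (e i))) s)
    exact h1
  have du₁ : ∀ i x, HasLineDerivAt ℝ (u₁ i) (-2 / s) x (e i) := fun i x => by
    have h1 : HasLineDerivAt ℝ (u₁ i) _ x (e i) := HasDerivAt.div_const
      (HasDerivAt.neg (HasDerivAt.const_mul 2 (hasLineDerivAt_inner_left (e i) x (e i)))) s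
    rwa [hee, mul_one] at h1
  have dq : ∀ i x, HasLineDerivAt ℝ q (q₁ i x) x (e i) := fun i x => by
    have h1 : HasLineDerivAt ℝ (fun y : E => ‖y - z‖ ^ 2) (q₁ i x) x (e i) := by
      have := hasLineDerivAt_norm_sq (x - z) (e i)
      unfold HasLineDerivAt at this ⊢
      simpa [sub_add_eq_add_sub] using this
    exact HasDerivAt.add_const ε h1
  have dq₁ : ∀ i x, HasLineDerivAt ℝ (q₁ i) 2 x (e i) := fun i x => by
    have h2 : HasLineDerivAt ℝ (fun y => inner ℝ (y - z) (e i)) (1 : ℝ) x (e i) := by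
      have := HasDerivAt.sub_const (inner ℝ z (e i)) (hasLineDerivAt_inner_left (e i) x (e i))
      unfold HasLineDerivAt
      simpa only [inner_sub_left, hee] using this
    have h1 : HasLineDerivAt ℝ (q₁ i) _ x (e i) := HasDerivAt.const_mul 2 h2
    rwa [mul_one] at h1
  have dp : ∀ i x, HasLineDerivAt ℝ p (p₁ i x) x (e i) := fun i x =>
    HasDerivAt.add_const 1 (HasDerivAt.sub
      (HasDerivAt.const_mul ζ (hasLineDerivAt_norm_sq x (e i)))
      (HasDerivAt.const_mul 2 (hasLineDerivAt_inner_left z x (e i))))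
  have dp₁ : ∀ i x, HasLineDerivAt ℝ (p₁ i) (2 * ζ) x (e i) := fun i x => by
    have h1 : HasLineDerivAt ℝ (p₁ i) _ x (e i) := HasDerivAt.sub_const (2 * inner ℝ (e i) z)
      (HasDerivAt.const_mul ζ (HasDerivAt.const_mul 2 (hasLineDerivAt_inner_left (e i) x (e i))))
    rw [hee, mul_one, mul_comm] at h1
    exact h1
  set k : E → ℝ := fun x => θ (u x) with hk
  set k₁ := fun i (x : E) => θ₁ (u x) * u₁ i x with hk₁
  set k₂ := fun i (x : E) => θ₂ (u x) * u₁ i x * u₁ i x + θ₁ (u x) * (-2 / s) with hk₂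
  have dk : ∀ i x, HasLineDerivAt ℝ k (k₁ i x) x (e i) := fun i x =>
    hasLineDerivAt_comp (hθ.deriv _) (du i x)
  have dk₁ : ∀ i x, HasLineDerivAt ℝ (k₁ i) (k₂ i x) x (e i) := fun i x =>
    hasLineDerivAt_mul (hasLineDerivAt_comp (hθ.deriv₂ _) (du i x)) (du₁ i x)
  set G : E → ℝ := fun x => g (q x) - g (p x) with hG
  set G₁ := fun i (x : E) => -(q x ^ n)⁻¹ * q₁ i x - -(p x ^ n)⁻¹ * p₁ i x with hG₁
  set G₂ := fun i (x : E) => (-(-(n * (q x ^ (n + 1))⁻¹)) * q₁ i x * q₁ i x + -(q x ^ n)⁻¹ * 2) -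
    (-(-(n * (p x ^ (n + 1))⁻¹)) * p₁ i x * p₁ i x + -(p x ^ n)⁻¹ * (2 * ζ)) with hG₂
  have dG : ∀ i, ∀ x ∈ U, HasLineDerivAt ℝ G (G₁ i x) x (e i) := fun i x hx =>
    HasDerivAt.sub (hasLineDerivAt_comp (hg _ (hq0 x)) (dq i x))
      (hasLineDerivAt_comp (hg _ (hp0 x hx)) (dp i x))
  have dG₁ : ∀ i, ∀ x ∈ U, HasLineDerivAt ℝ (G₁ i) (G₂ i x) x (e i) := fun i x hx =>
    HasDerivAt.sub
      (hasLineDerivAt_mul (hasLineDerivAt_comp (g := fun t => -(t ^ n)⁻¹)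
        (hasDerivAt_inv_pow n (hq0 x)).neg (dq i x)) (dq₁ i x))
      (hasLineDerivAt_mul (hasLineDerivAt_comp (g := fun t => -(t ^ n)⁻¹)
        (hasDerivAt_inv_pow n (hp0 x hx)).neg (dp i x)) (dp₁ i x))
  have k0 : ∀ x ∉ K, k x = 0 := fun x hx => hθ.eq_zero _ (huK x hx)
  have θ0 : ∀ x ∉ K, θ₁ (u x) = 0 ∧ θ₂ (u x) = 0 := fun x hx =>
    hθ.deriv_eq_zero _ fun h => absurd h.1 (not_le.2 (huK x hx))
  have k₁0 : ∀ i, ∀ x ∉ K, k₁ i x = 0 := fun i x hx => by simp [hk₁, (θ0 x hx).1]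
  have k₂0 : ∀ i, ∀ x ∉ K, k₂ i x = 0 := fun i x hx => by
    simp [hk₂, (θ0 x hx).1, (θ0 x hx).2]
  have hgq : ContinuousOn (fun x => g (q x)) K := fun x hx =>
    ((hg _ (hq0 x)).continuousAt.comp hqc.continuousAt).continuousWithinAt
  have hgp : ContinuousOn (fun x => g (p x)) K := fun x hx =>
    ((hg _ (hp0 x (hKU hx))).continuousAt.comp hpc.continuousAt).continuousWithinAt
  have hqi : ∀ m : ℕ, ContinuousOn (fun x => (q x ^ m)⁻¹) K := fun m =>
    ((hqc.pow m).continuousOn).inv₀ fun x _ => pow_ne_zero _ (hq0 x).ne'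
  have hpi : ∀ m : ℕ, ContinuousOn (fun x => (p x ^ m)⁻¹) K := fun m =>
    ((hpc.pow m).continuousOn).inv₀ fun x hx => pow_ne_zero _ (hp0 x (hKU hx)).ne'
  have hu₁c : ∀ i, Continuous (u₁ i) := fun i => by simp only [hu₁]; fun_prop
  have hq₁c : ∀ i, Continuous (q₁ i) := fun i => by simp only [hq₁]; fun_prop
  have hp₁c : ∀ i, Continuous (p₁ i) := fun i => by simp only [hp₁]; fun_prop
  have kc : ContinuousOn k K := (hθc.comp huc).continuousOn
  have k₁c : ∀ i, ContinuousOn (k₁ i) K := fun i =>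
    ((hθ₁c.comp huc).mul (hu₁c i)).continuousOn
  have k₂c : ∀ i, ContinuousOn (k₂ i) K := fun i =>
    ((((hθ.cont₂.comp huc).mul (hu₁c i)).mul (hu₁c i)).add
      ((hθ₁c.comp huc).mul continuous_const)).continuousOn
  have Gc : ContinuousOn G K := hgq.sub hgp
  have G₁c : ∀ i, ContinuousOn (G₁ i) K := fun i =>
    ((hqi n).neg.mul (hq₁c i).continuousOn).sub ((hpi n).neg.mul (hp₁c i).continuousOn)
  have G₂c : ∀ i, ContinuousOn (G₂ i) K := fun i =>
    (((((continuousOn_const.mul (hqi (n + 1))).neg.neg.mul (hq₁c i).continuousOn).mul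
      (hq₁c i).continuousOn).add ((hqi n).neg.mul continuousOn_const))).sub
    (((((continuousOn_const.mul (hpi (n + 1))).neg.neg.mul (hp₁c i).continuousOn).mul
      (hp₁c i).continuousOn).add ((hpi n).neg.mul continuousOn_const)))
  have key := integral_mul_laplacian_eq_zero (μ := μ) e Metric.isOpen_ball hKcomp hKU hb
    (f := fun x => k x * G x) (f₁ := fun i x => k₁ i x * G x + k x * G₁ i x)
    (f₂ := fun i x => (k₂ i x * G x + k₁ i x * G₁ i x) + (k₁ i x * G₁ i x + k x * G₂ i x))
    (fun i x => hasLineDerivAt_mul_of_support hKc (U := U) (fun y _ => dk i y) (dG i) hKU k0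
      (k₁0 i) x)
    (fun i x => HasDerivAt.add
      (hasLineDerivAt_mul_of_support hKc (U := U) (fun y _ => dk₁ i y) (dG i) hKU (k₁0 i)
        (k₂0 i) x)
      (hasLineDerivAt_mul_of_support hKc (U := U) (fun y _ => dk i y) (dG₁ i) hKU k0
        (k₁0 i) x))
    (kc.mul Gc) (fun i => ((k₁c i).mul Gc).add (kc.mul (G₁c i)))
    (fun i => (((k₂c i).mul Gc).add ((k₁c i).mul (G₁c i))).add
      (((k₁c i).mul (G₁c i)).add (kc.mul (G₂c i))))
    (fun x hx => by simp [k0 x hx]) (fun i x hx => by simp [k0 x hx, k₁0 i x hx])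
    (fun i x hx => by simp [k0 x hx, k₁0 i x hx, k₂0 i x hx])
  -- `R` is the part of the Laplacian of `k * G` in which the cutoff is differentiated. In the rest,
  -- `k * ΔG`, the image term is harmonic and drops out, and only the mollifier `-4 n ε q ^ (-(n +
  -- 1))` remains.
  set R : E → ℝ := fun x => θ₂ (u x) * (4 / s ^ 2) * ‖x‖ ^ 2 * (g (q x) - g (p x)) +
      θ₁ (u x) * (8 / s) * ((q x ^ n)⁻¹ * (‖x‖ ^ 2 - inner ℝ x z) -
        (p x ^ n)⁻¹ * (ζ * ‖x‖ ^ 2 - inner ℝ x z)) -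
      4 * n * θ₁ (u x) / s * (g (q x) - g (p x)) with hR
  have hsum : ∀ x ∈ K, ∑ i, ((k₂ i x * G x + k₁ i x * G₁ i x) +
      (k₁ i x * G₁ i x + k x * G₂ i x)) =
      R x - 4 * n * ε * k x * (q x ^ (n + 1))⁻¹ := by
    intro x hx
    have sxx : ∑ i, inner ℝ x (e i) ^ 2 = ‖x‖ ^ 2 := by
      rw [← real_inner_self_eq_norm_sq, ← e.sum_inner_mul_inner x x]
      exact Finset.sum_congr rfl fun i _ => by rw [real_inner_comm x (e i), sq]
    have szz : ∑ i, inner ℝ (e i) z ^ 2 = ζ := by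
      rw [hζ, ← real_inner_self_eq_norm_sq, ← e.sum_inner_mul_inner z z]
      exact Finset.sum_congr rfl fun i _ => by rw [real_inner_comm (e i) z, sq]
    have sxz : ∑ i, inner ℝ x (e i) * inner ℝ (e i) z = inner ℝ x z := e.sum_inner_mul_inner x z
    have hterm : ∀ i, (k₂ i x * G x + k₁ i x * G₁ i x) + (k₁ i x * G₁ i x + k x * G₂ i x) =
        (θ₂ (u x) * (4 / s ^ 2) * G x + 2 * θ₁ (u x) * (-2 / s) *
          (-2 * (q x ^ n)⁻¹ + 2 * ζ * (p x ^ n)⁻¹) +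
          k x * (4 * n * (q x ^ (n + 1))⁻¹ - 4 * n * (p x ^ (n + 1))⁻¹ * ζ ^ 2)) *
            inner ℝ x (e i) ^ 2 +
        (2 * θ₁ (u x) * (-2 / s) * (2 * (q x ^ n)⁻¹ - 2 * (p x ^ n)⁻¹) +
          k x * (-8 * n * (q x ^ (n + 1))⁻¹ + 8 * n * (p x ^ (n + 1))⁻¹ * ζ)) *
            (inner ℝ x (e i) * inner ℝ (e i) z) +
        (k x * (4 * n * (q x ^ (n + 1))⁻¹ - 4 * n * (p x ^ (n + 1))⁻¹)) * inner ℝ (e i) z ^ 2 +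
        (-2 * θ₁ (u x) / s * G x + k x * (-2 * (q x ^ n)⁻¹ + 2 * ζ * (p x ^ n)⁻¹)) := by
      intro i
      simp only [hk₂, hk₁, hG₁, hG₂, hu₁, hq₁, hp₁, inner_sub_left, real_inner_comm (e i) z]
      ring
    rw [Finset.sum_congr rfl fun i _ => hterm i]
    simp only [Finset.sum_add_distrib, ← Finset.mul_sum, sxx, szz, sxz, Finset.sum_const,
      Finset.card_univ, Fintype.card_fin, hdim, nsmul_eq_mul]
    -- With a single negative power of each of `q` and `p` left, the identity becomes polynomial.
    have eQ : (q x ^ n)⁻¹ = (q x ^ (n + 1))⁻¹ * (‖x‖ ^ 2 - 2 * inner ℝ x z + ζ + ε) := by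
      have := (hq0 x).ne'
      rw [← hqx, pow_succ]; field_simp
    have eP : (p x ^ n)⁻¹ = (p x ^ (n + 1))⁻¹ * (ζ * ‖x‖ ^ 2 - 2 * inner ℝ x z + 1) := by
      have := (hp0 x (hKU hx)).ne'
      change (p x ^ n)⁻¹ = (p x ^ (n + 1))⁻¹ * p x
      rw [pow_succ]; field_simp
    simp only [hR, hG]
    rw [eQ, eP]
    push_cast
    ring
  have hRb : ∀ x, |R x| ≤ Set.indicator {x | s ≤ 1 - ‖x‖ ^ 2 ∧ 1 - ‖x‖ ^ 2 ≤ 2 * s}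
      (fun x => M * (16 + 40 * n) * ((1 - ζ) / s) * (‖x - z‖ ^ (2 * n))⁻¹) x := by
    intro x
    by_cases hx : u x ∈ Set.Icc (0 : ℝ) 1
    · have h1 : s ≤ 1 - ‖x‖ ^ 2 := by
        have := hx.1
        simp only [hu, sub_nonneg, one_le_div₀ hs] at this
        exact this
      have h2 : 1 - ‖x‖ ^ 2 ≤ 2 * s := by
        have := hx.2
        simp only [hu, sub_le_iff_le_add] at this
        rw [div_le_iff₀ hs] at this
        linarith
      rw [Set.indicator_of_mem (show x ∈ {x : E | s ≤ 1 - ‖x‖ ^ 2 ∧ 1 - ‖x‖ ^ 2 ≤ 2 * s} from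
        ⟨h1, h2⟩)]
      have hD1 : 1 - ζ ≤ 1 := by linarith
      have hxz : ‖x‖ - ‖z‖ ≤ ‖x - z‖ := norm_sub_norm_le x z
      have hx1 : ‖x‖ ≤ 1 := by nlinarith [norm_nonneg x]
      -- The hypothesis `16 s ≤ (1 - ζ) ^ 2` serves here: the layer stays at distance `(1 - ζ) / 4`
      -- from `z`, and the square of this distance is at least `s`.
      have hgap : (1 - ζ) / 4 ≤ ‖x‖ - ‖z‖ := by
        have h3 : (‖x‖ - ‖z‖) * (‖x‖ + ‖z‖) ≥ (1 - ζ) / 2 := by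
          have : (‖x‖ - ‖z‖) * (‖x‖ + ‖z‖) = (1 - ζ) - (1 - ‖x‖ ^ 2) := by rw [hζ]; ring
          rw [this]; nlinarith
        have h4 : 0 ≤ ‖x‖ - ‖z‖ := by
          by_contra hneg
          push Not at hneg
          nlinarith [norm_nonneg x, norm_nonneg z]
        nlinarith [norm_nonneg x, norm_nonneg z]
      have hsq : s ≤ ‖x - z‖ ^ 2 := by
        have : ((1 - ζ) / 4) ^ 2 ≤ ‖x - z‖ ^ 2 := by
          have : 0 ≤ (1 - ζ) / 4 := by linarith
          gcongr; linarith
        nlinarith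
      have hxz0 : 0 < ‖x - z‖ := by nlinarith [norm_nonneg (x - z)]
      refine (abs_cutoff_terms_le hg hθ.nonneg (hθ.bound₁ _) (hθ.bound₂ _) (by positivity)
        (by linarith) hζ0 hζ1 ?_ hs (by linarith) hε hεs h1 h2 (hqx x) rfl
        (by simp only [hq]; linarith)).trans ?_
      · refine (abs_real_inner_le_norm x z).trans ?_
        exact mul_le_one₀ hx1 (norm_nonneg _) hz.le
      · have : 0 ≤ M * (16 + 40 * n) * ((1 - ζ) / s) := by
          have := hθ.nonneg
          have : 0 < 1 - ζ := by linarith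
          positivity
        rw [pow_mul]
        gcongr
        simp only [hq]; linarith
    · have hR0 : R x = 0 := by
        simp [hR, (hθ.deriv_eq_zero _ hx).1, (hθ.deriv_eq_zero _ hx).2]
      rw [hR0, abs_zero]
      refine Set.indicator_nonneg (fun y _ => ?_) x
      have := hθ.nonneg
      have : 0 < 1 - ζ := by linarith
      positivity
  have hR0 : ∀ x ∉ K, R x = 0 := fun x hx => by simp [hR, (θ0 x hx).1, (θ0 x hx).2]
  have hbc : ContinuousOn b K := hb.continuousOn.mono hKU
  have hint1 : Integrable (fun x => (4 * n * ε * k x * (q x ^ (n + 1))⁻¹) • b x) μ :=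
    integrable_of_continuousOn_of_eq_zero_off hKcomp
      (((continuousOn_const.mul kc).mul (hqi _)).smul hbc) fun x hx => by simp [k0 x hx]
  have hRc : ContinuousOn R K :=
    ((((hθ.cont₂.comp huc).continuousOn.mul continuousOn_const).mul
      (by fun_prop)).mul Gc).add ((((hθ₁c.comp huc).continuousOn.mul continuousOn_const)).mul
      (((hqi n).mul (by fun_prop)).sub ((hpi n).mul (by fun_prop)))) |>.sub
      (((continuousOn_const.mul (hθ₁c.comp huc).continuousOn).div_const _).mul Gc)
  have hint2 : Integrable (fun x => R x • b x) μ :=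
    integrable_of_continuousOn_of_eq_zero_off hKcomp (hRc.smul hbc)
      fun x hx => by simp [hR0 x hx]
  have hEq : ∫ x, (4 * n * ε * k x * (q x ^ (n + 1))⁻¹) • b x ∂μ = ∫ x, R x • b x ∂μ := by
    have h1 : ∫ x, (R x • b x - (4 * n * ε * k x * (q x ^ (n + 1))⁻¹) • b x) ∂μ = 0 := by
      rw [← key]
      congr 1; ext1 x
      by_cases hx : x ∈ K
      · rw [hsum x hx, sub_smul (R x)]
      · simp [hR0 x hx, k0 x hx, k₁0 _ x hx, k₂0 _ x hx]
    rw [integral_sub hint2 hint1, sub_eq_zero] at h1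
    exact h1.symm
  have hLm : MeasurableSet {x : E | s ≤ 1 - ‖x‖ ^ 2 ∧ 1 - ‖x‖ ^ 2 ≤ 2 * s} :=
    have hc : Continuous fun x : E => 1 - ‖x‖ ^ 2 := by fun_prop
    ((isClosed_le continuous_const hc).inter (isClosed_le hc continuous_const)).measurableSet
  change ‖∫ x, (4 * n * ε * k x * (q x ^ (n + 1))⁻¹) • b x ∂μ‖ₑ ≤ _
  rw [hEq]
  refine (enorm_integral_le_lintegral_enorm _).trans ?_
  rw [← lintegral_const_mul' _ _ ENNReal.ofReal_ne_top, ← lintegral_indicator hLm]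
  refine lintegral_mono fun x => ?_
  rw [enorm_smul, Real.enorm_eq_ofReal_abs]
  have hx := hRb x
  by_cases hxL : x ∈ {x : E | s ≤ 1 - ‖x‖ ^ 2 ∧ 1 - ‖x‖ ^ 2 ≤ 2 * s}
  · rw [Set.indicator_of_mem hxL] at hx ⊢
    rw [← mul_assoc, ← ENNReal.ofReal_mul' (by positivity)]
    gcongr
  · rw [Set.indicator_of_notMem hxL] at hx ⊢
    rw [abs_nonpos_iff.1 hx]; simp

end Kernel

/-! ### Pointwise control of harmonic functions by layers along the sphere. -/

section Representation

variable {E : Type*} [NormedAddCommGroup E] [InnerProductSpace ℝ E] [FiniteDimensional ℝ E]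
  [MeasurableSpace E] [BorelSpace E]

/-- Rescaling of the mollifier of the Newton kernel. -/
lemma integral_mollifier_eq {n : ℕ} (hdim : Module.finrank ℝ E = 2 * n)
    {μ : Measure E} [μ.IsAddHaarMeasure] (f : E → ℂ) (z : E) {η : ℝ} (hη : 0 < η) :
    ∫ x, (η ^ 2 * ((‖x - z‖ ^ 2 + η ^ 2) ^ (n + 1))⁻¹) • f x ∂μ =
      ∫ y, ((1 + ‖y‖ ^ 2) ^ (n + 1))⁻¹ • f (z + η • y) ∂μ := by
  have h1 : ∫ x, (η ^ 2 * ((‖x - z‖ ^ 2 + η ^ 2) ^ (n + 1))⁻¹) • f x ∂μ =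
      ∫ x, (η ^ 2 * ((‖x‖ ^ 2 + η ^ 2) ^ (n + 1))⁻¹) • f (z + x) ∂μ := by
    rw [← integral_add_left_eq_self _ z]
    simp
  have h2 := Measure.integral_comp_smul μ
    (fun x => (η ^ 2 * ((‖x‖ ^ 2 + η ^ 2) ^ (n + 1))⁻¹) • f (z + x)) η
  rw [hdim, abs_of_pos (by positivity)] at h2
  rw [h1, eq_comm]
  have h3 : ∀ y : E, ((1 + ‖y‖ ^ 2) ^ (n + 1))⁻¹ • f (z + η • y) = (η ^ (2 * n)) •
      ((η ^ 2 * ((‖η • y‖ ^ 2 + η ^ 2) ^ (n + 1))⁻¹) • f (z + η • y)) := by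
    intro y
    rw [smul_smul]
    congr 1
    rw [norm_smul, Real.norm_of_nonneg hη.le,
      show (η * ‖y‖) ^ 2 + η ^ 2 = η ^ 2 * (1 + ‖y‖ ^ 2) by ring, mul_pow, mul_inv]
    field_simp
    ring
  simp_rw [h3]
  rw [integral_smul, h2, smul_smul, mul_inv_cancel₀ (by positivity), one_smul]

lemma integrable_inv_one_add_norm_sq_pow {n : ℕ} (hdim : Module.finrank ℝ E = 2 * n)
    (μ : Measure E) [μ.IsAddHaarMeasure] :
    Integrable (fun y : E => ((1 + ‖y‖ ^ 2) ^ (n + 1))⁻¹) μ := by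
  have h := integrable_rpow_neg_one_add_norm_sq (E := E) (μ := μ) (r := 2 * n + 2)
    (by rw [hdim]; push_cast; linarith)
  refine h.congr (Filter.Eventually.of_forall fun y => ?_)
  simp only
  rw [show -(2 * (n : ℝ) + 2) / 2 = -((n + 1 : ℕ) : ℝ) by push_cast; ring,
    Real.rpow_neg (by positivity), Real.rpow_natCast]

/-- A harmonic function in the unit ball is controlled at `z` by the Poisson-type average of its
modulus over a thin layer along the sphere. -/
lemma exists_enorm_harmonic_le {n : ℕ} (hn : 1 ≤ n) (hdim : Module.finrank ℝ E = 2 * n)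
    (μ : Measure E) [μ.IsAddHaarMeasure] :
    ∃ C : ℝ≥0, ∀ b : E → ℂ, InnerProductSpace.HarmonicOnNhd b (Metric.ball 0 1) →
      ∀ (z : E) (s : ℝ), ‖z‖ < 1 → 0 < s → 16 * s ≤ (1 - ‖z‖ ^ 2) ^ 2 →
      ‖b z‖ₑ ≤ C * ENNReal.ofReal ((1 - ‖z‖ ^ 2) / s) *
        ∫⁻ x in {x | s ≤ 1 - ‖x‖ ^ 2 ∧ 1 - ‖x‖ ^ 2 ≤ 2 * s},
          ENNReal.ofReal ((‖x - z‖ ^ (2 * n))⁻¹) * ‖b x‖ₑ ∂μ := by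
  obtain ⟨θ, θ₁, θ₂, M, hθ⟩ := exists_isSmoothStep
  set I : ℝ := ∫ y : E, ((1 + ‖y‖ ^ 2) ^ (n + 1))⁻¹ ∂μ with hI
  have hint := integrable_inv_one_add_norm_sq_pow hdim μ
  have hI0 : 0 < I := by
    rw [hI, integral_pos_iff_support_of_nonneg (fun y => by positivity) hint]
    have : Function.support (fun y : E => ((1 + ‖y‖ ^ 2) ^ (n + 1))⁻¹) = Set.univ := by
      ext y
      simp only [Function.mem_support, Set.mem_univ, iff_true]
      positivity
    rw [this]
    exact Measure.measure_univ_pos.2 (NeZero.ne μ)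
  have hc0 : 0 < 4 * n * I := by
    have : (0 : ℝ) < n := by exact_mod_cast hn
    positivity
  refine ⟨(M * (16 + 40 * n) / (4 * n * I)).toNNReal, fun b hb z s hz hs hsz => ?_⟩
  have hM := hθ.nonneg
  set L := ∫⁻ x in {x | s ≤ 1 - ‖x‖ ^ 2 ∧ 1 - ‖x‖ ^ 2 ≤ 2 * s},
          ENNReal.ofReal ((‖x - z‖ ^ (2 * n))⁻¹) * ‖b x‖ₑ ∂μ with hL
  have hD0 : 0 < 1 - ‖z‖ ^ 2 := by
    rw [sub_pos, sq_lt_one_iff₀ (norm_nonneg _)]; exact hz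
  have hD1 : 1 - ‖z‖ ^ 2 ≤ 1 := by nlinarith [norm_nonneg z]
  set f : E → ℂ := fun x => θ ((1 - ‖x‖ ^ 2) / s - 1) • b x with hf
  have hfz : f z = b z := by
    -- The cutoff does not affect the value at `z`, because `2 s ≤ 1 - ‖z‖ ^ 2`.
    have : θ ((1 - ‖z‖ ^ 2) / s - 1) = 1 := by
      apply hθ.eq_one
      rw [le_sub_iff_add_le, le_div_iff₀ hs]
      nlinarith
    rw [hf]; simp only [this, one_smul]
  set K : Set E := {x | ‖x‖ ^ 2 ≤ 1 - s} with hK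
  have hKc : IsClosed K := isClosed_le (by fun_prop) continuous_const
  have hKU : K ⊆ Metric.ball 0 1 := fun x hx => by
    rw [mem_ball_zero_iff, ← sq_lt_one_iff₀ (norm_nonneg _)]
    have : ‖x‖ ^ 2 ≤ 1 - s := hx
    linarith
  have hKcomp : IsCompact K := (isCompact_closedBall (0 : E) 1).of_isClosed_subset hKc
    (hKU.trans Metric.ball_subset_closedBall)
  have hf0 : ∀ x ∉ K, f x = 0 := fun x hx => by
    have h1 : 1 - s < ‖x‖ ^ 2 := not_le.1 hx
    rw [hf]; simp only
    rw [hθ.eq_zero _ (by rw [sub_neg, div_lt_one hs]; linarith), zero_smul]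
  have hfsupp : HasCompactSupport f := HasCompactSupport.intro hKcomp hf0
  have hθc : Continuous θ := continuous_iff_continuousAt.2 fun t => (hθ.deriv t).continuousAt
  have hfc : Continuous f := by
    refine ContinuousOn.continuous_of_tsupport_subset (s := Metric.ball (0 : E) 1) ?_
      Metric.isOpen_ball ((closure_minimal (fun x hx => ?_) hKc).trans hKU)
    · exact (hθc.comp (by fun_prop)).continuousOn.smul hb.continuousOn
    · by_contra h; exact hx (hf0 x h)
  obtain ⟨B, hB⟩ := hfc.bounded_above_of_compact_support hfsupp
  -- With `ε = η ^ 2` the mollifier is an approximate identity of total mass `I`, up to the factor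
  -- `4 n`. The right side of Green's estimate does not depend on `ε`.
  have hlim : Filter.Tendsto (fun η : ℝ => ∫ y, ((1 + ‖y‖ ^ 2) ^ (n + 1))⁻¹ • f (z + η • y) ∂μ)
      (nhdsWithin 0 (Set.Ioi 0)) (nhds (∫ y : E, ((1 + ‖y‖ ^ 2) ^ (n + 1))⁻¹ • f z ∂μ)) := by
    refine tendsto_integral_filter_of_dominated_convergence
      (fun y => ((1 + ‖y‖ ^ 2) ^ (n + 1))⁻¹ * B) ?_ ?_ (hint.mul_const B) ?_
    · refine Filter.Eventually.of_forall fun η => Continuous.aestronglyMeasurable ?_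
      have h1 : Continuous fun y : E => (1 + ‖y‖ ^ 2) ^ (n + 1) := by fun_prop
      exact (h1.inv₀ fun y => by positivity).smul (hfc.comp (by fun_prop))
    · refine Filter.Eventually.of_forall fun η => Filter.Eventually.of_forall fun y => ?_
      rw [norm_smul, Real.norm_of_nonneg (by positivity)]
      gcongr
      exact hB _
    · refine Filter.Eventually.of_forall fun y => ?_
      refine Filter.Tendsto.const_smul ?_ _
      have h1 : Filter.Tendsto (fun η : ℝ => f (z + η • y)) (nhds 0) (nhds (f (z + (0 : ℝ) • y))) :=
        (hfc.comp (by fun_prop : Continuous fun η : ℝ => z + η • y)).tendsto 0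
      rw [zero_smul, add_zero] at h1
      exact h1.mono_left nhdsWithin_le_nhds
  rw [integral_smul_const, ← hI, hfz] at hlim
  have hlim2 := ((hlim.const_smul (4 * n : ℝ)).enorm)
  have hbound : ‖(4 * n : ℝ) • I • b z‖ₑ ≤
      ENNReal.ofReal (M * (16 + 40 * n) * ((1 - ‖z‖ ^ 2) / s)) * L := by
    refine le_of_tendsto hlim2 ?_
    have hev : ∀ᶠ η : ℝ in nhdsWithin 0 (Set.Ioi 0), η ^ 2 ≤ s * (1 - ‖z‖ ^ 2) := by
      have : Filter.Tendsto (fun η : ℝ => η ^ 2) (nhds 0) (nhds (0 ^ 2)) :=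
        (continuous_pow 2).tendsto 0
      rw [zero_pow (by norm_num)] at this
      exact ((this.mono_left nhdsWithin_le_nhds).eventually_le_const (by positivity))
    filter_upwards [hev, self_mem_nhdsWithin] with η hη hη0
    have hη0' : 0 < η := hη0
    have hmain := enorm_integral_mollifier_le hdim (μ := μ) hθ hb hz hs hsz
      (by positivity : 0 < η ^ 2) hη
    refine le_of_eq_of_le ?_ hmain
    rw [← integral_mollifier_eq hdim f z hη0', ← integral_smul]
    congr 2
    ext1 x
    simp only [hf]
    rw [smul_smul, smul_smul]
    congr 1
    ring
  rw [smul_smul, enorm_smul, Real.enorm_eq_ofReal hc0.le] at hbound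
  have h1 : ‖b z‖ₑ ≤ (ENNReal.ofReal (4 * n * I))⁻¹ *
      (ENNReal.ofReal (M * (16 + 40 * n) * ((1 - ‖z‖ ^ 2) / s)) * L) := by
    rw [mul_comm, ← div_eq_mul_inv, ENNReal.le_div_iff_mul_le
      (Or.inl (ENNReal.ofReal_pos.2 hc0).ne') (Or.inl ENNReal.ofReal_ne_top), mul_comm]
    exact hbound
  refine h1.trans (le_of_eq ?_)
  rw [← mul_assoc, ← ENNReal.ofReal_inv_of_pos hc0, ← ENNReal.ofReal_mul (by positivity)]
  congr 1
  rw [show (((M * (16 + 40 * n) / (4 * n * I)).toNNReal : ℝ≥0) : ℝ≥0∞) =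
    ENNReal.ofReal (M * (16 + 40 * n) / (4 * n * I)) from rfl,
    ← ENNReal.ofReal_mul (by positivity)]
  congr 1
  field_simp

end Representation

/-! ### Means of a BMO function over tents. -/

namespace BergmanCommutator

variable {n : ℕ}

/-- The Carleson tent of aperture `δ` with vertex at the unit vector `ζ`. -/
def tentAt (ζ : Cn n) (δ : ℝ) : Set (Cn n) := {w | ‖w‖ < 1 ∧ korDist ζ w < δ}

lemma measurableSet_tentAt (ζ : Cn n) (δ : ℝ) : MeasurableSet (tentAt ζ δ) :=
  ((isOpen_lt continuous_norm continuous_const).inter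
    (isOpen_lt (continuous_korDist_right ζ) continuous_const)).measurableSet

lemma tentAt_subset_unitBall (ζ : Cn n) (δ : ℝ) : tentAt ζ δ ⊆ unitBall n := fun w hw => by
  simpa [unitBall] using hw.1

lemma tentAt_mono (ζ : Cn n) {δ δ' : ℝ} (h : δ ≤ δ') : tentAt ζ δ ⊆ tentAt ζ δ' :=
  fun _ hw => ⟨hw.1, hw.2.trans_le h⟩

lemma carlesonTent_zero : carlesonTent (0 : Cn n) = unitBall n := by
  ext w; simp [carlesonTent]

lemma carlesonTent_smul {ζ : Cn n} (hζ : ‖ζ‖ = 1) {δ : ℝ} (h1 : δ < 1) :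
    carlesonTent ((1 - δ) • ζ) = tentAt ζ δ := by
  have hd : 0 < 1 - δ := by linarith
  have hn : ‖(1 - δ) • ζ‖ = 1 - δ := by
    rw [norm_smul, hζ, mul_one, Real.norm_of_nonneg hd.le]
  have hne : (1 - δ) • ζ ≠ 0 := by rw [← norm_ne_zero_iff, hn]; exact hd.ne'
  ext w
  simp only [carlesonTent, tentAt, Set.mem_ofPred_eq, unitBall, mem_ball_zero_iff, hn, hne, ne_eq,
    not_false_iff, forall_const, sub_sub_cancel, pairing_smul_left, korDist]
  rw [mul_div_cancel_left₀ _ (by exact_mod_cast hd.ne')]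

lemma lintegral_carlesonTent_le {b : Cn n → ℂ} {z : Cn n} (hz : z ∈ unitBall n)
    (h0 : volume (carlesonTent z) ≠ 0) (ht : volume (carlesonTent z) ≠ ∞) :
    ∫⁻ w in carlesonTent z, ‖b w - ⨍ u in carlesonTent z, b u‖ₑ ≤
      bmoNorm b * volume (carlesonTent z) := by
  have h : (volume (carlesonTent z))⁻¹ *
      ∫⁻ w in carlesonTent z, ‖b w - ⨍ u in carlesonTent z, b u‖ₑ ≤ bmoNorm b :=
    le_iSup₂ (f := fun (z : Cn n) (_ : z ∈ unitBall n) => (volume (carlesonTent z))⁻¹ *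
      ∫⁻ w in carlesonTent z, ‖b w - ⨍ u in carlesonTent z, b u‖ₑ) z hz
  rw [mul_comm, ← div_eq_mul_inv] at h
  exact (ENNReal.div_le_iff h0 ht).1 h

lemma enorm_average_sub_mul_le {α : Type*} [MeasurableSpace α] {μ : Measure α} {S : Set α}
    (h0 : μ S ≠ 0) (ht : μ S ≠ ∞) {b : α → ℂ} (hb : IntegrableOn b S μ) (c : ℂ) :
    ‖(⨍ x in S, b x ∂μ) - c‖ₑ * μ S ≤ ∫⁻ x in S, ‖b x - c‖ₑ ∂μ := by
  have hreal : μ.real S ≠ 0 := by simp [Measure.real, ENNReal.toReal_eq_zero_iff, h0, ht]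
  have h1 : ∫ x in S, (b x - c) ∂μ = μ.real S • ((⨍ x in S, b x ∂μ) - c) := by
    have : IsFiniteMeasure (μ.restrict S) := ⟨by simpa using ht.lt_top⟩
    rw [integral_sub hb (integrable_const c), setAverage_eq, smul_sub, smul_smul,
      mul_inv_cancel₀ hreal, one_smul]
    simp
  have h2 : ‖∫ x in S, (b x - c) ∂μ‖ₑ ≤ ∫⁻ x in S, ‖b x - c‖ₑ ∂μ :=
    enorm_integral_le_lintegral_enorm _
  rw [h1, enorm_smul, Real.enorm_eq_ofReal measureReal_nonneg, ofReal_measureReal ht, mul_comm] at h2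
  exact h2

lemma lintegral_unitBall_le (b : Cn n → ℂ) :
    ∫⁻ w in unitBall n, ‖b w - ⨍ u in unitBall n, b u‖ₑ ≤ bmoNorm b * volume (unitBall n) := by
  have := lintegral_carlesonTent_le (b := b) (z := 0) (by simp [unitBall])
    (by rw [carlesonTent_zero]; exact (Metric.measure_ball_pos _ _ one_pos).ne')
    (by rw [carlesonTent_zero]; exact measure_ball_lt_top.ne)
  rwa [carlesonTent_zero] at this

lemma volume_unitBall_ne_top : volume (unitBall n) ≠ ∞ := measure_ball_lt_top.ne

lemma integrableOn_unitBall_of_bmo {b : Cn n → ℂ} (hc : ContinuousOn b (unitBall n))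
    (hb : bmoNorm b < ∞) : IntegrableOn b (unitBall n) := by
  set c := ⨍ u in unitBall n, b u with hcdef
  have h1 : IntegrableOn (fun w => b w - c) (unitBall n) := by
    refine ⟨((hc.sub continuousOn_const).aestronglyMeasurable measurableSet_ball), ?_⟩
    exact (lintegral_unitBall_le b).trans_lt (ENNReal.mul_lt_top hb volume_unitBall_ne_top.lt_top)
  have h2 : IntegrableOn (fun _ => c) (unitBall n) := by
    refine integrableOn_const volume_unitBall_ne_top
  exact (h1.add h2).congr_fun (fun x _ => by simp) measurableSet_ball

/-- The mean of `b` over a tent of aperture at least `2 ^ (-(k + 1))` deviates from the mean over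
the ball by at most a multiple of `(k + 1) ‖b‖_BMO`. -/
lemma exists_enorm_average_tentAt_sub_le (n : ℕ) :
    ∃ A : ℝ≥0, ∀ b : Cn (n + 1) → ℂ, ContinuousOn b (unitBall (n + 1)) → bmoNorm b < ∞ →
      ∀ ζ : Cn (n + 1), ‖ζ‖ = 1 → ∀ (k : ℕ) (δ : ℝ), δ < 1 → (1 / 2) ^ (k + 1) ≤ δ →
      ‖(⨍ u in tentAt ζ δ, b u) - ⨍ u in unitBall (n + 1), b u‖ₑ ≤ A * (k + 1) * bmoNorm b := by
  obtain ⟨C, hC⟩ := volume_korDist_lt_le n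
  obtain ⟨c₀, hc₀, hlow⟩ := volume_korDist_lt_ge n
  set V : ℝ≥0 := (volume (unitBall (n + 1))).toNNReal with hV
  have hVe : (V : ℝ≥0∞) = volume (unitBall (n + 1)) := ENNReal.coe_toNNReal volume_unitBall_ne_top
  refine ⟨V * 2 ^ (n + 2) / c₀ + C * 2 ^ (n + 2) / c₀, fun b hbc hb ζ hζ => ?_⟩
  have hint := integrableOn_unitBall_of_bmo hbc hb
  set c := ⨍ u in unitBall (n + 1), b u with hc
  have hvol : ∀ δ : ℝ, 0 < δ → δ < 1 → volume (tentAt ζ δ) ≠ 0 ∧ volume (tentAt ζ δ) ≠ ∞ := by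
    refine fun δ h0 h1 => ⟨((ENNReal.mul_pos (by simpa using hc₀.ne') ?_).trans_le
      (hlow ζ hζ δ h0 h1.le)).ne', ?_⟩
    · simpa using pow_pos h0 _
    · exact ((measure_mono (tentAt_subset_unitBall ζ δ)).trans_lt volume_unitBall_ne_top.lt_top).ne
  have hdiv : ∀ (δ : ℝ), 0 < δ → δ < 1 → ∀ (x : ℝ≥0∞) (K : ℝ≥0),
      x * volume (tentAt ζ δ) ≤ K * ENNReal.ofReal (δ ^ (n + 2)) * bmoNorm b →
      x ≤ (K / c₀ : ℝ≥0) * bmoNorm b := by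
    intro δ h0 h1 x K hx
    have hne : c₀ * ENNReal.ofReal (δ ^ (n + 2)) ≠ 0 :=
      (ENNReal.mul_pos (by simpa using hc₀.ne') (by simpa using pow_pos h0 _)).ne'
    have hnt : c₀ * ENNReal.ofReal (δ ^ (n + 2)) ≠ ∞ :=
      ENNReal.mul_ne_top ENNReal.coe_ne_top ENNReal.ofReal_ne_top
    rw [← ENNReal.mul_le_mul_iff_left hne hnt]
    calc x * (c₀ * ENNReal.ofReal (δ ^ (n + 2))) ≤ x * volume (tentAt ζ δ) := by
          gcongr; exact hlow ζ hζ δ h0 h1.le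
      _ ≤ K * ENNReal.ofReal (δ ^ (n + 2)) * bmoNorm b := hx
      _ = ((K / c₀ : ℝ≥0) * c₀ : ℝ≥0) * ENNReal.ofReal (δ ^ (n + 2)) * bmoNorm b := by
          rw [div_mul_cancel₀ _ hc₀.ne']
      _ = _ := by push_cast; ring
  -- Apertures `δ < 1` correspond to the tents at points `z ≠ 0`, so doubling must stop at `1 / 2`.
  -- From there one passes directly to the ball, the tent at the origin, whose volume is comparable.
  have hbase : ∀ δ : ℝ, 1 / 2 ≤ δ → δ < 1 →
      ‖(⨍ u in tentAt ζ δ, b u) - c‖ₑ ≤ (V * 2 ^ (n + 2) / c₀ : ℝ≥0) * bmoNorm b := by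
    intro δ h1 h2
    have hδ0 : 0 < δ := by linarith
    refine hdiv δ hδ0 h2 _ _ ?_
    calc _ ≤ ∫⁻ x in tentAt ζ δ, ‖b x - c‖ₑ :=
          enorm_average_sub_mul_le (hvol δ hδ0 h2).1 (hvol δ hδ0 h2).2
            (hint.mono_set (tentAt_subset_unitBall ζ δ)) c
      _ ≤ ∫⁻ x in unitBall (n + 1), ‖b x - c‖ₑ := lintegral_mono_set (tentAt_subset_unitBall ζ δ)
      _ ≤ bmoNorm b * V := by rw [hVe]; exact lintegral_unitBall_le b
      _ = V * 1 * bmoNorm b := by ring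
      _ ≤ V * ENNReal.ofReal ((2 * δ) ^ (n + 2)) * bmoNorm b := by
          gcongr
          rw [← ENNReal.ofReal_one]
          exact ENNReal.ofReal_le_ofReal (one_le_pow₀ (by linarith))
      _ = _ := by
          rw [mul_pow, ENNReal.ofReal_mul (by positivity), ENNReal.ofReal_pow (by norm_num),
            ENNReal.ofReal_ofNat]
          push_cast; ring
  have hstep : ∀ δ : ℝ, 0 < δ → 2 * δ < 1 →
      ‖(⨍ u in tentAt ζ δ, b u) - ⨍ u in tentAt ζ (2 * δ), b u‖ₑ ≤
        (C * 2 ^ (n + 2) / c₀ : ℝ≥0) * bmoNorm b := by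
    intro δ h1 h2
    refine hdiv δ h1 (by linarith) _ _ ?_
    have hcar := lintegral_carlesonTent_le (b := b) (z := (1 - 2 * δ) • ζ)
      (by rw [unitBall, mem_ball_zero_iff, norm_smul, hζ, mul_one,
            Real.norm_of_nonneg (by linarith)]; linarith)
    rw [carlesonTent_smul hζ h2] at hcar
    calc _ ≤ ∫⁻ x in tentAt ζ δ, ‖b x - ⨍ u in tentAt ζ (2 * δ), b u‖ₑ :=
          enorm_average_sub_mul_le (hvol δ h1 (by linarith)).1 (hvol δ h1 (by linarith)).2
            (hint.mono_set (tentAt_subset_unitBall ζ δ)) _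
      _ ≤ ∫⁻ x in tentAt ζ (2 * δ), ‖b x - ⨍ u in tentAt ζ (2 * δ), b u‖ₑ :=
          lintegral_mono_set (tentAt_mono ζ (by linarith))
      _ ≤ bmoNorm b * volume (tentAt ζ (2 * δ)) :=
          hcar (hvol _ (by linarith) h2).1 (hvol _ (by linarith) h2).2
      _ ≤ bmoNorm b * (C * ENNReal.ofReal ((2 * δ) ^ (n + 2))) := by
          gcongr; exact hC ζ hζ.le _ (by linarith)
      _ = _ := by
          rw [mul_pow, ENNReal.ofReal_mul (by positivity), ENNReal.ofReal_pow (by norm_num),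
            ENNReal.ofReal_ofNat]
          push_cast; ring
  have hcast : ∀ k : ℕ, (V * 2 ^ (n + 2) / c₀ : ℝ≥0) * bmoNorm b ≤
      ((V * 2 ^ (n + 2) / c₀ + C * 2 ^ (n + 2) / c₀ : ℝ≥0) : ℝ≥0∞) * (k + 1) * bmoNorm b := by
    intro k
    gcongr
    calc ((V * 2 ^ (n + 2) / c₀ : ℝ≥0) : ℝ≥0∞)
        ≤ ((V * 2 ^ (n + 2) / c₀ + C * 2 ^ (n + 2) / c₀ : ℝ≥0) : ℝ≥0∞) * 1 := by
          rw [mul_one]; gcongr; exact le_self_add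
      _ ≤ _ := by gcongr; exact le_add_self
  intro k
  induction k with
  | zero =>
    intro δ h1 h2
    exact (hbase δ (by simpa using h2) h1).trans (by simpa using hcast 0)
  | succ k ih =>
    intro δ h1 h2
    have hδ0 : 0 < δ := lt_of_lt_of_le (by positivity) h2
    rcases le_or_gt (1 / 2) δ with h | h
    · exact (hbase δ h h1).trans (hcast _)
    · have e1 := ih (2 * δ) (by linarith) (by rw [pow_succ] at h2; linarith)
      have e2 := hstep δ hδ0 (by linarith)
      have e3 : (⨍ u in tentAt ζ δ, b u) - c =
        ((⨍ u in tentAt ζ δ, b u) - ⨍ u in tentAt ζ (2 * δ), b u) +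
          ((⨍ u in tentAt ζ (2 * δ), b u) - c) := by ring
      rw [e3]
      refine (enorm_add_le _ _).trans ((add_le_add e2 e1).trans ?_)
      calc _ ≤ ((V * 2 ^ (n + 2) / c₀ + C * 2 ^ (n + 2) / c₀ : ℝ≥0) : ℝ≥0∞) * bmoNorm b +
            ((V * 2 ^ (n + 2) / c₀ + C * 2 ^ (n + 2) / c₀ : ℝ≥0) : ℝ≥0∞) * (k + 1) *
              bmoNorm b := by
            gcongr; exact le_add_self
        _ = _ := by push_cast; ring

/-- The logarithmic weight `2 - log x`. -/
noncomputable def logWeight (x : ℝ) : ℝ := 2 - Real.log x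

/-- The number of doublings from `δ` to the unit scale is of order `log (1 / δ)`. The factor `2`
suffices because `log 2 > 1 / 2`. -/
lemma exists_nat_half_pow_le {δ : ℝ} (h0 : 0 < δ) (h1 : δ < 1) :
    ∃ k : ℕ, (1 / 2 : ℝ) ^ (k + 1) ≤ δ ∧ (k + 1 : ℝ) ≤ 2 * logWeight δ := by
  obtain ⟨k, hk1, hk2⟩ := exists_nat_pow_near (x := δ⁻¹) (y := (2 : ℝ))
    ((one_le_inv₀ h0).2 h1.le) one_lt_two
  refine ⟨k, ?_, ?_⟩
  · rw [one_div, inv_pow]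
    exact inv_le_of_inv_le₀ h0 hk2.le
  · have h3 := Real.log_le_log (by positivity) hk1
    rw [Real.log_pow, Real.log_inv] at h3
    have h4 := Real.log_two_gt_d9
    have h5 : (0 : ℝ) ≤ k := by positivity
    rw [logWeight]
    nlinarith

/-- Oscillation about the mean over the tent itself, plus the telescoped difference between that
mean and the mean over the ball. -/
lemma exists_lintegral_tentAt_le (n : ℕ) :
    ∃ A : ℝ≥0, ∀ b : Cn (n + 1) → ℂ, ContinuousOn b (unitBall (n + 1)) → bmoNorm b < ∞ →
      ∀ ζ : Cn (n + 1), ‖ζ‖ = 1 → ∀ δ : ℝ, 0 < δ → δ < 1 →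
      ∫⁻ w in tentAt ζ δ, ‖b w - ⨍ u in unitBall (n + 1), b u‖ₑ ≤
        A * ENNReal.ofReal (logWeight δ * δ ^ (n + 2)) * bmoNorm b := by
  obtain ⟨A, hA⟩ := exists_enorm_average_tentAt_sub_le n
  obtain ⟨C, hC⟩ := volume_korDist_lt_le n
  refine ⟨2 * (1 + A) * C, fun b hbc hb ζ hζ δ h0 h1 => ?_⟩
  obtain ⟨k, hk1, hk2⟩ := exists_nat_half_pow_le h0 h1
  set m := ⨍ u in tentAt ζ δ, b u with hm
  set c := ⨍ u in unitBall (n + 1), b u with hc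
  have hcar : ∫⁻ w in tentAt ζ δ, ‖b w - m‖ₑ ≤ bmoNorm b * volume (tentAt ζ δ) := by
    rcases eq_or_ne (volume (tentAt ζ δ)) 0 with hv | hv
    · rw [setLIntegral_measure_zero _ _ hv]; exact zero_le
    · have := lintegral_carlesonTent_le (b := b) (z := (1 - δ) • ζ)
        (by rw [unitBall, mem_ball_zero_iff, norm_smul, hζ, mul_one,
              Real.norm_of_nonneg (by linarith)]; linarith)
      rw [carlesonTent_smul hζ h1] at this
      exact this hv ((measure_mono (tentAt_subset_unitBall ζ δ)).trans_lt
        volume_unitBall_ne_top.lt_top).ne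
  calc ∫⁻ w in tentAt ζ δ, ‖b w - c‖ₑ ≤ ∫⁻ w in tentAt ζ δ, (‖b w - m‖ₑ + ‖m - c‖ₑ) := by
        refine lintegral_mono fun w => ?_
        rw [← sub_add_sub_cancel (b w) m c]
        exact enorm_add_le _ _
    _ = (∫⁻ w in tentAt ζ δ, ‖b w - m‖ₑ) + ‖m - c‖ₑ * volume (tentAt ζ δ) := by
        rw [lintegral_add_right _ measurable_const, setLIntegral_const]
    _ ≤ bmoNorm b * volume (tentAt ζ δ) + A * (k + 1) * bmoNorm b * volume (tentAt ζ δ) := by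
        gcongr; exact hA b hbc hb ζ hζ k δ h1 hk1
    _ ≤ (k + 1) * bmoNorm b * volume (tentAt ζ δ) +
          A * (k + 1) * bmoNorm b * volume (tentAt ζ δ) := by
        gcongr
        exact le_mul_of_one_le_left zero_le le_add_self
    _ = (k + 1) * (1 + A) * bmoNorm b * volume (tentAt ζ δ) := by ring
    _ ≤ ENNReal.ofReal (2 * logWeight δ) * (1 + A) * bmoNorm b *
          (C * ENNReal.ofReal (δ ^ (n + 2))) := by
        gcongr
        · rw [show ((k : ℝ≥0∞) + 1) = ENNReal.ofReal (k + 1) by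
            rw [ENNReal.ofReal_add (by positivity) (by norm_num)]; simp]
          exact ENNReal.ofReal_le_ofReal hk2
        · exact hC ζ hζ.le δ h0
    _ = _ := by
        have hl : 0 ≤ logWeight δ := by
          have : (0 : ℝ) ≤ k := by positivity
          linarith
        rw [ENNReal.ofReal_mul (by norm_num), ENNReal.ofReal_mul hl, ENNReal.ofReal_ofNat]
        push_cast; ring

end BergmanCommutator

/-! ### Logarithmic growth of harmonic BMO functions. -/

namespace BergmanCommutator

variable {n : ℕ}

/-- The Poisson-type kernel has bounded total mass on thin layers along the sphere. -/
lemma exists_lintegral_layer_kernel_le (n : ℕ) :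
    ∃ C : ℝ≥0, ∀ (z : Cn (n + 1)) (D h : ℝ), ‖z‖ ≤ 1 → 0 < D → 0 < h → h ≤ D →
      (∀ y : Cn (n + 1), ‖y‖ < 1 → 1 - h ≤ ‖y‖ → D ≤ ‖y - z‖) →
      ∫⁻ y in {y : Cn (n + 1) | ‖y‖ < 1 ∧ 1 - h ≤ ‖y‖},
        ENNReal.ofReal ((‖y - z‖ ^ (2 * (n + 1)))⁻¹) ≤ C * ENNReal.ofReal (h / D) := by
  obtain ⟨C, hC⟩ := volume_ball_layer_le n
  refine ⟨C * 2 ^ (2 * n + 1) * 2, fun z D h hz hD hh hhD hdist => ?_⟩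
  -- On the `j`-th Euclidean shell the kernel is at most `(2 ^ j D) ^ (-(2n+2))` and the volume is
  -- of order `(2 ^ j D) ^ (2n+1) h`, so each shell contributes a multiple of `2 ^ (-j) h / D`.
  set S : ℕ → Set (Cn (n + 1)) := fun j =>
    {y | (‖y‖ < 1 ∧ ‖z - y‖ < 2 ^ (j + 1) * D ∧ 1 - h ≤ ‖y‖) ∧ 2 ^ j * D ≤ ‖y - z‖} with hS
  have hsub : {y : Cn (n + 1) | ‖y‖ < 1 ∧ 1 - h ≤ ‖y‖} ⊆ ⋃ j, S j := by
    rintro y ⟨h1, h2⟩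
    have h3 := hdist y h1 h2
    obtain ⟨j, hj1, hj2⟩ := exists_nat_pow_near (x := ‖y - z‖ / D) (y := (2 : ℝ))
      ((one_le_div₀ hD).2 h3) one_lt_two
    rw [le_div_iff₀ hD] at hj1
    rw [div_lt_iff₀ hD] at hj2
    exact Set.mem_iUnion.2 ⟨j, ⟨h1, by rwa [norm_sub_rev], h2⟩, hj1⟩
  have hj : ∀ j, ∫⁻ y in S j, ENNReal.ofReal ((‖y - z‖ ^ (2 * (n + 1)))⁻¹) ≤
      (C * 2 ^ (2 * n + 1) : ℝ≥0) * ENNReal.ofReal (h / D) * ENNReal.ofReal ((1 / 2) ^ j) := by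
    intro j
    have hpos : 0 < 2 ^ j * D := by positivity
    calc ∫⁻ y in S j, ENNReal.ofReal ((‖y - z‖ ^ (2 * (n + 1)))⁻¹)
        ≤ ∫⁻ y in S j, ENNReal.ofReal (((2 ^ j * D) ^ (2 * (n + 1)))⁻¹) := by
          refine setLIntegral_mono measurable_const fun y hy => ?_
          have := hy.2
          gcongr
      _ = ENNReal.ofReal (((2 ^ j * D) ^ (2 * (n + 1)))⁻¹) * volume (S j) := setLIntegral_const _ _
      _ ≤ ENNReal.ofReal (((2 ^ j * D) ^ (2 * (n + 1)))⁻¹) *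
          (C * ENNReal.ofReal ((2 ^ (j + 1) * D) ^ (2 * n + 1) * h)) := by
          gcongr
          refine (measure_mono fun y hy => hy.1).trans (hC z hz h _ hh ?_)
          have : (1 : ℝ) ≤ 2 ^ (j + 1) := one_le_pow₀ (by norm_num)
          nlinarith
      _ = _ := by
          rw [mul_left_comm, ← ENNReal.ofReal_mul (by positivity),
            show ((2 ^ j * D) ^ (2 * (n + 1)))⁻¹ * ((2 ^ (j + 1) * D) ^ (2 * n + 1) * h) =
              2 ^ (2 * n + 1) * ((h / D) * (1 / 2) ^ j) by
              rw [show (2 : ℝ) ^ (j + 1) * D = 2 * (2 ^ j * D) by ring, mul_pow 2,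
                show 2 * (n + 1) = (2 * n + 1) + 1 by ring, pow_succ (2 ^ j * D) (2 * n + 1),
                one_div, inv_pow]
              field_simp,
            ENNReal.ofReal_mul (by positivity), ENNReal.ofReal_mul (by positivity),
            ENNReal.ofReal_pow (by norm_num), ENNReal.ofReal_ofNat]
          push_cast; ring
  have hgeo : HasSum (fun k : ℕ => (1 / 2 : ℝ) ^ k) 2 := hasSum_geometric_two
  calc _ ≤ ∫⁻ y in ⋃ j, S j, ENNReal.ofReal ((‖y - z‖ ^ (2 * (n + 1)))⁻¹) :=
        lintegral_mono_set hsub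
    _ ≤ ∑' j, ∫⁻ y in S j, ENNReal.ofReal ((‖y - z‖ ^ (2 * (n + 1)))⁻¹) := lintegral_iUnion_le _ _
    _ ≤ ∑' j : ℕ, (C * 2 ^ (2 * n + 1) : ℝ≥0) * ENNReal.ofReal (h / D) *
          ENNReal.ofReal ((1 / 2) ^ j) := ENNReal.tsum_le_tsum hj
    _ = (C * 2 ^ (2 * n + 1) : ℝ≥0) * ENNReal.ofReal (h / D) * ENNReal.ofReal 2 := by
        rw [ENNReal.tsum_mul_left, ← ENNReal.ofReal_tsum_of_nonneg (fun k => by positivity)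
          hgeo.summable, hgeo.tsum_eq]
    _ = _ := by rw [ENNReal.ofReal_ofNat]; push_cast; ring

/-- Averaging over Korányi balls of radius `4 s`: an integral against the Poisson-type kernel over
the layer of width `2 s` is controlled by the integrals over tents of aperture `8 s`. -/
lemma exists_lintegral_layer_le (n : ℕ) :
    ∃ C : ℝ≥0, ∀ (f : Cn (n + 1) → ℝ≥0∞), Measurable f → ∀ (z : Cn (n + 1)) (D s : ℝ) (B : ℝ≥0∞),
      ‖z‖ ≤ 1 → 0 < D → D ≤ 1 → 0 < s → 128 * s ≤ D ^ 2 →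
      (∀ x : Cn (n + 1), ‖x‖ ≤ 1 → 1 - 4 * s ≤ ‖x‖ → D / 4 ≤ ‖x - z‖) →
      (∀ ζ : Cn (n + 1), ‖ζ‖ = 1 → ∫⁻ x in tentAt ζ (8 * s), f x ≤ B * ENNReal.ofReal (s ^ (n + 2))) →
      ∫⁻ x in {x : Cn (n + 1) | ‖x‖ < 1 ∧ 1 - 2 * s ≤ ‖x‖},
        ENNReal.ofReal ((‖x - z‖ ^ (2 * (n + 1)))⁻¹) * f x ≤ C * B * ENNReal.ofReal (s / D) := by
  obtain ⟨c₀, hc₀, hlow⟩ := volume_korDist_lt_ge n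
  obtain ⟨C, hC⟩ := exists_lintegral_layer_kernel_le n
  refine ⟨c₀⁻¹ * 2 ^ (2 * (n + 1)) * C * 16, fun f hf z D s B hz hD hD1 hs hsD hdist hB => ?_⟩
  have hs1 : 128 * s ≤ 1 := by nlinarith
  set κ : Cn (n + 1) → ℝ≥0∞ := fun x => ENNReal.ofReal ((‖x - z‖ ^ (2 * (n + 1)))⁻¹) with hκ
  have hκm : Measurable κ := by
    refine ENNReal.measurable_ofReal.comp (Measurable.inv ?_)
    exact (by fun_prop : Continuous fun x : Cn (n + 1) => ‖x - z‖ ^ (2 * (n + 1))).measurable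
  set Λ : Set (Cn (n + 1)) := {x | ‖x‖ < 1 ∧ 1 - 2 * s ≤ ‖x‖} with hΛ
  have hΛm : MeasurableSet Λ := ((isOpen_lt continuous_norm continuous_const).measurableSet).inter
    (isClosed_le continuous_const continuous_norm).measurableSet
  set Λ' : Set (Cn (n + 1)) := {x | ‖x‖ < 1 ∧ 1 - 4 * s ≤ ‖x‖} with hΛ'
  have hΛm' : MeasurableSet Λ' :=
    ((isOpen_lt continuous_norm continuous_const).measurableSet).inter
    (isClosed_le continuous_const continuous_norm).measurableSet
  -- Fubini on pairs of nearby points. For fixed `x` the section contains a tent of aperture `2 s`,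
  -- over which the kernel is averaged. For fixed `y` it lies in a tent of aperture `8 s`, since
  -- projecting `y` radially to the sphere adds at most `4 s`.
  set T : Set (Cn (n + 1) × Cn (n + 1)) := {p | p.1 ∈ Λ ∧ p.2 ∈ Λ' ∧ korDist p.1 p.2 < 4 * s} with hT
  have hTm : MeasurableSet T := (measurable_fst hΛm).inter ((measurable_snd hΛm').inter
    (isOpen_lt continuous_korDist continuous_const).measurableSet)
  set F : Cn (n + 1) → Cn (n + 1) → ℝ≥0∞ := fun x y => T.indicator (fun p => κ p.2 * f p.1) (x, y)
    with hF
  have hFm : Measurable (Function.uncurry F) :=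
    ((hκm.comp measurable_snd).mul (hf.comp measurable_fst)).indicator hTm
  have hc₀e : ENNReal.ofReal (s ^ (n + 2)) * c₀ ≠ 0 :=
    (ENNReal.mul_pos (by simpa using pow_pos hs _) (by simpa using hc₀.ne')).ne'
  have hc₀t : ENNReal.ofReal (s ^ (n + 2)) * c₀ ≠ ∞ :=
    ENNReal.mul_ne_top ENNReal.ofReal_ne_top ENNReal.coe_ne_top
  have hunit : ∀ x : Cn (n + 1), 0 < ‖x‖ → ‖x‖ ≤ 1 →
      ‖‖x‖⁻¹ • x‖ = 1 ∧ ‖‖x‖⁻¹ • x - x‖ = 1 - ‖x‖ := by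
    intro x hx hx1
    refine ⟨by rw [norm_smul, norm_inv, norm_norm, inv_mul_cancel₀ hx.ne'], ?_⟩
    have e : ‖x‖⁻¹ • x - x = (‖x‖⁻¹ - 1) • x := by rw [sub_smul, one_smul]
    rw [e, norm_smul, Real.norm_of_nonneg (by rw [sub_nonneg]; exact (one_le_inv₀ hx).2 hx1),
      sub_mul, inv_mul_cancel₀ hx.ne', one_mul]
  have h1 : ∀ x ∈ Λ, (ENNReal.ofReal (s ^ (n + 2)) * c₀) * (κ x * f x) ≤
      2 ^ (2 * (n + 1)) * ∫⁻ y, F x y := by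
    rintro x hx
    have hx1 := hx.1
    have hx2 := hx.2
    have hx0 : 0 < ‖x‖ := by linarith
    obtain ⟨hu1, hu2⟩ := hunit x hx0 hx1.le
    set P : Set (Cn (n + 1)) := {y | ‖y‖ < 1 ∧ korDist (‖x‖⁻¹ • x) y < 2 * s} with hP
    have hPm : MeasurableSet P := measurableSet_tentAt (‖x‖⁻¹ • x) (2 * s)
    have hPT : ∀ y ∈ P, (x, y) ∈ T := by
      intro y hy
      refine ⟨hx, ⟨hy.1, ?_⟩, ?_⟩
      · have := one_sub_norm_le_korDist (z := y) hu1.le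
        rw [korDist_comm] at this
        have := hy.2
        linarith
      · have := korDist_le_add_norm_sub (z := x) (u := ‖x‖⁻¹ • x) hy.1.le
        rw [norm_sub_rev, hu2] at this
        have := hy.2
        simp only
        linarith
    -- `‖x - y‖ ^ 2 ≤ 8 s ≤ D ^ 2 / 16`, so `‖x - y‖` does not exceed the lower bound `D / 4` for
    -- `‖x - z‖`. This is where `128` comes from.
    have hker : ∀ y ∈ P, κ x ≤ 2 ^ (2 * (n + 1)) * κ y := by
      intro y hy
      have hyT := hPT y hy
      have hd1 : D / 4 ≤ ‖x - z‖ := hdist x hx1.le (by linarith)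
      have hd2 : D / 4 ≤ ‖y - z‖ := hdist y hy.1.le hyT.2.1.2
      have hxy : ‖x - y‖ ^ 2 ≤ 2 * korDist x y := norm_sub_sq_le_korDist hx1.le hy.1.le
      have hxy2 : korDist x y < 4 * s := hyT.2.2
      have hxy3 : ‖x - y‖ ≤ D / 4 := by
        refine le_of_sq_le_sq ?_ (by positivity)
        nlinarith
      have hle : ‖y - z‖ ≤ 2 * ‖x - z‖ := by
        have : ‖y - z‖ ≤ ‖x - z‖ + ‖x - y‖ := by
          have e : y - z = (x - z) - (x - y) := by abel
          rw [e]; exact norm_sub_le _ _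
        linarith
      have hy0 : 0 < ‖y - z‖ := by linarith
      have hx0' : 0 < ‖x - z‖ := by linarith
      simp only [hκ]
      rw [show (2 : ℝ≥0∞) ^ (2 * (n + 1)) = ENNReal.ofReal (2 ^ (2 * (n + 1))) by
        rw [ENNReal.ofReal_pow (by norm_num), ENNReal.ofReal_ofNat],
        ← ENNReal.ofReal_mul (by positivity)]
      apply ENNReal.ofReal_le_ofReal
      rw [← div_eq_mul_inv, inv_eq_one_div, div_le_div_iff₀ (by positivity) (by positivity), one_mul,
        ← mul_pow]
      gcongr
    have hvolP : ENNReal.ofReal (s ^ (n + 2)) * c₀ ≤ volume P := by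
      refine le_trans ?_ (hlow (‖x‖⁻¹ • x) hu1 (2 * s) (by linarith) (by linarith))
      rw [mul_comm]
      gcongr
      linarith
    calc (ENNReal.ofReal (s ^ (n + 2)) * c₀) * (κ x * f x)
        ≤ volume P * (κ x * f x) := by gcongr
      _ = ∫⁻ y in P, κ x * f x := by rw [setLIntegral_const, mul_comm]
      _ ≤ ∫⁻ y in P, 2 ^ (2 * (n + 1)) * F x y := by
          refine setLIntegral_mono' hPm fun y hy => ?_
          simp only [hF]
          rw [Set.indicator_of_mem (hPT y hy), ← mul_assoc]
          gcongr
          exact hker y hy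
      _ ≤ ∫⁻ y, 2 ^ (2 * (n + 1)) * F x y := setLIntegral_le_lintegral _ _
      _ = _ := lintegral_const_mul' _ _ (by simp)
  have h2 : ∀ y, ∫⁻ x, F x y ≤ Λ'.indicator (fun y => κ y * (B * ENNReal.ofReal (s ^ (n + 2)))) y := by
    intro y
    by_cases hy : y ∈ Λ'
    · rw [Set.indicator_of_mem hy]
      have hy1 := hy.1
      have hy2 := hy.2
      have hy0 : 0 < ‖y‖ := by linarith
      obtain ⟨hu1, hu2⟩ := hunit y hy0 hy1.le
      calc ∫⁻ x, F x y ≤ ∫⁻ x, (tentAt (‖y‖⁻¹ • y) (8 * s)).indicator (fun x => κ y * f x) x := by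
            refine lintegral_mono fun x => ?_
            simp only [hF]
            by_cases hxy : (x, y) ∈ T
            · rw [Set.indicator_of_mem hxy, Set.indicator_of_mem]
              refine ⟨hxy.1.1, ?_⟩
              have := korDist_le_add_norm_sub (z := ‖y‖⁻¹ • y) (u := y) hxy.1.1.le
              rw [hu2, korDist_comm y x] at this
              have h3 : korDist x y < 4 * s := hxy.2.2
              linarith
            · rw [Set.indicator_of_notMem hxy]; exact zero_le
        _ = κ y * ∫⁻ x in tentAt (‖y‖⁻¹ • y) (8 * s), f x := by
            rw [lintegral_indicator (measurableSet_tentAt _ _),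
              lintegral_const_mul' _ _ ENNReal.ofReal_ne_top]
        _ ≤ _ := by gcongr; exact hB _ hu1
    · rw [Set.indicator_of_notMem hy]
      have : ∀ x, F x y = 0 := fun x => Set.indicator_of_notMem (fun h => hy h.2.1) _
      simp [this]
  have h3 := hC z (D / 4) (4 * s) hz (by linarith) (by linarith) (by nlinarith)
    (fun y h1 h2 => hdist y h1.le h2)
  rw [← ENNReal.mul_le_mul_iff_right hc₀e hc₀t, ← lintegral_const_mul' _ _ hc₀t]
  calc ∫⁻ x in Λ, (ENNReal.ofReal (s ^ (n + 2)) * c₀) * (κ x * f x)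
      ≤ ∫⁻ x in Λ, 2 ^ (2 * (n + 1)) * ∫⁻ y, F x y := setLIntegral_mono' hΛm h1
    _ ≤ ∫⁻ x, 2 ^ (2 * (n + 1)) * ∫⁻ y, F x y := setLIntegral_le_lintegral _ _
    _ = 2 ^ (2 * (n + 1)) * ∫⁻ y, ∫⁻ x, F x y := by
        rw [lintegral_const_mul' _ _ (by simp), lintegral_lintegral_swap hFm.aemeasurable]
    _ ≤ 2 ^ (2 * (n + 1)) * ∫⁻ y, Λ'.indicator
          (fun y => κ y * (B * ENNReal.ofReal (s ^ (n + 2)))) y := by gcongr; exact h2 _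
    _ = 2 ^ (2 * (n + 1)) * ((∫⁻ y in Λ', κ y) * (B * ENNReal.ofReal (s ^ (n + 2)))) := by
        rw [lintegral_indicator hΛm', lintegral_mul_const _ hκm]
    _ ≤ 2 ^ (2 * (n + 1)) * ((C * ENNReal.ofReal (4 * s / (D / 4))) *
          (B * ENNReal.ofReal (s ^ (n + 2)))) := by gcongr
    _ = _ := by
        rw [show 4 * s / (D / 4) = 16 * (s / D) by field_simp; ring,
          ENNReal.ofReal_mul (by norm_num), ENNReal.ofReal_ofNat]
        have : (c₀ : ℝ≥0∞) * (c₀ : ℝ≥0∞)⁻¹ = 1 :=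
          ENNReal.mul_inv_cancel (by simpa using hc₀.ne') ENNReal.coe_ne_top
        push_cast
        rw [ENNReal.coe_inv hc₀.ne']
        calc _ = 2 ^ (2 * (n + 1)) * (C * (16 * ENNReal.ofReal (s / D))) *
              (B * ENNReal.ofReal (s ^ (n + 2))) * (c₀ * (c₀ : ℝ≥0∞)⁻¹) := by rw [this]; ring
          _ = _ := by ring

/-- Harmonic functions of bounded mean oscillation over the Carleson tents grow at most
logarithmically at the sphere. -/
lemma exists_enorm_sub_average_le (n : ℕ) :
    ∃ C : ℝ≥0, ∀ b : Cn (n + 1) → ℂ, InnerProductSpace.HarmonicOnNhd b (unitBall (n + 1)) →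
      bmoNorm b < ∞ → ∀ z : Cn (n + 1), ‖z‖ < 1 →
      ‖b z - ⨍ u in unitBall (n + 1), b u‖ₑ ≤
        C * bmoNorm b * ENNReal.ofReal (logWeight (1 - ‖z‖)) := by
  obtain ⟨C₁, hC₁⟩ := exists_enorm_harmonic_le (E := Cn (n + 1)) (n := n + 1) (by omega)
    (finrank_real_Cn (n + 1)) volume
  obtain ⟨C₂, hC₂⟩ := exists_lintegral_layer_le n
  obtain ⟨A, hA⟩ := exists_lintegral_tentAt_le n
  refine ⟨C₁ * C₂ * A * 8 ^ (n + 2) * 3, fun b hb hbmo z hz => ?_⟩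
  set c := ⨍ u in unitBall (n + 1), b u with hc
  set D : ℝ := 1 - ‖z‖ ^ 2 with hD
  have hz0 := norm_nonneg z
  have hD0 : 0 < D := by
    rw [hD, sub_pos, sq_lt_one_iff₀ (norm_nonneg _)]; exact hz
  have hD1 : D ≤ 1 := by rw [hD]; nlinarith
  have hDz : 1 - ‖z‖ ≤ D := by rw [hD]; nlinarith
  have hDz2 : D ≤ 2 * (1 - ‖z‖) := by rw [hD]; nlinarith
  -- The largest width allowed by `exists_lintegral_layer_le`. Being a power of `D`, it changes the
  -- logarithm only by constants, and the factors `D / s` and `s / D` of the two estimates cancel.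
  set s : ℝ := D ^ 2 / 128 with hs
  have hs0 : 0 < s := by positivity
  have hsD : 128 * s = D ^ 2 := by rw [hs]; ring
  have hs1 : 128 * s ≤ 1 := by nlinarith
  have hsD' : 128 * s ≤ D := by nlinarith
  have hbc : ContinuousOn b (unitBall (n + 1)) := hb.continuousOn
  set f : Cn (n + 1) → ℝ≥0∞ := (unitBall (n + 1)).indicator fun x => ‖b x - c‖ₑ with hf
  have hfm : Measurable f := by
    have h1 : ContinuousOn (fun x => ‖b x - c‖ₑ) (unitBall (n + 1)) :=
      continuous_enorm.comp_continuousOn (hbc.sub continuousOn_const)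
    classical
    have h2 := h1.measurable_piecewise (g := 0) continuousOn_const
      (measurableSet_ball : MeasurableSet (unitBall (n + 1)))
    rwa [Set.piecewise_eq_indicator] at h2
  have hfeq : ∀ x : Cn (n + 1), ‖x‖ < 1 → f x = ‖b x - c‖ₑ := fun x hx =>
    Set.indicator_of_mem (by simpa [unitBall] using hx) _
  have hlw : 0 ≤ logWeight (1 - ‖z‖) := by
    have := Real.log_nonpos (by linarith : 0 ≤ 1 - ‖z‖) (by linarith)
    rw [logWeight]; linarith
  have hlw2 : logWeight (8 * s) ≤ 3 * logWeight (1 - ‖z‖) := by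
    have e1 : 8 * s = D ^ 2 / 2 ^ 4 := by rw [hs]; ring
    have e2 := Real.log_le_log (by linarith) hDz
    have e3 := Real.log_nonpos (by linarith : 0 ≤ 1 - ‖z‖) (by linarith)
    have e4 := Real.log_two_lt_d9
    rw [logWeight, logWeight, e1, Real.log_div (by positivity) (by positivity), Real.log_pow,
      Real.log_pow]
    push_cast
    linarith
  have hmain := hC₁ (fun x => b x - c)
    (fun x hx => by
      have := (hb x hx).sub (InnerProductSpace.harmonicAt_const (x := x) c)
      exact this)
    z s hz hs0 (by nlinarith)
  have hlayer := hC₂ f hfm z D s (A * ENNReal.ofReal (logWeight (8 * s) * 8 ^ (n + 2)) * bmoNorm b)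
    hz.le hD0 hD1 hs0 hsD.le
    (fun x hx1 hx2 => by
      have := norm_sub_norm_le x z
      nlinarith)
    (fun ζ hζ => by
      have h1 := hA b hbc hbmo ζ hζ (8 * s) (by linarith) (by linarith)
      have h2 : ∫⁻ x in tentAt ζ (8 * s), f x = ∫⁻ x in tentAt ζ (8 * s), ‖b x - c‖ₑ :=
        setLIntegral_congr_fun (measurableSet_tentAt _ _) fun x hx => hfeq x hx.1
      rw [h2]
      refine h1.trans (le_of_eq ?_)
      rw [mul_pow, ← mul_assoc, ENNReal.ofReal_mul' (q := s ^ (n + 2)) (by positivity)]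
      ring)
  have hsub : ∫⁻ x in {x : Cn (n + 1) | s ≤ 1 - ‖x‖ ^ 2 ∧ 1 - ‖x‖ ^ 2 ≤ 2 * s},
      ENNReal.ofReal ((‖x - z‖ ^ (2 * (n + 1)))⁻¹) * ‖b x - c‖ₑ ≤
      ∫⁻ x in {x : Cn (n + 1) | ‖x‖ < 1 ∧ 1 - 2 * s ≤ ‖x‖},
        ENNReal.ofReal ((‖x - z‖ ^ (2 * (n + 1)))⁻¹) * f x := by
    have hss : {x : Cn (n + 1) | s ≤ 1 - ‖x‖ ^ 2 ∧ 1 - ‖x‖ ^ 2 ≤ 2 * s} ⊆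
        {x : Cn (n + 1) | ‖x‖ < 1 ∧ 1 - 2 * s ≤ ‖x‖} := by
      rintro x ⟨h1, h2⟩
      have hx := norm_nonneg x
      have h3 : ‖x‖ < 1 := by rw [← sq_lt_one_iff₀ hx]; linarith
      exact ⟨h3, by nlinarith⟩
    refine (lintegral_mono_set hss).trans (le_of_eq ?_)
    refine setLIntegral_congr_fun ?_ fun x hx => ?_
    · exact ((isOpen_lt continuous_norm continuous_const).measurableSet).inter
        (isClosed_le continuous_const continuous_norm).measurableSet
    · simp only [hfeq x hx.1]
  calc ‖b z - c‖ₑ ≤ _ := hmain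
    _ ≤ C₁ * ENNReal.ofReal (D / s) * (C₂ * (A * ENNReal.ofReal (logWeight (8 * s) * 8 ^ (n + 2)) *
          bmoNorm b) * ENNReal.ofReal (s / D)) := by
        gcongr
        exact hsub.trans hlayer
    _ = C₁ * C₂ * A * bmoNorm b * ENNReal.ofReal (logWeight (8 * s) * 8 ^ (n + 2)) *
          (ENNReal.ofReal (D / s) * ENNReal.ofReal (s / D)) := by ring
    _ = C₁ * C₂ * A * bmoNorm b * ENNReal.ofReal (logWeight (8 * s) * 8 ^ (n + 2)) := by
        rw [← ENNReal.ofReal_mul (by positivity), div_mul_div_cancel₀ hs0.ne', div_self hD0.ne',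
          ENNReal.ofReal_one, mul_one]
    _ ≤ C₁ * C₂ * A * bmoNorm b * ENNReal.ofReal (3 * logWeight (1 - ‖z‖) * 8 ^ (n + 2)) := by
        gcongr
    _ = _ := by
        rw [ENNReal.ofReal_mul (by positivity), ENNReal.ofReal_mul (by norm_num),
          ENNReal.ofReal_pow (by norm_num), ENNReal.ofReal_ofNat, ENNReal.ofReal_ofNat]
        push_cast; ring

end BergmanCommutator

/-! ### The commutator, the logarithmic density and the `L log⁺ L` norm. -/

namespace BergmanCommutator

variable {n : ℕ}

lemma one_le_logWeight {d : ℝ} (h0 : 0 ≤ d) (h1 : d ≤ 1) : 1 ≤ logWeight d := by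
  have := Real.log_nonpos h0 h1
  rw [logWeight]; linarith

/-- A Young inequality between `t log⁺ t` and the logarithmic weight. -/
lemma mul_logWeight_le {t d : ℝ} (ht : 0 ≤ t) (h0 : 0 < d) (h1 : d ≤ 1) :
    t * logWeight d ≤ 4 * youngLlogL t + 18 * (√d)⁻¹ := by
  -- The cases are split at `t = e d ^ (-1/4)`. Above it, `4 log t` dominates the weight; below it,
  -- both `t` and the weight are at most constants times `d ^ (-1/4)`, and their product is still
  -- integrable over the ball.
  set q : ℝ := (√√d)⁻¹ with hq
  have hs : 0 < √√d := Real.sqrt_pos.2 (Real.sqrt_pos.2 h0)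
  have hq0 : 0 < q := inv_pos.2 hs
  have hq2 : q * q = (√d)⁻¹ := by
    rw [hq, ← mul_inv, Real.mul_self_sqrt (Real.sqrt_nonneg _)]
  have hlogq : Real.log q = -(1 / 4) * Real.log d := by
    rw [hq, Real.log_inv, Real.log_sqrt (Real.sqrt_nonneg _), Real.log_sqrt h0.le]; ring
  have hq1 : 1 ≤ q := by
    rw [hq, one_le_inv₀ hs]
    exact Real.sqrt_le_one.2 (Real.sqrt_le_one.2 h1)
  have hyoung : 0 ≤ youngLlogL t := mul_nonneg ht Real.posLog_nonneg
  have he : Real.exp 1 < 3 := Real.exp_one_lt_three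
  rcases le_or_gt (Real.exp 1 * q) t with h | h
  · have hlt : 1 - (1 / 4) * Real.log d ≤ Real.log t := by
      have := Real.log_le_log (by positivity) h
      rw [Real.log_mul (Real.exp_ne_zero 1) hq0.ne', Real.log_exp, hlogq] at this
      linarith
    have h2 : logWeight d ≤ 4 * Real.posLog t := by
      have : Real.log t ≤ Real.posLog t := le_max_right _ _
      rw [logWeight]
      have := Real.log_nonpos h0.le h1
      linarith
    have h3 : t * logWeight d ≤ t * (4 * Real.posLog t) := by gcongr
    have h4 : 0 ≤ 18 * (√d)⁻¹ := by positivity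
    rw [youngLlogL]; linarith
  · have h2 : logWeight d ≤ 6 * q := by
      have := Real.log_le_sub_one_of_pos hq0
      rw [logWeight]; linarith
    calc t * logWeight d ≤ (3 * q) * (6 * q) := by
          have := one_le_logWeight h0.le h1
          gcongr
          nlinarith
      _ = 18 * (√d)⁻¹ := by rw [← hq2]; ring
      _ ≤ _ := by linarith

/-- On the layer where `1 - ‖w‖` is about `4 ^ (-j)` the integrand is about `2 ^ j` and the volume
is of order `4 ^ (-j)`. -/
lemma lintegral_inv_sqrt_lt_top (n : ℕ) :
    ∫⁻ w, ENNReal.ofReal (√(1 - ‖w‖))⁻¹ ∂(ballVolume (n + 1)) < ∞ := by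
  obtain ⟨C, hC⟩ := volume_ball_layer_le n
  set S : ℕ → Set (Cn (n + 1)) := fun j =>
    {w | ‖w‖ < 1 ∧ (4 : ℝ) ^ j ≤ (1 - ‖w‖)⁻¹ ∧ (1 - ‖w‖)⁻¹ < 4 ^ (j + 1)} with hS
  have hsub : unitBall (n + 1) ⊆ ⋃ j, S j := by
    intro w hw
    have hw1 : ‖w‖ < 1 := by simpa [unitBall] using hw
    obtain ⟨j, hj⟩ := exists_nat_pow_near (x := (1 - ‖w‖)⁻¹) (y := (4 : ℝ))
      ((one_le_inv₀ (by linarith)).2 (by linarith [norm_nonneg w])) (by norm_num)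
    exact Set.mem_iUnion.2 ⟨j, hw1, hj⟩
  have hj : ∀ j, ∫⁻ w in S j, ENNReal.ofReal (√(1 - ‖w‖))⁻¹ ≤
      (C * 2 ^ (2 * n + 2) : ℝ≥0) * ENNReal.ofReal ((1 / 2) ^ j) := by
    intro j
    have hp : (0 : ℝ) < 4 ^ j := by positivity
    calc ∫⁻ w in S j, ENNReal.ofReal (√(1 - ‖w‖))⁻¹ ≤ ∫⁻ w in S j, ENNReal.ofReal (2 ^ (j + 1)) := by
          refine setLIntegral_mono measurable_const fun w hw => ENNReal.ofReal_le_ofReal ?_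
          rw [← Real.sqrt_inv]
          refine Real.sqrt_le_iff.2 ⟨by positivity, hw.2.2.le.trans (le_of_eq ?_)⟩
          rw [← pow_mul, mul_comm, pow_mul]; norm_num
      _ = ENNReal.ofReal (2 ^ (j + 1)) * volume (S j) := setLIntegral_const _ _
      _ ≤ ENNReal.ofReal (2 ^ (j + 1)) *
          (C * ENNReal.ofReal (2 ^ (2 * n + 1) * ((4 : ℝ) ^ j)⁻¹)) := by
          gcongr
          refine le_trans (measure_mono ?_) (hC 0 (by simp) ((4 : ℝ) ^ j)⁻¹ 2 (by positivity) ?_)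
          · intro w hw
            refine ⟨hw.1, ?_, ?_⟩
            · rw [zero_sub, norm_neg]; linarith [hw.1]
            · have h1 := hw.1
              have := inv_anti₀ hp hw.2.1
              rw [inv_inv] at this
              linarith
          · have : ((4 : ℝ) ^ j)⁻¹ ≤ 1 := inv_le_one_of_one_le₀ (one_le_pow₀ (by norm_num))
            linarith
      _ = _ := by
          rw [mul_left_comm, ← ENNReal.ofReal_mul (by positivity),
            show (2 : ℝ) ^ (j + 1) * (2 ^ (2 * n + 1) * ((4 : ℝ) ^ j)⁻¹) =
              2 ^ (2 * n + 2) * (1 / 2) ^ j by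
              rw [show (4 : ℝ) ^ j = 2 ^ j * 2 ^ j by rw [← mul_pow]; norm_num, one_div, inv_pow]
              field_simp
              ring,
            ENNReal.ofReal_mul (by positivity), ENNReal.ofReal_pow (by norm_num),
            ENNReal.ofReal_ofNat]
          push_cast; ring
  have hgeo : HasSum (fun k : ℕ => (1 / 2 : ℝ) ^ k) 2 := hasSum_geometric_two
  calc _ ≤ ∫⁻ w in ⋃ j, S j, ENNReal.ofReal (√(1 - ‖w‖))⁻¹ := lintegral_mono_set hsub
    _ ≤ ∑' j, ∫⁻ w in S j, ENNReal.ofReal (√(1 - ‖w‖))⁻¹ := lintegral_iUnion_le _ _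
    _ ≤ ∑' j : ℕ, (C * 2 ^ (2 * n + 2) : ℝ≥0) * ENNReal.ofReal ((1 / 2) ^ j) :=
        ENNReal.tsum_le_tsum hj
    _ = (C * 2 ^ (2 * n + 2) : ℝ≥0) * ENNReal.ofReal 2 := by
        rw [ENNReal.tsum_mul_left, ← ENNReal.ofReal_tsum_of_nonneg (fun k => by positivity)
          hgeo.summable, hgeo.tsum_eq]
    _ < ∞ := ENNReal.mul_lt_top ENNReal.coe_lt_top ENNReal.ofReal_lt_top

/-- The weight paired with `|f|` in the estimate of the commutator. -/
noncomputable def logDensity (f : Cn n → ℂ) (w : Cn n) : ℝ≥0∞ :=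
  ‖f w‖ₑ * ENNReal.ofReal (logWeight (1 - ‖w‖))

lemma ae_ballVolume_norm_lt (n : ℕ) : ∀ᵐ w ∂(ballVolume n), ‖w‖ < 1 := by
  filter_upwards [ae_restrict_mem (μ := volume)
    (measurableSet_ball : MeasurableSet (unitBall n))] with w hw
  simpa [unitBall] using hw

/-- Young's inequality is applied to `‖f w‖ / c` for each admissible `c`. Its error term has a fixed
finite integral, so the bound is linear in `c` and passes to the infimum. -/
lemma exists_lintegral_logDensity_le (n : ℕ) :
    ∃ C : ℝ≥0, ∀ f : Cn (n + 1) → ℂ,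
      ∫⁻ w, logDensity f w ∂(ballVolume (n + 1)) ≤ C * llogLNorm f := by
  set J := ∫⁻ w, ENNReal.ofReal (√(1 - ‖w‖))⁻¹ ∂(ballVolume (n + 1)) with hJ
  have hJt : J ≠ ∞ := (lintegral_inv_sqrt_lt_top n).ne
  refine ⟨4 + 18 * J.toNNReal, fun f => ?_⟩
  have hK : (((4 + 18 * J.toNNReal : ℝ≥0)) : ℝ≥0∞) = 4 + 18 * J := by
    push_cast; rw [ENNReal.coe_toNNReal hJt]
  have hK0 : (4 : ℝ≥0∞) + 18 * J ≠ 0 := by simp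
  have hKt : (4 : ℝ≥0∞) + 18 * J ≠ ∞ := by
    rw [← hK]; exact ENNReal.coe_ne_top
  rw [hK, mul_comm, ← ENNReal.div_le_iff hK0 hKt]
  refine le_iInf fun c => le_iInf fun hc => le_iInf fun hle => ?_
  rw [ENNReal.div_le_iff hK0 hKt]
  calc ∫⁻ w, logDensity f w ∂(ballVolume (n + 1))
      ≤ ∫⁻ w, ENNReal.ofReal c * (4 * ENNReal.ofReal (youngLlogL (‖f w‖ / c)) +
          18 * ENNReal.ofReal (√(1 - ‖w‖))⁻¹) ∂(ballVolume (n + 1)) := by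
        refine lintegral_mono_ae ?_
        filter_upwards [ae_ballVolume_norm_lt (n + 1)] with w hw
        have h1 := mul_logWeight_le (t := ‖f w‖ / c) (d := 1 - ‖w‖) (by positivity) (by linarith)
          (by linarith [norm_nonneg w])
        have hyoung : 0 ≤ youngLlogL (‖f w‖ / c) := mul_nonneg (by positivity) Real.posLog_nonneg
        have e : logDensity f w =
            ENNReal.ofReal c * ENNReal.ofReal (‖f w‖ / c * logWeight (1 - ‖w‖)) := by
          rw [logDensity, ← ofReal_norm, ← ENNReal.ofReal_mul (by positivity),
            ← ENNReal.ofReal_mul hc.le]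
          congr 1
          field_simp
        rw [e]
        gcongr
        refine (ENNReal.ofReal_le_ofReal h1).trans (le_of_eq ?_)
        rw [ENNReal.ofReal_add (by positivity) (by positivity), ENNReal.ofReal_mul (by norm_num),
          ENNReal.ofReal_mul (by norm_num), ENNReal.ofReal_ofNat, ENNReal.ofReal_ofNat]
    _ = ENNReal.ofReal c * (4 * ∫⁻ w, ENNReal.ofReal (youngLlogL (‖f w‖ / c))
          ∂(ballVolume (n + 1)) + 18 * J) := by
        rw [lintegral_const_mul' _ _ ENNReal.ofReal_ne_top, lintegral_add_right,
          lintegral_const_mul' _ _ (by simp), lintegral_const_mul' _ _ (by simp)]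
        refine measurable_const.mul (ENNReal.measurable_ofReal.comp (Measurable.inv ?_))
        exact (by fun_prop : Continuous fun w : Cn (n + 1) => √(1 - ‖w‖)).measurable
    _ ≤ ENNReal.ofReal c * (4 * 1 + 18 * J) := by gcongr
    _ = _ := by rw [mul_one]

/-- For `k ≥ 1`, dividing the argument of `t log⁺ t` by `k` divides its value by at least `k`; hence
a finite integral can be brought below `1` by enlarging `c`. -/
lemma llogLNorm_lt_top {f : Cn n → ℂ} (hf : MemLlogL f) : llogLNorm f < ∞ := by
  obtain ⟨-, c, hc, hfin⟩ := hf
  set J := ∫⁻ z, ENNReal.ofReal (youngLlogL (‖f z‖ / c)) ∂(ballVolume n) with hJ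
  set k : ℝ := max 1 J.toReal with hk
  have hk1 : 1 ≤ k := le_max_left _ _
  have hk0 : 0 < k := by linarith
  have hle : ∫⁻ z, ENNReal.ofReal (youngLlogL (‖f z‖ / (c * k))) ∂(ballVolume n) ≤ 1 := by
    calc ∫⁻ z, ENNReal.ofReal (youngLlogL (‖f z‖ / (c * k))) ∂(ballVolume n)
        ≤ ∫⁻ z, ENNReal.ofReal k⁻¹ * ENNReal.ofReal (youngLlogL (‖f z‖ / c)) ∂(ballVolume n) := by
          refine lintegral_mono fun z => ?_
          rw [← ENNReal.ofReal_mul (inv_nonneg.2 hk0.le)]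
          apply ENNReal.ofReal_le_ofReal
          have h1 : ‖f z‖ / (c * k) = k⁻¹ * (‖f z‖ / c) := by field_simp
          have h2 : k⁻¹ * (‖f z‖ / c) ≤ ‖f z‖ / c :=
            mul_le_of_le_one_left (by positivity) (inv_le_one_of_one_le₀ hk1)
          rw [youngLlogL, youngLlogL, h1, mul_assoc]
          gcongr
      _ = ENNReal.ofReal k⁻¹ * J := lintegral_const_mul' _ _ ENNReal.ofReal_ne_top
      _ ≤ ENNReal.ofReal k⁻¹ * ENNReal.ofReal k := by
          gcongr
          rw [← ENNReal.ofReal_toReal hfin.ne]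
          exact ENNReal.ofReal_le_ofReal (le_max_right _ _)
      _ = 1 := by
          rw [← ENNReal.ofReal_mul (inv_nonneg.2 hk0.le), inv_mul_cancel₀ hk0.ne', ENNReal.ofReal_one]
  refine (iInf_le_of_le (c * k) (iInf_le_of_le (mul_pos hc hk0) (iInf_le _ hle))).trans_lt
    ENNReal.ofReal_lt_top

/-- The positive commutator kernel is dominated by the shell sum of the measure `|f| log dV`. -/
lemma lintegral_kernel_le_shellSum {f : Cn n → ℂ} {z : Cn n} (hz : ‖z‖ < 1) :
    ∫⁻ w, (ENNReal.ofReal (logWeight (1 - ‖z‖)) + ENNReal.ofReal (logWeight (1 - ‖w‖))) *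
      (‖f w‖ₑ * ENNReal.ofReal (korDist z w ^ (n + 1))⁻¹) ∂(ballVolume n) ≤
      2 * shellSum ((ballVolume n).withDensity (logDensity f)) z := by
  set d : ℝ := 1 - ‖z‖ with hd
  have hd0 : 0 < d := by rw [hd]; linarith
  have hd1 : d ≤ 1 := by rw [hd]; linarith [norm_nonneg z]
  set S : ℕ → Set (Cn n) := fun j => korShell j z ∩ {w | 2 ^ j * d ≤ korDist z w} with hS
  have hSm : ∀ j, MeasurableSet (S j) := fun j => (measurableSet_korShell j z).inter
    (isClosed_le continuous_const (continuous_korDist_right z)).measurableSet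
  have hcov : ∀ᵐ w ∂(ballVolume n), w ∈ ⋃ j, S j := by
    filter_upwards [ae_ballVolume_norm_lt n] with w hw
    have h1 := one_sub_norm_le_korDist (z := z) hw.le
    obtain ⟨j, hj1, hj2⟩ := exists_nat_pow_near (x := korDist z w / d) (y := (2 : ℝ))
      ((one_le_div₀ hd0).2 h1) one_lt_two
    rw [le_div_iff₀ hd0] at hj1
    rw [div_lt_iff₀ hd0] at hj2
    exact Set.mem_iUnion.2 ⟨j, ⟨hw, hj2⟩, hj1⟩
  have hj : ∀ j, ∫⁻ w in S j, (ENNReal.ofReal (logWeight d) +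
      ENNReal.ofReal (logWeight (1 - ‖w‖))) *
      (‖f w‖ₑ * ENNReal.ofReal (korDist z w ^ (n + 1))⁻¹) ∂(ballVolume n) ≤
      2 * ((j + 2 : ℝ≥0∞) * ENNReal.ofReal ((2 ^ j * d) ^ (n + 1))⁻¹ *
        (ballVolume n).withDensity (logDensity f) (korShell j z)) := by
    intro j
    have hjt : (2 : ℝ≥0∞) * ((j + 2 : ℝ≥0∞) * ENNReal.ofReal ((2 ^ j * d) ^ (n + 1))⁻¹) ≠ ∞ := by
      refine ENNReal.mul_ne_top (by simp) (ENNReal.mul_ne_top ?_ ENNReal.ofReal_ne_top)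
      exact_mod_cast ENNReal.natCast_ne_top (j + 2)
    calc _ ≤ ∫⁻ w in S j, 2 * ((j + 2 : ℝ≥0∞) * ENNReal.ofReal ((2 ^ j * d) ^ (n + 1))⁻¹) *
          logDensity f w ∂(ballVolume n) := by
          refine setLIntegral_mono' (hSm j) fun w hw => ?_
          have hw1 : ‖w‖ < 1 := hw.1.1
          have hw2 : korDist z w < 2 ^ (j + 1) * d := hw.1.2
          have hw3 : 2 ^ j * d ≤ korDist z w := hw.2
          have hdw : 1 - ‖w‖ ≤ korDist z w := by
            rw [korDist_comm]; exact one_sub_norm_le_korDist hz.le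
          have hlw : 1 ≤ logWeight (1 - ‖w‖) :=
            one_le_logWeight (by linarith) (by linarith [norm_nonneg w])
          -- The transfer of the logarithm from `z` to `w`: since `1 - ‖w‖ ≤ |1 - ⟨z, w⟩| < 2 ^ (j +
          -- 1) d`, the weight at `z` exceeds that at `w` by at most `(j + 1) log 2`, and the weight
          -- at `w` is at least `1`.
          have hlz : logWeight d ≤ (j + 2) * logWeight (1 - ‖w‖) := by
            have h1 := Real.log_le_log (by linarith) (hdw.trans hw2.le)
            rw [Real.log_mul (by positivity) hd0.ne', Real.log_pow] at h1
            have h2 := Real.log_two_lt_d9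
            have h3 : (0 : ℝ) ≤ j := by positivity
            push_cast at h1
            have h4 : logWeight d ≤ logWeight (1 - ‖w‖) + (j + 1) := by
              rw [logWeight, logWeight]
              nlinarith
            nlinarith
          have hsum : ENNReal.ofReal (logWeight d) + ENNReal.ofReal (logWeight (1 - ‖w‖)) ≤
              2 * (j + 2 : ℝ≥0∞) * ENNReal.ofReal (logWeight (1 - ‖w‖)) := by
            rw [← ENNReal.ofReal_add (by linarith [one_le_logWeight hd0.le hd1]) (by linarith),
              show (2 : ℝ≥0∞) * (j + 2) = ENNReal.ofReal (2 * (j + 2)) by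
                rw [ENNReal.ofReal_mul (by norm_num), ENNReal.ofReal_add (by positivity)
                  (by norm_num), ENNReal.ofReal_natCast, ENNReal.ofReal_ofNat],
              ← ENNReal.ofReal_mul (by positivity)]
            apply ENNReal.ofReal_le_ofReal
            have h3 : (0 : ℝ) ≤ j := by positivity
            nlinarith
          calc _ ≤ (2 * (j + 2 : ℝ≥0∞) * ENNReal.ofReal (logWeight (1 - ‖w‖))) *
                (‖f w‖ₑ * ENNReal.ofReal ((2 ^ j * d) ^ (n + 1))⁻¹) := by
                gcongr
            _ = _ := by rw [logDensity]; ring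
      _ ≤ ∫⁻ w in korShell j z, 2 * ((j + 2 : ℝ≥0∞) * ENNReal.ofReal ((2 ^ j * d) ^ (n + 1))⁻¹) *
          logDensity f w ∂(ballVolume n) := lintegral_mono_set Set.inter_subset_left
      _ = _ := by
          rw [lintegral_const_mul' _ _ hjt, withDensity_apply _ (measurableSet_korShell j z)]
          ring
  calc _ = ∫⁻ w in ⋃ j, S j, (ENNReal.ofReal (logWeight d) +
          ENNReal.ofReal (logWeight (1 - ‖w‖))) *
          (‖f w‖ₑ * ENNReal.ofReal (korDist z w ^ (n + 1))⁻¹) ∂(ballVolume n) := by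
        rw [Measure.restrict_eq_self_of_ae_mem hcov]
    _ ≤ _ := lintegral_iUnion_le _ _
    _ ≤ _ := ENNReal.tsum_le_tsum hj
    _ = _ := by rw [ENNReal.tsum_mul_left, shellSum]

lemma stronglyMeasurable_integral_kernel {f : Cn n → ℂ}
    (hf : AEStronglyMeasurable f (ballVolume n)) :
    StronglyMeasurable (bergmanProj f) := by
  obtain ⟨g, hg, hfg⟩ := hf
  have e : bergmanProj f = bergmanProj g := by
    funext z
    rw [bergmanProj, bergmanProj]
    congr 1
    refine integral_congr_ae ?_
    filter_upwards [hfg] with w hw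
    rw [hw]
  rw [e]
  have : SFinite (ballVolume n) := by unfold ballVolume; infer_instance
  refine StronglyMeasurable.const_mul ?_ _
  refine StronglyMeasurable.integral_prod_right
    (f := fun z w : Cn n => g w / (1 - pairing z w) ^ (n + 1)) ?_
  refine (Measurable.div ?_ ?_).stronglyMeasurable
  · exact hg.measurable.comp measurable_snd
  · exact ((continuous_const.sub continuous_pairing).pow (n + 1)).measurable

lemma integrable_div_kernel {f : Cn n → ℂ} (hf : Integrable f (ballVolume n)) {z : Cn n}
    (hz : ‖z‖ < 1) :
    Integrable (fun w => f w / (1 - pairing z w) ^ (n + 1)) (ballVolume n) := by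
  have hd0 : 0 < 1 - ‖z‖ := by linarith
  refine (hf.norm.mul_const ((1 - ‖z‖) ^ (n + 1))⁻¹).mono' ?_ ?_
  · have hm : Measurable fun w : Cn n => ((1 - pairing z w) ^ (n + 1))⁻¹ :=
      ((continuous_const.sub (continuous_pairing_right z)).pow (n + 1)).measurable.inv
    simp only [div_eq_mul_inv]
    exact hf.1.mul hm.aestronglyMeasurable
  · filter_upwards [ae_ballVolume_norm_lt n] with w hw
    have h1 := one_sub_norm_le_korDist (z := z) hw.le
    rw [norm_div, norm_pow, div_eq_mul_inv]
    change ‖f w‖ * (korDist z w ^ (n + 1))⁻¹ ≤ _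
    gcongr

lemma bergmanCommutator_eq_integral {g f : Cn n → ℂ} (hf : Integrable f (ballVolume n))
    (hgf : Integrable (fun w => g w * f w) (ballVolume n)) {z : Cn n} (hz : ‖z‖ < 1) :
    bergmanCommutator g f z = ((n.factorial : ℂ) / (Real.pi : ℂ) ^ n) *
      ∫ w, (g z - g w) * (f w / (1 - pairing z w) ^ (n + 1)) ∂(ballVolume n) := by
  rw [bergmanCommutator, bergmanProj, bergmanProj, mul_left_comm, ← mul_sub,
    ← integral_const_mul, ← integral_sub ((integrable_div_kernel hf hz).const_mul _)
      (integrable_div_kernel hgf hz)]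
  congr 2
  ext1 w
  ring

/-- The constant `c` cancels in `b z - b w`, and conjugation preserves the modulus of this
difference, so the growth bound at both points gives the positive kernel of
`lintegral_kernel_le_shellSum`. -/
lemma enorm_bergmanCommutator_le {b f : Cn n → ℂ} (hf : Integrable f (ballVolume n))
    (hbf : Integrable (fun w => starRingEnd ℂ (b w) * f w) (ballVolume n)) {c : ℂ} {B : ℝ≥0∞}
    (hB : B ≠ ∞) (hb : ∀ w : Cn n, ‖w‖ < 1 →
      ‖b w - c‖ₑ ≤ B * ENNReal.ofReal (logWeight (1 - ‖w‖))) {z : Cn n} (hz : ‖z‖ < 1) :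
    ‖bergmanCommutator (fun w => starRingEnd ℂ (b w)) f z‖ₑ ≤
      2 * ‖(n.factorial : ℂ) / (Real.pi : ℂ) ^ n‖ₑ * B *
        shellSum ((ballVolume n).withDensity (logDensity f)) z := by
  rw [bergmanCommutator_eq_integral hf hbf hz, enorm_mul]
  have key : ‖∫ w, (starRingEnd ℂ (b z) - starRingEnd ℂ (b w)) *
      (f w / (1 - pairing z w) ^ (n + 1)) ∂(ballVolume n)‖ₑ ≤
      B * (2 * shellSum ((ballVolume n).withDensity (logDensity f)) z) := by
    refine (enorm_integral_le_lintegral_enorm _).trans ?_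
    refine le_trans ?_ (mul_le_mul_right (lintegral_kernel_le_shellSum (f := f) hz) B)
    rw [← lintegral_const_mul' _ _ hB]
    refine lintegral_mono_ae ?_
    filter_upwards [ae_ballVolume_norm_lt n] with w hw
    have h0 : 0 < korDist z w := by
      have := one_sub_norm_le_korDist (z := z) hw.le
      linarith
    have h1 : ‖starRingEnd ℂ (b z) - starRingEnd ℂ (b w)‖ₑ ≤
        B * (ENNReal.ofReal (logWeight (1 - ‖z‖)) + ENNReal.ofReal (logWeight (1 - ‖w‖))) := by
      rw [← map_sub, ← ofReal_norm, RCLike.norm_conj, ofReal_norm, mul_add,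
        show b z - b w = (b z - c) - (b w - c) by ring]
      exact enorm_sub_le.trans (add_le_add (hb z hz) (hb w hw))
    have h2 : ‖f w / (1 - pairing z w) ^ (n + 1)‖ₑ =
        ‖f w‖ₑ * ENNReal.ofReal (korDist z w ^ (n + 1))⁻¹ := by
      rw [← ofReal_norm, norm_div, norm_pow, div_eq_mul_inv,
        ENNReal.ofReal_mul (norm_nonneg _), ofReal_norm]
      rfl
    rw [enorm_mul, h2]
    refine (mul_le_mul' h1 le_rfl).trans (le_of_eq ?_)
    ring
  calc _ ≤ ‖(n.factorial : ℂ) / (Real.pi : ℂ) ^ n‖ₑ *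
        (B * (2 * shellSum ((ballVolume n).withDensity (logDensity f)) z)) := by gcongr
    _ = _ := by ring

/-- The weak type bound for functions dominated by a shell sum. -/
lemma exists_weakL1Norm_le (n : ℕ) :
    ∃ C : ℝ≥0, ∀ (μ : Measure (Cn (n + 1))) [IsFiniteMeasure μ] (g : Cn (n + 1) → ℂ) (B : ℝ≥0),
      (∀ z : Cn (n + 1), ‖z‖ < 1 → ‖g z‖ₑ ≤ B * shellSum μ z) →
      weakL1Norm g ≤ C * B * μ Set.univ := by
  obtain ⟨C, hC⟩ := volume_shellSum_gt_le n
  refine ⟨C, fun μ _ g B hg => iSup₂_le fun t ht => ?_⟩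
  have hset : ballVolume (n + 1) {z | t < ‖g z‖} ≤ volume {z : Cn (n + 1) | ‖z‖ < 1 ∧ t < ‖g z‖} := by
    have hm : MeasurableSet (unitBall (n + 1)) := measurableSet_ball
    rw [ballVolume, Measure.restrict_apply' hm]
    exact measure_mono fun z hz => ⟨by simpa [unitBall] using hz.2, hz.1⟩
  have hgt : ∀ z : Cn (n + 1), ‖z‖ < 1 → t < ‖g z‖ → ENNReal.ofReal t < B * shellSum μ z := by
    intro z hz hlt
    refine lt_of_lt_of_le ?_ (hg z hz)
    rw [← ofReal_norm]
    exact (ENNReal.ofReal_lt_ofReal_iff (ht.trans hlt)).2 hlt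
  rcases eq_or_ne B 0 with hB | hB
  · have : {z : Cn (n + 1) | ‖z‖ < 1 ∧ t < ‖g z‖} = ∅ := by
      ext z
      simp only [Set.mem_ofPred_eq, Set.mem_empty_iff_false, iff_false, not_and]
      intro hz hlt
      have := hgt z hz hlt
      simp [hB] at this
    rw [this, measure_empty, nonpos_iff_eq_zero] at hset
    rw [hset, mul_zero]; exact zero_le
  · have hB0 : (0 : ℝ) < B := NNReal.coe_pos.2 (pos_iff_ne_zero.2 hB)
    have h1 := hC μ (t / B) (by positivity)
    calc ENNReal.ofReal t * ballVolume (n + 1) {z | t < ‖g z‖}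
        ≤ ENNReal.ofReal t * volume {z : Cn (n + 1) | ‖z‖ < 1 ∧
            ENNReal.ofReal (t / B) < shellSum μ z} := by
          refine mul_le_mul' le_rfl (hset.trans (measure_mono ?_))
          intro z hz
          refine ⟨hz.1, ?_⟩
          have := hgt z hz.1 hz.2
          rw [ENNReal.ofReal_div_of_pos hB0, ENNReal.ofReal_coe_nnreal]
          exact ENNReal.div_lt_of_lt_mul' this
      _ = B * (ENNReal.ofReal (t / B) * volume {z : Cn (n + 1) | ‖z‖ < 1 ∧
            ENNReal.ofReal (t / B) < shellSum μ z}) := by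
          rw [← mul_assoc, ← ENNReal.ofReal_coe_nnreal, ← ENNReal.ofReal_mul hB0.le,
            mul_div_cancel₀ _ hB0.ne']
      _ ≤ B * (C * μ Set.univ) := by gcongr
      _ = _ := by ring

lemma integrable_of_logDensity {f : Cn n → ℂ} (hf : AEStronglyMeasurable f (ballVolume n))
    (hfin : ∫⁻ w, logDensity f w ∂(ballVolume n) < ∞) : Integrable f (ballVolume n) := by
  refine ⟨hf, lt_of_le_of_lt (lintegral_mono_ae ?_) hfin⟩
  filter_upwards [ae_ballVolume_norm_lt n] with w hw
  rw [logDensity]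
  refine le_mul_of_one_le_right zero_le ?_
  rw [← ENNReal.ofReal_one]
  exact ENNReal.ofReal_le_ofReal (one_le_logWeight (by linarith) (by linarith [norm_nonneg w]))

lemma integrable_conj_mul_of_logDensity {b f : Cn n → ℂ} (hbc : ContinuousOn b (unitBall n))
    (hf : AEStronglyMeasurable f (ballVolume n))
    (hfin : ∫⁻ w, logDensity f w ∂(ballVolume n) < ∞) {c : ℂ} {B : ℝ≥0∞} (hB : B ≠ ∞)
    (hb : ∀ w : Cn n, ‖w‖ < 1 → ‖b w - c‖ₑ ≤ B * ENNReal.ofReal (logWeight (1 - ‖w‖))) :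
    Integrable (fun w => starRingEnd ℂ (b w) * f w) (ballVolume n) := by
  have hbm : AEStronglyMeasurable (fun w => starRingEnd ℂ (b w)) (ballVolume n) :=
    (Complex.continuous_conj.comp_continuousOn hbc).aestronglyMeasurable measurableSet_ball
  refine ⟨hbm.mul hf, lt_of_le_of_lt (b := ∫⁻ w, (B + ‖c‖ₑ) * logDensity f w ∂(ballVolume n))
    (lintegral_mono_ae ?_) ?_⟩
  · filter_upwards [ae_ballVolume_norm_lt n] with w hw
    have h1 : (1 : ℝ≥0∞) ≤ ENNReal.ofReal (logWeight (1 - ‖w‖)) := by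
      rw [← ENNReal.ofReal_one]
      exact ENNReal.ofReal_le_ofReal (one_le_logWeight (by linarith) (by linarith [norm_nonneg w]))
    have h2 : ‖b w‖ₑ ≤ (B + ‖c‖ₑ) * ENNReal.ofReal (logWeight (1 - ‖w‖)) := by
      calc ‖b w‖ₑ = ‖(b w - c) + c‖ₑ := by rw [sub_add_cancel]
        _ ≤ ‖b w - c‖ₑ + ‖c‖ₑ := enorm_add_le _ _
        _ ≤ B * ENNReal.ofReal (logWeight (1 - ‖w‖)) +
            ‖c‖ₑ * ENNReal.ofReal (logWeight (1 - ‖w‖)) :=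
          add_le_add (hb w hw) (le_mul_of_one_le_right zero_le h1)
        _ = _ := by ring
    have h3 : ‖starRingEnd ℂ (b w)‖ₑ = ‖b w‖ₑ := by
      rw [← ofReal_norm, RCLike.norm_conj, ofReal_norm]
    rw [enorm_mul, h3, logDensity]
    calc ‖b w‖ₑ * ‖f w‖ₑ ≤ (B + ‖c‖ₑ) * ENNReal.ofReal (logWeight (1 - ‖w‖)) * ‖f w‖ₑ := by gcongr
      _ = _ := by ring
  · have hBc : B + ‖c‖ₑ ≠ ∞ := ENNReal.add_ne_top.2 ⟨hB, enorm_ne_top⟩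
    rw [lintegral_const_mul' _ _ hBc]
    exact ENNReal.mul_lt_top hBc.lt_top hfin

end BergmanCommutator

theorem theoremF (n : ℕ) (hn : 1 ≤ n) :
    ∃ C : ℝ≥0, ∀ b : BergmanCommutator.Cn n → ℂ,
      InnerProductSpace.HarmonicOnNhd b (BergmanCommutator.unitBall n) →
      BergmanCommutator.MemBMO b →
      ∀ f : BergmanCommutator.Cn n → ℂ, BergmanCommutator.MemLlogL f →
        Integrable f (BergmanCommutator.ballVolume n) ∧
        Integrable (fun w => starRingEnd ℂ (b w) * f w) (BergmanCommutator.ballVolume n) ∧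
        BergmanCommutator.MemWeakL1
          (BergmanCommutator.bergmanCommutator (fun w => starRingEnd ℂ (b w)) f) ∧
        BergmanCommutator.weakL1Norm
            (BergmanCommutator.bergmanCommutator (fun w => starRingEnd ℂ (b w)) f) ≤
          (C : ℝ≥0∞) * BergmanCommutator.bmoNorm b * BergmanCommutator.llogLNorm f := by
  open BergmanCommutator in
  obtain ⟨m, rfl⟩ : ∃ m, n = m + 1 := ⟨n - 1, by omega⟩
  obtain ⟨C₁, hC₁⟩ := exists_enorm_sub_average_le m
  obtain ⟨C₂, hC₂⟩ := exists_lintegral_logDensity_le m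
  obtain ⟨C₃, hC₃⟩ := exists_weakL1Norm_le m
  set κ : ℝ≥0 := ‖((m + 1).factorial : ℂ) / (Real.pi : ℂ) ^ (m + 1)‖₊ with hκ
  refine ⟨C₃ * (2 * κ * C₁) * C₂, fun b hb hbmo f hf => ?_⟩
  have hβ := hbmo.2
  have hbc : ContinuousOn b (unitBall (m + 1)) := hb.continuousOn
  have hnorm := llogLNorm_lt_top hf
  have hfin : ∫⁻ w, logDensity f w ∂(ballVolume (m + 1)) < ∞ :=
    (hC₂ f).trans_lt (ENNReal.mul_lt_top ENNReal.coe_lt_top hnorm)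
  have hB : (C₁ : ℝ≥0∞) * bmoNorm b ≠ ∞ := ENNReal.mul_ne_top ENNReal.coe_ne_top hβ.ne
  have hgrowth := fun w hw => hC₁ b hb hβ w hw
  have hfi := integrable_of_logDensity hf.1 hfin
  have hbfi := integrable_conj_mul_of_logDensity hbc hf.1 hfin hB hgrowth
  have hfinm : IsFiniteMeasure ((ballVolume (m + 1)).withDensity (logDensity f)) :=
    isFiniteMeasure_withDensity hfin.ne
  have hβe : ((bmoNorm b).toNNReal : ℝ≥0∞) = bmoNorm b := ENNReal.coe_toNNReal hβ.ne
  have hweak : weakL1Norm (bergmanCommutator (fun w => starRingEnd ℂ (b w)) f) ≤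
      ((C₃ * (2 * κ * C₁) * C₂ : ℝ≥0) : ℝ≥0∞) * bmoNorm b * llogLNorm f := by
    have h1 := hC₃ ((ballVolume (m + 1)).withDensity (logDensity f))
      (bergmanCommutator (fun w => starRingEnd ℂ (b w)) f)
      (2 * κ * (C₁ * (bmoNorm b).toNNReal)) (fun z hz => by
        refine (enorm_bergmanCommutator_le hfi hbfi hB hgrowth hz).trans (le_of_eq ?_)
        push_cast
        rw [hβe]
        rfl)
    rw [withDensity_apply _ MeasurableSet.univ, Measure.restrict_univ] at h1
    refine h1.trans ?_
    calc _ ≤ (C₃ : ℝ≥0∞) * ((2 * κ * (C₁ * (bmoNorm b).toNNReal) : ℝ≥0) : ℝ≥0∞) *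
          (C₂ * llogLNorm f) := by gcongr; exact hC₂ f
      _ = _ := by push_cast; rw [hβe]; ring
  refine ⟨hfi, hbfi, ⟨?_, hweak.trans_lt ?_⟩, hweak⟩
  · refine AEStronglyMeasurable.sub (AEStronglyMeasurable.mul ?_ ?_) ?_
    · exact (Complex.continuous_conj.comp_continuousOn hbc).aestronglyMeasurable measurableSet_ball
    · exact (stronglyMeasurable_integral_kernel hf.1).aestronglyMeasurable
    · exact (stronglyMeasurable_integral_kernel hbfi.1).aestronglyMeasurable
  · exact ENNReal.mul_lt_top (ENNReal.mul_lt_top ENNReal.coe_lt_top hβ) hnorm
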